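/- **Setting.** Let $m\ge 3$ and $k\ge 1$ be integers. Let $\mathcal H_k$ be the space of real-valued harmonic polynomials on $\mathbb R^m$ that are homogeneous of degree $k$. Write $\mathbb B^m$ and $\mathbb S^{m-1}$ for the open unit ball and the unit sphere of $\mathbb R^m$, $dS$ for surface measure on $\mathbb S^{m-1}$, and $\omega_m$ for its total mass. Points of the upper half-space $\mathbb R^m_+$ are written $x=(x',y)$ with $x'\in\mathbb R^{m-1}$, $y>0$. A function with slices in $\mathcal H_k$ is extended in its second variable from $\mathbb B^m$ to $\mathbb R^m$ as a polynomial. For smooth $F(x,u)$ with $F(x,\cdot)\in\mathcal H_k$, the bosonic Laplacian is $$\mathcal D_kF=\Delta_xF-\frac{4\,\langle u,D_x\rangle\langle D_u,D_x\rangle F}{m+2k-2}+\frac{4|u|^2\langle D_u,D_x\rangle^2F}{(m+2k-2)(m+2k-4)},$$ where $\langle u,D_x\rangle=\sum_j u_j\partial_{x_j}$ and $\langle D_u,D_x\rangle=\sum_j\partial_{u_j}\partial_{x_j}$. Let $Z_k(u,v)$ be the reproducing kernel of $\mathcal H_k$: $Z_k(\cdot,v)\in\mathcal H_k$ and $\int_{\mathbb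 S^{m-1}}Z_k(u,v)h(u)\,dS(u)=h(v)$ for all $h\in\mathcal H_k$. For $x\neq0$ let $R_xu=u-2\frac{\langle u,x\rangle}{|x|^2}x$ (which equals $xux/|x|^2$ in the Clifford algebra with $x^2=-|x|^2$). The Poisson kernel of $\mathbb R^m_+$ is $$P_H(x,t,u,v)=c_{m,k}\,\frac{y}{|x-t|^m}\,Z_k\big(R_{x-t}u,v\big),\qquad t=(t',0),\qquad c_{m,k}=\frac{2(m+2k-2)}{(m-2)\,\omega_m}.$$ For $1\le p<\infty$ let $L^p(\mathbb R^{m-1}\times\mathbb B^m,\mathcal H_k)$ be the set of Borel measurable $f$ on $\mathbb R^{m-1}\times\mathbb B^m$ with $f(x',\cdot)\in\mathcal H_k$ for every $x'$ and $$\|f\|_p=\Big(\int_{\mathbb R^{m-1}}\int_{\mathbb S^{m-1}}|f(x',u)|^p\,dS(u)\,dx'\Big)^{1/p}<\infty .$$ Its Poisson integral is $$P_H[f](x,v)=\int_{\mathbb R^{m-1}}\int_{\mathbb S^{m-1}}P_H(x,t,u,v)\,f(t',u)\,dS(u)\,dt'.$$ **Theorem (Dirichlet problem with $L^p$ data in the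 upper half-space).** There is a constant $c'_{m,k}>0$, depending only on $m$ and $k$, such that the following holds for all $1\le p<\infty$ and all $f\in L^p(\mathbb R^{m-1}\times\mathbb B^m,\mathcal H_k)$. The integral $g=P_H[f]$ converges absolutely for all $x\in\mathbb R^m_+$ and all $v$; it is a $C^\infty$ function of $(x,v)$ with $g(x,\cdot)\in\mathcal H_k$ for every $x\in\mathbb R^m_+$; and, with $g_y(x',v)=g((x',y),v)$: 1. $\mathcal D_kg=0$ in $\mathbb R^m_+\times\mathbb B^m$. 2. For every $y>0$, $g_y\in L^p(\mathbb R^{m-1}\times\mathbb B^m,\mathcal H_k)$ and $\|g_y\|_p\le c'_{m,k}\|f\|_p$. 3. $\|g_y-f\|_p\to0$ as $y\to0^+$. -/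

import Mathlib

open MeasureTheory Set Filter Topology
open scoped ENNReal NNReal

namespace Bosonic

noncomputable section

/-- Euclidean space `ℝ^m`. -/
abbrev E (m : ℕ) : Type := EuclideanSpace ℝ (Fin m)

/-- The surface measure `dS` on the unit sphere of `ℝ^m` (not normalized: its total mass is the
surface area of the sphere). -/
def surf (m : ℕ) : Measure (Metric.sphere (0 : E m) 1) := (volume : Measure (E m)).toSphere

/-- The surface area `ω_m` of the unit sphere of `ℝ^m`. -/
def sphereArea (m : ℕ) : ℝ := (surf m).real univ

/-- The Laplacian on polynomials in `m` variables. -/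
def polyLaplacian (m : ℕ) : MvPolynomial (Fin m) ℝ →ₗ[ℝ] MvPolynomial (Fin m) ℝ :=
  ∑ j, (MvPolynomial.pderiv j).toLinearMap ∘ₗ (MvPolynomial.pderiv j).toLinearMap

/-- The polynomial function on `ℝ^m` given by a polynomial. -/
def polyFun (m : ℕ) : MvPolynomial (Fin m) ℝ →ₗ[ℝ] (E m → ℝ) :=
  LinearMap.pi fun u => (MvPolynomial.aeval fun j => u j).toLinearMap

/-- `ℋ_k`: the real-valued harmonic polynomials on `ℝ^m` that are homogeneous of degree `k`, as
functions on `ℝ^m`. -/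
def Harm (m k : ℕ) : Submodule ℝ (E m → ℝ) :=
  (MvPolynomial.homogeneousSubmodule (Fin m) ℝ k ⊓ LinearMap.ker (polyLaplacian m)).map (polyFun m)

instance (m k : ℕ) : FiniteDimensional ℝ (Harm m k) := by
  have h : FiniteDimensional ℝ (MvPolynomial.homogeneousSubmodule (Fin m) ℝ k) :=
    Module.Finite.iff_fg.mpr (MvPolynomial.homogeneousSubmodule_fg _ _ k)
  have h2 : FiniteDimensional ℝ
      ↥(MvPolynomial.homogeneousSubmodule (Fin m) ℝ k ⊓ LinearMap.ker (polyLaplacian m)) :=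
    Submodule.finiteDimensional_inf_left _ _
  unfold Harm
  infer_instance

lemma Harm.continuous {m k : ℕ} {q : E m → ℝ} (hq : q ∈ Harm m k) : Continuous q := by
  obtain ⟨P, -, rfl⟩ := hq
  have : polyFun m P = fun u : E m => MvPolynomial.eval (fun j => u j) P := by
    ext u; simp [polyFun, MvPolynomial.aeval_def, MvPolynomial.eval₂_eq', MvPolynomial.eval_eq']
  rw [this]
  exact (MvPolynomial.continuous_eval P).comp (by fun_prop)

lemma Harm.smul_apply {m k : ℕ} {q : E m → ℝ} (hq : q ∈ Harm m k) (r : ℝ) (u : E m) :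
    q (r • u) = r ^ k * q u := by
  obtain ⟨P, ⟨hP, -⟩, rfl⟩ := hq
  have hP' : P.IsHomogeneous k := hP
  have key : ∀ w : E m, polyFun m P w = ∑ d ∈ P.support, P.coeff d * ∏ i, w i ^ d i := by
    intro w
    simp [polyFun, MvPolynomial.aeval_def, MvPolynomial.eval₂_eq']
  rw [key, key, Finset.mul_sum]
  refine Finset.sum_congr rfl fun d hd => ?_
  have hdeg : ∑ i, d i = k := by
    have := hP' (MvPolynomial.mem_support_iff.mp hd)
    rw [← this, Finsupp.weight_apply, Finsupp.sum_fintype] <;> simp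
  simp only [PiLp.smul_apply, smul_eq_mul, mul_pow, Finset.prod_mul_distrib,
    Finset.prod_pow_eq_pow_sum, hdeg]
  ring

lemma integrable_sphere {m : ℕ} {φ : E m → ℝ} (h : Continuous φ) :
    Integrable (fun u : Metric.sphere (0 : E m) 1 => φ u) (surf m) := by
  have : IsFiniteMeasure (surf m) := by unfold surf; infer_instance
  exact (h.comp continuous_subtype_val).integrable_of_hasCompactSupport
    (HasCompactSupport.of_compactSpace _)

/-- The pairing `(q, f) ↦ ∫_{S^{m-1}} q(u) f(u) dS(u)` on `ℋ_k`, as a map from `ℋ_k` to its dual. -/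
def spherePairing (m k : ℕ) : Harm m k →ₗ[ℝ] Module.Dual ℝ (Harm m k) :=
  LinearMap.mk₂ ℝ
    (fun q f => ∫ u : Metric.sphere (0 : E m) 1, (q : E m → ℝ) u * (f : E m → ℝ) u ∂(surf m))
    (fun a b c => by
      refine Eq.trans ?_ (integral_add
        (integrable_sphere ((Harm.continuous a.2).mul (Harm.continuous c.2)))
        (integrable_sphere ((Harm.continuous b.2).mul (Harm.continuous c.2))))
      simp [add_mul])
    (fun r a b => by
      rw [smul_eq_mul, ← integral_const_mul]
      simp [mul_assoc])
    (fun a b c => by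
      refine Eq.trans ?_ (integral_add
        (integrable_sphere ((Harm.continuous a.2).mul (Harm.continuous b.2)))
        (integrable_sphere ((Harm.continuous a.2).mul (Harm.continuous c.2))))
      simp [mul_add])
    (fun r a b => by
      rw [smul_eq_mul, ← integral_const_mul]
      simp [mul_left_comm])

lemma spherePairing_injective (m k : ℕ) [NeZero m] : Function.Injective (spherePairing m k) := by
  rw [← LinearMap.ker_eq_bot, LinearMap.ker_eq_bot']
  intro q hq
  have : IsFiniteMeasure (surf m) := by unfold surf; infer_instance
  have : (surf m).IsOpenPosMeasure := by unfold surf; infer_instance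
  have hc := Harm.continuous q.2
  have h0 : ∫ u : Metric.sphere (0 : E m) 1, (q : E m → ℝ) u * (q : E m → ℝ) u ∂(surf m) = 0 :=
    LinearMap.congr_fun hq q
  rw [integral_eq_zero_iff_of_nonneg (fun u => mul_self_nonneg _)
    (integrable_sphere (hc.mul hc))] at h0
  have hs : Continuous fun u : Metric.sphere (0 : E m) 1 => (q : E m → ℝ) u * (q : E m → ℝ) u :=
    (hc.mul hc).comp continuous_subtype_val
  have h1 := (Continuous.ae_eq_iff_eq (surf m) hs continuous_zero).mp h0
  have h2 : ∀ u : E m, ‖u‖ = 1 → (q : E m → ℝ) u = 0 := fun u hu =>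
    mul_self_eq_zero.mp (congrFun h1 ⟨u, by simpa using hu⟩)
  have h3 : ∀ (r : ℝ) (u : E m), ‖u‖ = 1 → (q : E m → ℝ) (r • u) = 0 := fun r u hu => by
    rw [Harm.smul_apply q.2, h2 u hu, mul_zero]
  apply Subtype.ext
  funext u
  by_cases hu : u = 0
  · have := h3 0 (EuclideanSpace.single 0 1) (by simp)
    simpa [hu] using this
  · have hu' : ‖u‖ ≠ 0 := norm_ne_zero_iff.mpr hu
    have := h3 ‖u‖ (‖u‖⁻¹ • u) (by rw [norm_smul, norm_inv, norm_norm, inv_mul_cancel₀ hu'])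
    simpa [smul_smul, hu'] using this

/-- The isomorphism of `ℋ_k` with its dual given by integration over the sphere. -/
def sphereDual (m k : ℕ) [NeZero m] : Harm m k ≃ₗ[ℝ] Module.Dual ℝ (Harm m k) :=
  LinearMap.linearEquivOfInjective (spherePairing m k) (spherePairing_injective m k)
    Subspace.dual_finrank_eq.symm

/-- The reproducing kernel `Z_k(u, v)` of `ℋ_k`: for fixed `v`, `Z_k(·, v)` is the element of
`ℋ_k` that represents evaluation at `v` with respect to integration over the sphere. -/
def Z (m k : ℕ) [NeZero m] (u v : E m) : ℝ :=
  ((sphereDual m k).symm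
    ((LinearMap.proj v : (E m → ℝ) →ₗ[ℝ] ℝ) ∘ₗ (Harm m k).subtype) : E m → ℝ) u

lemma Z_mem (m k : ℕ) [NeZero m] (v : E m) : (fun u => Z m k u v) ∈ Harm m k :=
  ((sphereDual m k).symm
    ((LinearMap.proj v : (E m → ℝ) →ₗ[ℝ] ℝ) ∘ₗ (Harm m k).subtype)).2

lemma Z_reproducing (m k : ℕ) [NeZero m] (f : E m → ℝ) (hf : f ∈ Harm m k) (v : E m) :
    ∫ u : Metric.sphere (0 : E m) 1, Z m k u v * f u ∂(surf m) = f v := by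
  have h := (sphereDual m k).apply_symm_apply
    ((LinearMap.proj v : (E m → ℝ) →ₗ[ℝ] ℝ) ∘ₗ (Harm m k).subtype)
  exact LinearMap.congr_fun h ⟨f, hf⟩

/-- `x u x / |x|²`, where the products are taken in the Clifford algebra with `x² = -|x|²`. -/
def reflect {m : ℕ} (x u : E m) : E m := u - (2 * inner ℝ u x / ‖x‖ ^ 2) • x

lemma clifford_reflect {m : ℕ} (x u : E m) (hx : x ≠ 0) :
    let Q : QuadraticForm ℝ (E m) := -LinearMap.BilinMap.toQuadraticMap (innerₗ (E m))
    CliffordAlgebra.ι Q (reflect x u) =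
      (‖x‖ ^ 2)⁻¹ • (CliffordAlgebra.ι Q x * CliffordAlgebra.ι Q u * CliffordAlgebra.ι Q x) := by
  intro Q
  have hx' : ‖x‖ ^ 2 ≠ 0 := by simpa using hx
  rw [CliffordAlgebra.ι_mul_ι_mul_ι, ← map_smul]
  congr 1
  have hQ : Q x = -‖x‖ ^ 2 := by simp [Q]
  have hp : QuadraticMap.polar Q x u = -2 * inner ℝ u x := by
    simp only [QuadraticMap.polar, Q, neg_apply,
      LinearMap.BilinMap.toQuadraticMap_apply, innerₗ_apply_apply, inner_add_left, inner_add_right, real_inner_comm u x]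
    ring
  rw [hQ, hp, smul_sub, smul_smul, smul_smul, reflect, sub_eq_add_neg, add_comm, ← neg_smul,
    sub_eq_add_neg, ← neg_smul]
  congr 2
  · field_simp
  · rw [mul_neg, neg_neg, inv_mul_cancel₀ hx', one_smul]

/-- The partial derivative `∂F/∂x_j` of a function `F(x, u)`. -/
def dx {m : ℕ} (j : Fin m) (F : E m → E m → ℝ) : E m → E m → ℝ :=
  fun x u => lineDeriv ℝ (fun z => F z u) x (EuclideanSpace.single j 1)

/-- The partial derivative `∂F/∂u_j` of a function `F(x, u)`. -/
def du {m : ℕ} (j : Fin m) (F : E m → E m → ℝ) : E m → E m → ℝ :=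
  fun x u => lineDeriv ℝ (fun w => F x w) u (EuclideanSpace.single j 1)

/-- `⟨u, D_x⟩ F = ∑ j, u_j ∂F/∂x_j`. -/
def uDx {m : ℕ} (F : E m → E m → ℝ) : E m → E m → ℝ :=
  fun x u => ∑ j, u j * dx j F x u

/-- `⟨D_u, D_x⟩ F = ∑ j, ∂²F/∂u_j∂x_j`. -/
def DuDx {m : ℕ} (F : E m → E m → ℝ) : E m → E m → ℝ :=
  fun x u => ∑ j, du j (dx j F) x u

/-- The bosonic Laplacian
`𝒟_k = Δ_x - 4⟨u,D_x⟩⟨D_u,D_x⟩/(m+2k-2) + 4|u|²⟨D_u,D_x⟩²/((m+2k-2)(m+2k-4))`. -/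
def bosonicLaplacian (m k : ℕ) (F : E m → E m → ℝ) : E m → E m → ℝ := fun x u =>
  ∑ j, dx j (dx j F) x u
    - 4 / ((m : ℝ) + 2 * k - 2) * uDx (DuDx F) x u
    + 4 * ‖u‖ ^ 2 / (((m : ℝ) + 2 * k - 2) * ((m : ℝ) + 2 * k - 4)) * DuDx (DuDx F) x u

/-- The upper half-space of `ℝ^m`, `m = n + 1`: the last coordinate is positive. -/
def upperHalf (n : ℕ) : Set (E (n + 1)) := {x | 0 < x (Fin.last n)}

/-- The point `(x', y)` of `ℝ^m`, `m = n + 1`, for `x' ∈ ℝ^{m-1}` and `y ∈ ℝ`. -/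
def join {n : ℕ} (x' : E n) (y : ℝ) : E (n + 1) :=
  WithLp.toLp 2 (Fin.snoc (α := fun _ => ℝ) (fun i => x' i) y)

/-- `c_{m,k} = 2(m+2k-2) / ((m-2) ω_m)`. -/
def cConst (m k : ℕ) : ℝ := 2 * ((m : ℝ) + 2 * k - 2) / (((m : ℝ) - 2) * sphereArea m)

/-- The Poisson kernel of the upper half-space of `ℝ^m`, `m = n + 1`, with `t = (t', 0)`:
`P_H(x, t, u, v) = c_{m,k} y |x-t|^{-m} Z_k((x-t)u(x-t)/|x-t|², v)`. -/
def poissonKernel (n k : ℕ) (x : E (n + 1)) (t' : E n) (u v : E (n + 1)) : ℝ :=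
  cConst (n + 1) k * (x (Fin.last n) / ‖x - join t' 0‖ ^ (n + 1)) *
    Z (n + 1) k (reflect (x - join t' 0) u) v

/-- The Poisson integral
`P_H[f](x, v) = ∫_{ℝ^{m-1}} ∫_{S^{m-1}} P_H(x, t, u, v) f(t', u) dS(u) dt'`, `m = n + 1`. -/
def poissonIntegral (n k : ℕ) (f : E n → E (n + 1) → ℝ) (x v : E (n + 1)) : ℝ :=
  ∫ t' : E n, ∫ u : Metric.sphere (0 : E (n + 1)) 1,
    poissonKernel n k x t' u v * f t' u ∂(surf (n + 1))

/-- The norm `(∫_{ℝ^{m-1}} ∫_{S^{m-1}} |f(x', u)|^p dS(u) dx')^{1/p}`, `m = n + 1`. -/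
def normLp (n : ℕ) (p : ℝ≥0∞) (f : E n → E (n + 1) → ℝ) : ℝ≥0∞ :=
  eLpNorm (fun z : E n × Metric.sphere (0 : E (n + 1)) 1 => f z.1 z.2) p
    ((volume : Measure (E n)).prod (surf (n + 1)))

/-- `f ∈ L^p(ℝ^{m-1} × 𝔹^m, ℋ_k)`, `m = n + 1`. A function on `ℝ^{m-1} × 𝔹^m` whose slices
`f(x', ·)` are homogeneous harmonic polynomials is identified with its polynomial extension to
`ℝ^{m-1} × ℝ^m`. -/
structure MemLpHarm (n k : ℕ) (p : ℝ≥0∞) (f : E n → E (n + 1) → ℝ) : Prop where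
  mem_harm : ∀ x', f x' ∈ Harm (n + 1) k
  measurable : Measurable fun z : E n × Metric.ball (0 : E (n + 1)) 1 => f z.1 z.2
  normLp_lt_top : normLp n p f < ∞

end

end Bosonic

/-! ### Polynomial functions and harmonic polynomials -/

namespace Bosonic

noncomputable section

/-! Write m = n + 1 and let R_z be the reflection in z. It is an involutive linear isometry, so it
preserves both dS and ℋ_k. Moving it from the kernel to the data and applying the reproducing
property removes the integral over the sphere: P_H[f](x, v) is the integral of c y |x - t|^{-m} f(t,
R_{x-t} v) over t (`poissonIntegral_eq`). With t = x' - y s one has x - t = y (s, 1), and R does not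
see the factor y. Hence P_H[f]((x', y), v) = ∫ f(x' - y s, R_{(s,1)} v) dν(s), where the finite
measure ν depends on neither y nor f (`poissonIntegral_join`).

The norm estimates follow from this average. For fixed s, translating and reflecting f leaves its
norm unchanged, so Jensen's inequality bounds the slices by the mass of ν. Moreover ∫ h(R_{(s,1)} v)
dν(s) = h(v) for h in ℋ_k (`integral_weight_mul`), so g_y - f is the ν-average of reflected
differences f(x' - y s, ·) - f(x', ·). Continuity of translations in L^p and dominated convergence
make it tend to zero.

The reproducing identity is obtained from Gaussian integrals. The function |x|^{2k} h(R_x v) is a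
polynomial in x. Integrating it by parts against exp(-|x|²) shows, by induction on k, that its
Gaussian integral is an explicit multiple of h(v) (`gaussInt_refl`). Substituting x = s (t, 1) and
integrating in s turns the same Gaussian integral into an integral over t against |(t, 1)|^{-m}
(`gaussInt_eq_integral_join`). Comparing the two gives exactly the constant c_{m,k}.

For the differential equation, a direct computation shows that x_m |x|^{-m} P(R_x u) is a null
solution for every harmonic P of degree k (`bosonicLaplacian_kelvin`). To bring the operator under
the integral, elements of ℋ_k are interpolated from finitely many nodes. The Poisson integral
becomes a finite sum of products: a fixed polynomial in v times x_m times a scalar integral with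
kernel Q(x - t) |x - t|^{-s}. Derivatives of such kernels have the same form and decay at least as
fast, which gives smoothness (`contDiffOn_kerInt`). The operator acts on such sums through second
derivatives in x, so the pointwise identity for the kernel integrates to 𝒟_k g = 0. -/

open MvPolynomial in
lemma polyFun_apply {m : ℕ} (P : MvPolynomial (Fin m) ℝ) (u : E m) :
    polyFun m P u = eval (fun j => u j) P := by
  simp [polyFun, aeval_def, eval₂_eq', eval_eq']

@[simp] lemma polyFun_X {m : ℕ} (j : Fin m) (u : E m) : polyFun m (MvPolynomial.X j) u = u j := by
  simp [polyFun_apply]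

@[simp] lemma polyFun_C {m : ℕ} (a : ℝ) (u : E m) : polyFun m (MvPolynomial.C a) u = a := by
  simp [polyFun_apply]

@[simp] lemma polyFun_mul {m : ℕ} (P Q : MvPolynomial (Fin m) ℝ) (u : E m) :
    polyFun m (P * Q) u = polyFun m P u * polyFun m Q u := by
  simp [polyFun_apply]

lemma polyFun_sum {m : ℕ} {ι : Type*} (s : Finset ι) (P : ι → MvPolynomial (Fin m) ℝ) (u : E m) :
    polyFun m (∑ i ∈ s, P i) u = ∑ i ∈ s, polyFun m (P i) u := by
  simp [polyFun_apply]

lemma continuous_polyFun {m : ℕ} (P : MvPolynomial (Fin m) ℝ) : Continuous (polyFun m P) := by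
  have : polyFun m P = fun u : E m => MvPolynomial.eval (fun j => u j) P :=
    funext (polyFun_apply P)
  rw [this]
  exact (MvPolynomial.continuous_eval P).comp (by fun_prop)

/-- The coordinate functional on `ℝ^m`. -/
abbrev coord {m : ℕ} (j : Fin m) : E m →L[ℝ] ℝ := EuclideanSpace.proj j

lemma hasFDerivAt_polyFun {m : ℕ} (P : MvPolynomial (Fin m) ℝ) (u : E m) :
    HasFDerivAt (polyFun m P)
      (∑ j, polyFun m (MvPolynomial.pderiv j P) u • coord j) u := by
  induction P using MvPolynomial.induction_on with
  | C a =>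
    have : polyFun m (MvPolynomial.C a) = fun _ => a := by ext; simp
    rw [this]
    simpa using hasFDerivAt_const a u
  | add P Q hP hQ => simpa [add_smul, Finset.sum_add_distrib] using hP.add hQ
  | mul_X P i hP =>
    have hX : HasFDerivAt (fun u : E m => u i) (coord i : E m →L[ℝ] ℝ) u :=
      (coord i : E m →L[ℝ] ℝ).hasFDerivAt
    have hfun : polyFun m (P * MvPolynomial.X i) = fun u => polyFun m P u * u i := by ext; simp
    rw [hfun]
    convert! hP.mul hX using 1
    simp only [Derivation.leibniz, MvPolynomial.pderiv_X, smul_eq_mul, map_add, Pi.add_apply,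
      polyFun_mul, polyFun_X, add_smul, Finset.sum_add_distrib, Finset.smul_sum, smul_smul]
    congr 1
    rw [Finset.sum_eq_single i]
    · simp [polyFun_apply]
    · intro j _ hj
      simp [Ne.symm hj, polyFun_apply]
    · simp

lemma contDiff_polyFun {m : ℕ} (P : MvPolynomial (Fin m) ℝ) {N : WithTop ℕ∞} :
    ContDiff ℝ N (polyFun m P) := by
  induction P using MvPolynomial.induction_on with
  | C a =>
    have : polyFun m (MvPolynomial.C a) = fun _ => a := by ext; simp
    rw [this]
    exact contDiff_const
  | add P Q hP hQ =>
    rw [map_add]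
    exact hP.add hQ
  | mul_X P i hP =>
    have hfun : polyFun m (P * MvPolynomial.X i) = fun u => polyFun m P u * coord i u := by
      ext; simp
    rw [hfun]
    exact hP.mul (coord i).contDiff

lemma hasDerivAt_polyFun_comp {m : ℕ} (P : MvPolynomial (Fin m) ℝ) {γ : ℝ → E m} {γ' : Fin m → ℝ}
    {τ : ℝ} (h : ∀ j, HasDerivAt (fun s => γ s j) (γ' j) τ) :
    HasDerivAt (fun s => polyFun m P (γ s))
      (∑ j, polyFun m (MvPolynomial.pderiv j P) (γ τ) * γ' j) τ := by
  have hγ : HasDerivAt γ (WithLp.toLp 2 γ') τ := by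
    have h1 : HasDerivAt (fun s j => γ s j) γ' τ := hasDerivAt_pi.2 h
    exact (PiLp.continuousLinearEquiv 2 ℝ fun _ : Fin m => ℝ).symm.toContinuousLinearMap.hasFDerivAt
      |>.comp_hasDerivAt τ h1
  have := (hasFDerivAt_polyFun P (γ τ)).comp_hasDerivAt τ hγ
  simpa [Function.comp_def] using this

lemma pderiv_pderiv_comm {m : ℕ} (i j : Fin m) (P : MvPolynomial (Fin m) ℝ) :
    MvPolynomial.pderiv i (MvPolynomial.pderiv j P) =
      MvPolynomial.pderiv j (MvPolynomial.pderiv i P) := by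
  induction P using MvPolynomial.induction_on with
  | C a => simp
  | add P Q hP hQ => simp [hP, hQ]
  | mul_X P l hP =>
    classical
    simp only [Derivation.leibniz, MvPolynomial.pderiv_X, smul_eq_mul, map_add, hP, Pi.single_apply]
    split_ifs <;> simp <;> ring

/-- A harmonic polynomial, homogeneous of degree `k`. -/
structure IsHarmPoly {m : ℕ} (P : MvPolynomial (Fin m) ℝ) (k : ℕ) : Prop where
  homogeneous : P.IsHomogeneous k
  laplacian : polyLaplacian m P = 0

lemma mem_Harm_iff {m k : ℕ} {h : E m → ℝ} :
    h ∈ Harm m k ↔ ∃ P : MvPolynomial (Fin m) ℝ, IsHarmPoly P k ∧ polyFun m P = h := by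
  constructor
  · rintro ⟨P, ⟨h1, h2⟩, rfl⟩
    exact ⟨P, ⟨h1, h2⟩, rfl⟩
  · rintro ⟨P, ⟨h1, h2⟩, rfl⟩
    exact ⟨P, ⟨h1, h2⟩, rfl⟩

lemma polyLaplacian_apply {m : ℕ} (P : MvPolynomial (Fin m) ℝ) :
    polyLaplacian m P = ∑ j, MvPolynomial.pderiv j (MvPolynomial.pderiv j P) := by
  simp [polyLaplacian]

namespace IsHarmPoly

variable {m k : ℕ} {P : MvPolynomial (Fin m) ℝ}

/-- The truncated degree is harmless: for k = 0 the derivative is the zero polynomial. -/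
lemma pderiv (h : IsHarmPoly P k) (j : Fin m) : IsHarmPoly (MvPolynomial.pderiv j P) (k - 1) := by
  refine ⟨h.homogeneous.pderiv, ?_⟩
  have h2 := h.laplacian
  rw [polyLaplacian_apply] at h2 ⊢
  have : ∀ i, MvPolynomial.pderiv i (MvPolynomial.pderiv i (MvPolynomial.pderiv j P)) =
      MvPolynomial.pderiv j (MvPolynomial.pderiv i (MvPolynomial.pderiv i P)) := fun i => by
    rw [pderiv_pderiv_comm i j P, pderiv_pderiv_comm i j]
  simp_rw [this, ← map_sum, h2, map_zero]

lemma sum_pderiv_pderiv (h : IsHarmPoly P k) (u : E m) :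
    ∑ j, polyFun m (MvPolynomial.pderiv j (MvPolynomial.pderiv j P)) u = 0 := by
  have h2 := h.laplacian
  rw [polyLaplacian_apply] at h2
  rw [← polyFun_sum, h2, map_zero, Pi.zero_apply]

lemma euler (h : IsHarmPoly P k) (u : E m) :
    ∑ j, u j * polyFun m (MvPolynomial.pderiv j P) u = k * polyFun m P u := by
  have := congrArg (fun Q => polyFun m Q u) h.homogeneous.sum_X_mul_pderiv
  rw [map_nsmul, Pi.smul_apply, nsmul_eq_mul] at this
  simpa only [polyFun_sum, polyFun_mul, polyFun_X] using this

end IsHarmPoly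

/-! ### Isometries and reflections acting on harmonic polynomials -/

/-- The matrix of a linear isometry, acting on polynomials by substitution. -/
def polySubst {m : ℕ} (A : E m ≃ₗᵢ[ℝ] E m) :
    MvPolynomial (Fin m) ℝ →ₐ[ℝ] MvPolynomial (Fin m) ℝ :=
  MvPolynomial.aeval fun i =>
    ∑ j, MvPolynomial.C (A (EuclideanSpace.single j 1) i) * MvPolynomial.X j

lemma isometry_apply_coord {m : ℕ} (A : E m ≃ₗᵢ[ℝ] E m) (u : E m) (i : Fin m) :
    A u i = ∑ j, A (EuclideanSpace.single j 1) i * u j := by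
  have hu : u = ∑ j, u j • EuclideanSpace.single j (1 : ℝ) := by
    ext i
    simp [Finset.sum_apply, Pi.single_apply]
  conv_lhs => rw [hu]
  simp [mul_comm]

lemma polyFun_polySubst {m : ℕ} (A : E m ≃ₗᵢ[ℝ] E m) (P : MvPolynomial (Fin m) ℝ) (u : E m) :
    polyFun m (polySubst A P) u = polyFun m P (A u) := by
  induction P using MvPolynomial.induction_on with
  | C a => simp [polySubst, polyFun_apply]
  | add P Q hP hQ => simp [hP, hQ]
  | mul_X P i hP =>
    rw [map_mul, polyFun_mul, hP, polyFun_mul, polyFun_X, isometry_apply_coord]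
    simp [polySubst, polyFun_sum]

/-- Parseval for the orthonormal basis A e_j: the rows of an orthogonal matrix are orthonormal. -/
lemma isometry_sum_mul {m : ℕ} (A : E m ≃ₗᵢ[ℝ] E m) (i l : Fin m) :
    ∑ j, A (EuclideanSpace.single j 1) i * A (EuclideanSpace.single j 1) l =
      if i = l then 1 else 0 := by
  have h := ((EuclideanSpace.basisFun (Fin m) ℝ).map A).sum_inner_mul_inner
    (EuclideanSpace.single l (1 : ℝ)) (EuclideanSpace.single i (1 : ℝ))
  simp only [OrthonormalBasis.map_apply, EuclideanSpace.basisFun_apply] at h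
  simpa [EuclideanSpace.inner_single_left, EuclideanSpace.inner_single_right, Pi.single_apply,
    mul_comm] using h

lemma pderiv_polySubst {m : ℕ} (A : E m ≃ₗᵢ[ℝ] E m) (P : MvPolynomial (Fin m) ℝ) (j : Fin m) :
    MvPolynomial.pderiv j (polySubst A P) =
      ∑ i, MvPolynomial.C (A (EuclideanSpace.single j 1) i) *
        polySubst A (MvPolynomial.pderiv i P) := by
  induction P using MvPolynomial.induction_on with
  | C a => simp [polySubst]
  | add P Q hP hQ => simp [hP, hQ, mul_add, Finset.sum_add_distrib]
  | mul_X P l hP =>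
    classical
    have h1 : polySubst A (MvPolynomial.X l) =
      ∑ j, MvPolynomial.C (A (EuclideanSpace.single j 1) l) * MvPolynomial.X j := by
      simp [polySubst]
    have h2 : MvPolynomial.pderiv j (polySubst A (MvPolynomial.X l)) =
        MvPolynomial.C (A (EuclideanSpace.single j 1) l) := by
      rw [h1, map_sum, Finset.sum_eq_single j]
      · simp
      · intro b _ hb
        simp [MvPolynomial.pderiv_X, hb]
      · simp
    rw [map_mul, Derivation.leibniz, h2, hP]
    simp only [Derivation.leibniz, smul_eq_mul, map_add, map_mul, mul_add,
      Finset.sum_add_distrib, MvPolynomial.pderiv_X]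
    congr 1
    · rw [Finset.sum_eq_single l]
      · simp [mul_comm]
      · intro b _ hb
        simp [Ne.symm hb]
      · simp
    · rw [Finset.mul_sum]
      exact Finset.sum_congr rfl fun i _ => by ring

/-- Substituting linear forms keeps the degree. The Laplacian picks up the Gram matrix of the rows
of A, which is the identity, so it commutes with the substitution. -/
lemma IsHarmPoly.polySubst {m k : ℕ} {P : MvPolynomial (Fin m) ℝ} (h : IsHarmPoly P k)
    (A : E m ≃ₗᵢ[ℝ] E m) : IsHarmPoly (polySubst A P) k := by
  constructor
  · have := h.homogeneous.aeval
      (g := fun i => ∑ j, MvPolynomial.C (A (EuclideanSpace.single j 1) i) * MvPolynomial.X j)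
      (n := 1) (fun i => MvPolynomial.IsHomogeneous.sum _ _ _ fun j _ => by
        simpa using (MvPolynomial.isHomogeneous_C (Fin m) _).mul
          (MvPolynomial.isHomogeneous_X ℝ j))
    rwa [one_mul] at this
  · rw [polyLaplacian_apply]
    simp_rw [pderiv_polySubst, map_sum, MvPolynomial.pderiv_C_mul, pderiv_polySubst, Finset.mul_sum]
    rw [Finset.sum_comm]
    have h3 : ∀ i, ∑ j, ∑ l, MvPolynomial.C (A (EuclideanSpace.single j 1) i) *
        (MvPolynomial.C (A (EuclideanSpace.single j 1) l) *
          Bosonic.polySubst A (MvPolynomial.pderiv l (MvPolynomial.pderiv i P))) =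
        Bosonic.polySubst A (MvPolynomial.pderiv i (MvPolynomial.pderiv i P)) := by
      intro i
      rw [Finset.sum_comm]
      simp_rw [← mul_assoc, ← map_mul, ← Finset.sum_mul, ← map_sum, isometry_sum_mul]
      rw [Finset.sum_eq_single i]
      · simp
      · intro b _ hb
        simp [Ne.symm hb]
      · simp
    simp_rw [h3, ← map_sum, ← polyLaplacian_apply, h.laplacian, map_zero]

lemma Harm.comp_isometry {m k : ℕ} {h : E m → ℝ} (hh : h ∈ Harm m k) (A : E m ≃ₗᵢ[ℝ] E m) :
    (fun u => h (A u)) ∈ Harm m k := by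
  obtain ⟨P, hP, rfl⟩ := mem_Harm_iff.1 hh
  exact mem_Harm_iff.2 ⟨_, hP.polySubst A, funext fun u => polyFun_polySubst A P u⟩

/-- `reflect x` as a linear isometry. -/
def reflectIso {m : ℕ} (x : E m) : E m ≃ₗᵢ[ℝ] E m := (ℝ ∙ x)ᗮ.reflection

/-- Also valid at x = 0, where both sides are the identity. -/
lemma reflectIso_apply {m : ℕ} (x u : E m) : reflectIso x u = reflect x u := by
  rw [reflectIso, Submodule.reflection_orthogonal_apply, Submodule.reflection_singleton_apply,
    reflect, real_inner_comm]
  simp only [RCLike.ofReal_real_eq_id, id_eq, two_smul, two_mul, ← add_smul, add_div]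
  rw [neg_sub]

lemma reflect_reflect {m : ℕ} (x u : E m) : reflect x (reflect x u) = u := by
  rw [← reflectIso_apply, ← reflectIso_apply]
  exact Submodule.reflection_reflection _ u

lemma norm_reflect {m : ℕ} (x u : E m) : ‖reflect x u‖ = ‖u‖ := by
  rw [← reflectIso_apply, LinearIsometryEquiv.norm_map]

lemma reflect_smul_left {m : ℕ} {r : ℝ} (hr : r ≠ 0) (x u : E m) :
    reflect (r • x) u = reflect x u := by
  by_cases hx : x = 0
  · simp [reflect, hx]
  · have : ‖x‖ ≠ 0 := norm_ne_zero_iff.2 hx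
    simp only [reflect, norm_smul, inner_smul_right, smul_smul, mul_pow, Real.norm_eq_abs, sq_abs]
    congr 2
    field_simp

lemma Harm.comp_reflect {m k : ℕ} {h : E m → ℝ} (hh : h ∈ Harm m k) (x : E m) :
    (fun u => h (reflect x u)) ∈ Harm m k := by
  simpa only [reflectIso_apply] using Harm.comp_isometry hh (reflectIso x)

/-! ### Interpolation in finite-dimensional function spaces -/

/-- On a finite-dimensional space of functions, functions are determined linearly by their values at
finitely many points. -/
lemma exists_interpolation {X : Type*} (V : Submodule ℝ (X → ℝ)) [FiniteDimensional ℝ V] :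
    ∃ (N : ℕ) (x : Fin N → X) (b : Fin N → X → ℝ), (∀ i, b i ∈ V) ∧
      ∀ h ∈ V, ∀ v, h v = ∑ i, h (x i) * b i v := by
  classical
  let ev : X → Module.Dual ℝ V := fun v => (LinearMap.proj v : (X → ℝ) →ₗ[ℝ] ℝ) ∘ₗ V.subtype
  -- A function killed by all evaluations vanishes, so in finite dimension the evaluations span the
  -- dual.
  have htop : Submodule.span ℝ (Set.range ev) = ⊤ := by
    have h1 : (Submodule.span ℝ (Set.range ev)).dualCoannihilator = ⊥ := by
      rw [eq_bot_iff]
      intro h hh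
      rw [Submodule.mem_dualCoannihilator] at hh
      ext v
      exact hh (ev v) (Submodule.subset_span ⟨v, rfl⟩)
    have h2 := Subspace.dualCoannihilator_dualAnnihilator_eq (W := Submodule.span ℝ (Set.range ev))
    rw [← h2, h1]
    simp
  let B := Module.finBasis ℝ V
  -- Each coordinate functional of a basis is a finite combination of evaluations; the points that
  -- occur are the nodes.
  have hc : ∀ i, ∃ c : X →₀ ℝ, Finsupp.linearCombination ℝ ev c = B.coord i := fun i => by
    have : B.coord i ∈ Submodule.span ℝ (Set.range ev) := htop ▸ Submodule.mem_top
    exact (Finsupp.mem_span_range_iff_exists_finsupp.1 this)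
  choose c hc using hc
  let s : Finset X := Finset.univ.biUnion fun i => (c i).support
  have key : ∀ h (hh : h ∈ V) v, h v = ∑ x ∈ s, h x * ∑ i, c i x * (B i : X → ℝ) v := by
    intro h hh v
    have h1 : h = ∑ i, B.coord i ⟨h, hh⟩ • (B i : X → ℝ) := by
      have := congrArg V.subtype (B.sum_repr ⟨h, hh⟩)
      rw [map_sum] at this
      exact this.symm
    have h2 : ∀ i, B.coord i ⟨h, hh⟩ = ∑ x ∈ s, c i x * h x := by
      intro i
      rw [← hc i, Finsupp.linearCombination_apply,
        Finsupp.sum_of_support_subset (s := s) _ (Finset.subset_biUnion_of_mem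
          (fun i => (c i).support) (Finset.mem_univ i)) _ (by simp)]
      simp [ev]
    conv_lhs => rw [h1]
    simp_rw [h2, Finset.sum_apply, Pi.smul_apply, smul_eq_mul, Finset.sum_mul, Finset.mul_sum]
    rw [Finset.sum_comm]
    exact Finset.sum_congr rfl fun x _ => Finset.sum_congr rfl fun i _ => by ring
  refine ⟨s.card, fun i => (s.equivFin.symm i : X),
    fun j v => ∑ i, c i (s.equivFin.symm j : X) * (B i : X → ℝ) v, fun j => ?_, fun h hh v => ?_⟩
  · have : (fun v => ∑ i, c i (s.equivFin.symm j : X) * (B i : X → ℝ) v) =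
        ∑ i, c i (s.equivFin.symm j : X) • (B i : X → ℝ) := by
      ext v; simp
    show (fun v => ∑ i, c i (s.equivFin.symm j : X) * (B i : X → ℝ) v) ∈ V
    rw [this]
    exact V.sum_mem fun i _ => V.smul_mem _ (B i).2
  · rw [key h hh v, ← Finset.sum_coe_sort s]
    exact (Equiv.sum_comp s.equivFin.symm
      (fun x : s => h x * ∑ i, c i x * (B i : X → ℝ) v)).symm

/-! ### Rules for directional derivatives -/

section LineDeriv

variable {F : Type*} [NormedAddCommGroup F] [NormedSpace ℝ F] {f g : F → ℝ} {f' g' : ℝ} {x v : F}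

lemma hasLineDerivAt_mul (hf : HasLineDerivAt ℝ f f' x v) (hg : HasLineDerivAt ℝ g g' x v) :
    HasLineDerivAt ℝ (fun z => f z * g z) (f' * g x + f x * g') x v := by
  simpa [HasLineDerivAt] using! HasDerivAt.mul hf hg

lemma hasLineDerivAt_add (hf : HasLineDerivAt ℝ f f' x v) (hg : HasLineDerivAt ℝ g g' x v) :
    HasLineDerivAt ℝ (fun z => f z + g z) (f' + g') x v :=
  HasDerivAt.add hf hg

lemma hasLineDerivAt_sub (hf : HasLineDerivAt ℝ f f' x v) (hg : HasLineDerivAt ℝ g g' x v) :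
    HasLineDerivAt ℝ (fun z => f z - g z) (f' - g') x v :=
  HasDerivAt.sub hf hg

lemma hasLineDerivAt_const_mul (c : ℝ) (hf : HasLineDerivAt ℝ f f' x v) :
    HasLineDerivAt ℝ (fun z => c * f z) (c * f') x v :=
  HasDerivAt.const_mul c hf

lemma hasLineDerivAt_const (c : ℝ) (x v : F) : HasLineDerivAt ℝ (fun _ => c) 0 x v :=
  hasDerivAt_const _ _

lemma hasLineDerivAt_sum {ι : Type*} {s : Finset ι} {f : ι → F → ℝ} {f' : ι → ℝ}
    (hf : ∀ i ∈ s, HasLineDerivAt ℝ (f i) (f' i) x v) :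
    HasLineDerivAt ℝ (fun z => ∑ i ∈ s, f i z) (∑ i ∈ s, f' i) x v :=
  HasDerivAt.fun_sum hf

end LineDeriv

/-! ### First derivatives of P(R_x u) in x and in u -/

section ReflectionCalculus

variable {m : ℕ}

lemma hasLineDerivAt_coord (i j : Fin m) (x : E m) :
    HasLineDerivAt ℝ (fun z : E m => z i) (if i = j then 1 else 0) x (EuclideanSpace.single j 1) := by
  have := ((hasDerivAt_id (0 : ℝ)).mul_const
    ((EuclideanSpace.single j 1 : E m) i)).const_add (x i)
  simpa [HasLineDerivAt, Pi.single_apply] using this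

lemma hasLineDerivAt_inner_right (j : Fin m) (u x : E m) :
    HasLineDerivAt ℝ (fun z : E m => inner ℝ u z) (u j) x (EuclideanSpace.single j 1) := by
  have := ((hasDerivAt_id (0 : ℝ)).mul_const (u j)).const_add (inner ℝ u x)
  simpa [HasLineDerivAt, inner_add_right, inner_smul_right,
    EuclideanSpace.inner_single_right] using this

lemma hasLineDerivAt_inner_left (j : Fin m) (u x : E m) :
    HasLineDerivAt ℝ (fun z : E m => inner ℝ z x) (x j) u (EuclideanSpace.single j 1) := by
  simpa only [real_inner_comm] using hasLineDerivAt_inner_right j x u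

lemma hasLineDerivAt_inv_norm_pow (a : ℕ) (j : Fin m) {x : E m} (hx : x ≠ 0) :
    HasLineDerivAt ℝ (fun z : E m => (‖z‖ ^ a)⁻¹)
      (-(a * x j * (‖x‖ ^ a)⁻¹ * (‖x‖ ^ 2)⁻¹)) x (EuclideanSpace.single j 1) := by
  have hn : ‖x‖ ≠ 0 := norm_ne_zero_iff.2 hx
  have h1 : HasDerivAt (fun t : ℝ => x + t • (EuclideanSpace.single j 1 : E m))
      (EuclideanSpace.single j 1) 0 := by
    simpa using ((hasDerivAt_id (0 : ℝ)).smul_const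
      (EuclideanSpace.single j 1 : E m)).const_add x
  have h2 := h1.norm_sq
  have h3 := h2.sqrt (by simpa using hn)
  have h4 := (h3.pow a).inv (by simp [hx])
  unfold HasLineDerivAt
  have hfun : (fun t : ℝ => (‖x + t • (EuclideanSpace.single j 1 : E m)‖ ^ a)⁻¹) =
      ((fun t : ℝ => √(‖x + t • (EuclideanSpace.single j 1 : E m)‖ ^ 2)) ^ a)⁻¹ := by
    ext t
    simp
  rw [hfun]
  convert! h4 using 1
  rcases a with _ | a
  · simp
  · simp [EuclideanSpace.inner_single_right]
    field_simp
    ring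

lemma reflect_coord (x u : E m) (i : Fin m) :
    reflect x u i = u i - 2 * inner ℝ u x * (‖x‖ ^ 2)⁻¹ * x i := by
  simp [reflect, div_eq_mul_inv]

lemma sum_mul_self_eq (x : E m) : ∑ i, x i * x i = ‖x‖ ^ 2 := by
  rw [EuclideanSpace.real_norm_sq_eq]
  simp [sq]

lemma sum_mul_eq_inner (x u : E m) : ∑ i, u i * x i = inner ℝ u x := by
  rw [PiLp.inner_apply]
  simp [mul_comm]

/-- The derivative of `P` at `R_x u` in the direction `x`. -/
def radDeriv (P : MvPolynomial (Fin m) ℝ) (x u : E m) : ℝ :=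
  ∑ i, x i * polyFun m (MvPolynomial.pderiv i P) (reflect x u)

/-- Chain rule for R_x u = u - 2⟨u, x⟩|x|^{-2} x. Collecting the derivative along x in `radDeriv`
reduces the later contractions to algebra in a few scalars. -/
lemma hasLineDerivAt_comp_reflect_left (P : MvPolynomial (Fin m) ℝ) (u : E m) {x : E m} (hx : x ≠ 0)
    (j : Fin m) :
    HasLineDerivAt ℝ (fun z => polyFun m P (reflect z u))
      (-2 * (‖x‖ ^ 2)⁻¹ * (u j * radDeriv P x u
        + inner ℝ u x * polyFun m (MvPolynomial.pderiv j P) (reflect x u)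
        - 2 * inner ℝ u x * (‖x‖ ^ 2)⁻¹ * x j * radDeriv P x u)) x (EuclideanSpace.single j 1) := by
  have h1 : ∀ i, HasLineDerivAt ℝ (fun z => reflect z u i)
      (-2 * (u j * (‖x‖ ^ 2)⁻¹ * x i - 2 * inner ℝ u x * x j * (‖x‖ ^ 2)⁻¹ * (‖x‖ ^ 2)⁻¹ * x i
        + inner ℝ u x * (‖x‖ ^ 2)⁻¹ * if i = j then 1 else 0)) x (EuclideanSpace.single j 1) := by
    intro i
    have := hasLineDerivAt_sub (hasLineDerivAt_const (u i) x (EuclideanSpace.single j (1 : ℝ)))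
      (hasLineDerivAt_mul (hasLineDerivAt_mul (hasLineDerivAt_const_mul 2
        (hasLineDerivAt_inner_right j u x)) (hasLineDerivAt_inv_norm_pow 2 j hx))
        (hasLineDerivAt_coord i j x))
    simp only [reflect_coord]
    convert! this using 1
    push_cast
    ring
  have h2 := hasDerivAt_polyFun_comp P h1
  unfold HasLineDerivAt
  convert! h2 using 1
  simp only [zero_smul, add_zero, radDeriv]
  have h3 : ∑ i, polyFun m (MvPolynomial.pderiv i P) (reflect x u) * (if i = j then (1 : ℝ) else 0) =
      polyFun m (MvPolynomial.pderiv j P) (reflect x u) := by simp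
  calc _ = (-2 * u j * (‖x‖ ^ 2)⁻¹ + 4 * inner ℝ u x * x j * (‖x‖ ^ 2)⁻¹ * (‖x‖ ^ 2)⁻¹) *
        (∑ i, x i * polyFun m (MvPolynomial.pderiv i P) (reflect x u)) +
        (-2 * inner ℝ u x * (‖x‖ ^ 2)⁻¹) *
        ∑ i, polyFun m (MvPolynomial.pderiv i P) (reflect x u) * (if i = j then (1 : ℝ) else 0) := by
        rw [h3]; ring
    _ = _ := by
        rw [Finset.mul_sum, Finset.mul_sum, ← Finset.sum_add_distrib]
        exact Finset.sum_congr rfl fun i _ => by ring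

lemma hasLineDerivAt_comp_reflect_right (P : MvPolynomial (Fin m) ℝ) (x u : E m) (j : Fin m) :
    HasLineDerivAt ℝ (fun z => polyFun m P (reflect x z))
      (polyFun m (MvPolynomial.pderiv j P) (reflect x u) - 2 * (‖x‖ ^ 2)⁻¹ * x j * radDeriv P x u) u
      (EuclideanSpace.single j 1) := by
  have h1 : ∀ i, HasLineDerivAt ℝ (fun z => reflect x z i)
      ((if i = j then 1 else 0) - 2 * (‖x‖ ^ 2)⁻¹ * x j * x i) u (EuclideanSpace.single j 1) := by
    intro i
    have := hasLineDerivAt_sub (hasLineDerivAt_coord i j u)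
      (hasLineDerivAt_const_mul (2 * (‖x‖ ^ 2)⁻¹ * x i) (hasLineDerivAt_inner_left j u x))
    simp only [reflect_coord]
    convert! this using 1
    · ext z; ring
    · ring
  have h2 := hasDerivAt_polyFun_comp P h1
  unfold HasLineDerivAt
  convert! h2 using 1
  simp only [zero_smul, add_zero, radDeriv]
  have h3 : ∑ i, polyFun m (MvPolynomial.pderiv i P) (reflect x u) * (if i = j then (1 : ℝ) else 0) =
      polyFun m (MvPolynomial.pderiv j P) (reflect x u) := by simp
  conv_lhs => rw [← h3]
  rw [Finset.mul_sum, ← Finset.sum_sub_distrib]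
  exact Finset.sum_congr rfl fun i _ => by ring

/-- The second derivative of `P` at `R_x u` in the direction `x`. -/
def radDeriv₂ (P : MvPolynomial (Fin m) ℝ) (x u : E m) : ℝ :=
  ∑ j, x j * radDeriv (MvPolynomial.pderiv j P) x u

lemma radDeriv_pderiv (P : MvPolynomial (Fin m) ℝ) (x u : E m) (j : Fin m) :
    radDeriv (MvPolynomial.pderiv j P) x u =
      ∑ i, x i * polyFun m (MvPolynomial.pderiv j (MvPolynomial.pderiv i P)) (reflect x u) := by
  simp_rw [radDeriv, pderiv_pderiv_comm _ j]

lemma hasLineDerivAt_radDeriv_left (P : MvPolynomial (Fin m) ℝ) (u : E m) {x : E m} (hx : x ≠ 0)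
    (j : Fin m) :
    HasLineDerivAt ℝ (fun z => radDeriv P z u)
      (polyFun m (MvPolynomial.pderiv j P) (reflect x u)
        - 2 * (‖x‖ ^ 2)⁻¹ * (u j * radDeriv₂ P x u
        + inner ℝ u x * radDeriv (MvPolynomial.pderiv j P) x u
        - 2 * inner ℝ u x * (‖x‖ ^ 2)⁻¹ * x j * radDeriv₂ P x u)) x
      (EuclideanSpace.single j 1) := by
  have h := hasLineDerivAt_sum (s := Finset.univ) fun i _ =>
    hasLineDerivAt_mul (hasLineDerivAt_coord i j x)
      (hasLineDerivAt_comp_reflect_left (MvPolynomial.pderiv i P) u hx j)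
  unfold radDeriv
  convert! h using 1
  rw [Finset.sum_add_distrib]
  have h1 : ∑ i, (if i = j then (1 : ℝ) else 0) * polyFun m (MvPolynomial.pderiv i P) (reflect x u) =
      polyFun m (MvPolynomial.pderiv j P) (reflect x u) := by simp
  rw [h1, sub_eq_add_neg]
  congr 1
  have h2 := radDeriv_pderiv P x u j
  rw [radDeriv] at h2
  rw [h2, radDeriv₂]
  calc _ = (-2 * (‖x‖ ^ 2)⁻¹ * u j + 4 * inner ℝ u x * (‖x‖ ^ 2)⁻¹ * (‖x‖ ^ 2)⁻¹ * x j) *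
        (∑ i, x i * radDeriv (MvPolynomial.pderiv i P) x u) +
        (-2 * (‖x‖ ^ 2)⁻¹ * inner ℝ u x) *
        ∑ i, x i * polyFun m (MvPolynomial.pderiv j (MvPolynomial.pderiv i P)) (reflect x u) := by
        ring
    _ = _ := by
        rw [Finset.mul_sum, Finset.mul_sum, ← Finset.sum_add_distrib]
        exact Finset.sum_congr rfl fun i _ => by ring

lemma hasLineDerivAt_radDeriv_right (P : MvPolynomial (Fin m) ℝ) (x u : E m) (j : Fin m) :
    HasLineDerivAt ℝ (fun z => radDeriv P x z)
      (radDeriv (MvPolynomial.pderiv j P) x u - 2 * (‖x‖ ^ 2)⁻¹ * x j * radDeriv₂ P x u) u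
      (EuclideanSpace.single j 1) := by
  have h := hasLineDerivAt_sum (s := Finset.univ) fun i _ =>
    hasLineDerivAt_const_mul (x i) (hasLineDerivAt_comp_reflect_right (MvPolynomial.pderiv i P) x u j)
  have h2 := radDeriv_pderiv P x u j
  rw [h2, radDeriv₂]
  unfold radDeriv
  convert! h using 1
  rw [Finset.mul_sum, ← Finset.sum_sub_distrib]
  exact Finset.sum_congr rfl fun i _ => by rw [radDeriv]; ring

namespace IsHarmPoly

variable {k : ℕ} {P : MvPolynomial (Fin m) ℝ}

/-- Euler's relation is differentiated, not applied to the derivative of P; the factor k - 1 is then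
a real number, correct for k = 0 as well. -/
lemma euler_pderiv (h : IsHarmPoly P k) (i : Fin m) (u : E m) :
    ∑ j, u j * polyFun m (MvPolynomial.pderiv j (MvPolynomial.pderiv i P)) u =
      ((k : ℝ) - 1) * polyFun m (MvPolynomial.pderiv i P) u := by
  have h1 := congrArg (MvPolynomial.pderiv i) h.homogeneous.sum_X_mul_pderiv
  rw [map_sum, map_nsmul] at h1
  classical
  simp only [Derivation.leibniz, MvPolynomial.pderiv_X, smul_eq_mul, Finset.sum_add_distrib] at h1
  have h2 := congrArg (fun Q => polyFun m Q u) h1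
  have h0 : polyFun m (k : MvPolynomial (Fin m) ℝ) u = k := by simp [polyFun_apply]
  simp only [map_add, Pi.add_apply, polyFun_sum, h0, polyFun_mul, polyFun_X,
    nsmul_eq_mul, pderiv_pderiv_comm i] at h2
  have h3 : ∑ j, polyFun m (MvPolynomial.pderiv j P) u *
      polyFun m (Pi.single (M := fun _ => MvPolynomial (Fin m) ℝ) i 1 j) u =
      polyFun m (MvPolynomial.pderiv i P) u := by
    rw [Finset.sum_eq_single i]
    · simp [polyFun_apply]
    · intro b _ hb
      simp [hb]
    · simp
  linarith [h2, h3]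

/-- Euler's relation at R_x u, after writing u = R_x u + 2⟨u, x⟩|x|^{-2} x; the second summand gives
the radial term. -/
lemma sum_mul_pderiv_reflect (h : IsHarmPoly P k) (x u : E m) :
    ∑ j, u j * polyFun m (MvPolynomial.pderiv j P) (reflect x u) =
      k * polyFun m P (reflect x u) + 2 * inner ℝ u x * (‖x‖ ^ 2)⁻¹ * radDeriv P x u := by
  rw [← h.euler, radDeriv, Finset.mul_sum, ← Finset.sum_add_distrib]
  exact Finset.sum_congr rfl fun i _ => by rw [reflect_coord]; ring

/-- The same splitting of u, one derivative higher. -/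
lemma sum_mul_radDeriv_pderiv (h : IsHarmPoly P k) (x u : E m) :
    ∑ j, u j * radDeriv (MvPolynomial.pderiv j P) x u =
      ((k : ℝ) - 1) * radDeriv P x u + 2 * inner ℝ u x * (‖x‖ ^ 2)⁻¹ * radDeriv₂ P x u := by
  have h1 : ∀ i, ∑ j, u j * polyFun m (MvPolynomial.pderiv j (MvPolynomial.pderiv i P)) (reflect x u)
      = ((k : ℝ) - 1) * polyFun m (MvPolynomial.pderiv i P) (reflect x u) +
        2 * inner ℝ u x * (‖x‖ ^ 2)⁻¹ * radDeriv (MvPolynomial.pderiv i P) x u := by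
    intro i
    rw [← h.euler_pderiv, radDeriv, Finset.mul_sum, ← Finset.sum_add_distrib]
    exact Finset.sum_congr rfl fun j _ => by rw [reflect_coord]; ring
  simp_rw [radDeriv_pderiv, Finset.mul_sum]
  rw [Finset.sum_comm]
  simp_rw [mul_left_comm, ← Finset.mul_sum, h1]
  rw [radDeriv₂, radDeriv, Finset.mul_sum, Finset.mul_sum, ← Finset.sum_add_distrib]
  exact Finset.sum_congr rfl fun j _ => by ring

end IsHarmPoly

end ReflectionCalculus

/-! ### The operators on sums of ψ_i(x) P_i(R_x u) -/

section ReflectedPolynomials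

variable {m : ℕ}

section Congr

variable {U : Set (E m)} {F G : E m → E m → ℝ}

/-- The operators are local in x, so a formula valid on an open set, away from the origin or in the
half-space, may be differentiated again there. -/
lemma dx_congr (hU : IsOpen U) (h : ∀ x ∈ U, ∀ u, F x u = G x u) (j : Fin m) :
    ∀ x ∈ U, ∀ u, dx j F x u = dx j G x u := by
  intro x hx u
  refine Filter.EventuallyEq.lineDeriv_eq ?_
  filter_upwards [hU.mem_nhds hx] with z hz using h z hz u

lemma DuDx_congr (hU : IsOpen U) (h : ∀ x ∈ U, ∀ u, F x u = G x u) :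
    ∀ x ∈ U, ∀ u, DuDx F x u = DuDx G x u := by
  intro x hx u
  refine Finset.sum_congr rfl fun j _ => ?_
  have : dx j F x = dx j G x := funext fun w => dx_congr hU h j x hx w
  simp only [du, this]

lemma uDx_congr (hU : IsOpen U) (h : ∀ x ∈ U, ∀ u, F x u = G x u) :
    ∀ x ∈ U, ∀ u, uDx F x u = uDx G x u := by
  intro x hx u
  refine Finset.sum_congr rfl fun j _ => ?_
  rw [dx_congr hU h j x hx u]

end Congr

lemma isOpen_ne_zero : IsOpen {x : E m | x ≠ 0} := isOpen_ne

section Family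

variable {ι : Type*} [Fintype ι] {ψ : ι → E m → ℝ} {ψ' : ι → Fin m → E m → ℝ}
  {P : ι → MvPolynomial (Fin m) ℝ} {k : ℕ}

/-- Sums are needed because ⟨D_u, D_x⟩ applied to one product ψ(x) P(R_x u) already produces a sum
over the partial derivatives of P. -/
lemma hasLineDerivAt_family
    (hψ : ∀ i j x, x ≠ 0 → HasLineDerivAt ℝ (ψ i) (ψ' i j x) x (EuclideanSpace.single j 1))
    {x : E m} (hx : x ≠ 0) (u : E m) (j : Fin m) :
    HasLineDerivAt ℝ (fun z => ∑ i, ψ i z * polyFun m (P i) (reflect z u))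
      (∑ i, (ψ' i j x * polyFun m (P i) (reflect x u)
        + ψ i x * (-2 * (‖x‖ ^ 2)⁻¹ * (u j * radDeriv (P i) x u
        + inner ℝ u x * polyFun m (MvPolynomial.pderiv j (P i)) (reflect x u)
        - 2 * inner ℝ u x * (‖x‖ ^ 2)⁻¹ * x j * radDeriv (P i) x u)))) x
      (EuclideanSpace.single j 1) :=
  hasLineDerivAt_sum fun i _ =>
    hasLineDerivAt_mul (hψ i j x hx) (hasLineDerivAt_comp_reflect_left (P i) u hx j)

lemma uDx_family
    (hψ : ∀ i j x, x ≠ 0 → HasLineDerivAt ℝ (ψ i) (ψ' i j x) x (EuclideanSpace.single j 1))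
    (hP : ∀ i, IsHarmPoly (P i) k) {x : E m} (hx : x ≠ 0) (u : E m) :
    uDx (fun z w => ∑ i, ψ i z * polyFun m (P i) (reflect z w)) x u =
      ∑ i, ((∑ j, u j * ψ' i j x) * polyFun m (P i) (reflect x u)
        - 2 * (‖x‖ ^ 2)⁻¹ * ψ i x * (‖u‖ ^ 2 * radDeriv (P i) x u
        + k * inner ℝ u x * polyFun m (P i) (reflect x u))) := by
  simp only [uDx, dx, (hasLineDerivAt_family (P := P) hψ hx u _).lineDeriv, Finset.mul_sum]
  rw [Finset.sum_comm]
  refine Finset.sum_congr rfl fun i _ => ?_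
  have h1 := (hP i).sum_mul_pderiv_reflect x u
  calc _ = (∑ j, u j * ψ' i j x) * polyFun m (P i) (reflect x u)
        - 2 * (‖x‖ ^ 2)⁻¹ * ψ i x * ((∑ j, u j * u j) * radDeriv (P i) x u
        + inner ℝ u x * ∑ j, u j * polyFun m (MvPolynomial.pderiv j (P i)) (reflect x u)
        - 2 * inner ℝ u x * (‖x‖ ^ 2)⁻¹ * radDeriv (P i) x u * ∑ j, u j * x j) := by
        simp only [Finset.mul_sum, Finset.sum_mul, ← Finset.sum_add_distrib,
          ← Finset.sum_sub_distrib]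
        exact Finset.sum_congr rfl fun j _ => by ring
    _ = _ := by
        rw [h1, sum_mul_self_eq, sum_mul_eq_inner]
        ring_nf

/-- The second radial derivatives cancel and harmonicity removes the trace of the Hessian. The
multiple of the radial derivative is m + (k - 1) + 1 - 2: the dimension, Euler's relation, the
gradient along x, and the normal part of the reflection. -/
lemma DuDx_family
    (hψ : ∀ i j x, x ≠ 0 → HasLineDerivAt ℝ (ψ i) (ψ' i j x) x (EuclideanSpace.single j 1))
    (hP : ∀ i, IsHarmPoly (P i) k) {x : E m} (hx : x ≠ 0) (u : E m) :
    DuDx (fun z w => ∑ i, ψ i z * polyFun m (P i) (reflect z w)) x u =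
      ∑ i, ((∑ j, ψ' i j x * (polyFun m (MvPolynomial.pderiv j (P i)) (reflect x u)
        - 2 * (‖x‖ ^ 2)⁻¹ * x j * radDeriv (P i) x u))
        - 2 * (‖x‖ ^ 2)⁻¹ * ψ i x * (m + k - 2) * radDeriv (P i) x u) := by
  have hs : ‖x‖ ^ 2 * (‖x‖ ^ 2)⁻¹ = 1 := mul_inv_cancel₀ (by simpa using hx)
  have h1 : ∀ j, dx j (fun z w => ∑ i, ψ i z * polyFun m (P i) (reflect z w)) x = fun u =>
      ∑ i, (ψ' i j x * polyFun m (P i) (reflect x u)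
        + ψ i x * (-2 * (‖x‖ ^ 2)⁻¹ * (u j * radDeriv (P i) x u
        + inner ℝ u x * polyFun m (MvPolynomial.pderiv j (P i)) (reflect x u)
        - 2 * inner ℝ u x * (‖x‖ ^ 2)⁻¹ * x j * radDeriv (P i) x u))) := fun j =>
    funext fun u => (hasLineDerivAt_family (P := P) hψ hx u j).lineDeriv
  have H := fun j => hasLineDerivAt_sum (s := Finset.univ) fun i _ => hasLineDerivAt_add
    (hasLineDerivAt_const_mul (ψ' i j x) (hasLineDerivAt_comp_reflect_right (P i) x u j))
    (hasLineDerivAt_const_mul (ψ i x) (hasLineDerivAt_const_mul (-2 * (‖x‖ ^ 2)⁻¹)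
      (hasLineDerivAt_sub (hasLineDerivAt_add
        (hasLineDerivAt_mul (hasLineDerivAt_coord j j u) (hasLineDerivAt_radDeriv_right (P i) x u j))
        (hasLineDerivAt_mul (hasLineDerivAt_inner_left j u x)
          (hasLineDerivAt_comp_reflect_right (MvPolynomial.pderiv j (P i)) x u j)))
        (hasLineDerivAt_mul (hasLineDerivAt_mul (hasLineDerivAt_mul
          (hasLineDerivAt_const_mul 2 (hasLineDerivAt_inner_left j u x))
          (hasLineDerivAt_const (‖x‖ ^ 2)⁻¹ _ _)) (hasLineDerivAt_const (x j) _ _))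
          (hasLineDerivAt_radDeriv_right (P i) x u j)))))
  have h2 : ∀ j, du j (dx j (fun z w => ∑ i, ψ i z * polyFun m (P i) (reflect z w))) x u = _ :=
    fun j => Eq.trans (by rw [du, h1]) (H j).lineDeriv
  rw [DuDx, Finset.sum_congr rfl fun j _ => h2 j, Finset.sum_comm]
  refine Finset.sum_congr rfl fun i _ => ?_
  have e1 := (hP i).sum_mul_radDeriv_pderiv x u
  have e2 := (hP i).sum_pderiv_pderiv (reflect x u)
  have e3 : ∑ j : Fin m, (1 : ℝ) = m := by simp
  calc _ = (∑ j, ψ' i j x * (polyFun m (MvPolynomial.pderiv j (P i)) (reflect x u)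
        - 2 * (‖x‖ ^ 2)⁻¹ * x j * radDeriv (P i) x u))
        + ψ i x * (-2 * (‖x‖ ^ 2)⁻¹) * (radDeriv (P i) x u * ∑ j : Fin m, (1 : ℝ)
        + (∑ j, u j * radDeriv (MvPolynomial.pderiv j (P i)) x u)
        - 2 * (‖x‖ ^ 2)⁻¹ * radDeriv₂ (P i) x u * (∑ j, u j * x j)
        + (∑ j, x j * polyFun m (MvPolynomial.pderiv j (P i)) (reflect x u))
        + inner ℝ u x * (∑ j, polyFun m (MvPolynomial.pderiv j (MvPolynomial.pderiv j (P i)))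
          (reflect x u))
        - 4 * inner ℝ u x * (‖x‖ ^ 2)⁻¹ *
          (∑ j, x j * radDeriv (MvPolynomial.pderiv j (P i)) x u)
        - 2 * (‖x‖ ^ 2)⁻¹ * radDeriv (P i) x u * (∑ j, x j * x j)
        + 4 * inner ℝ u x * (‖x‖ ^ 2)⁻¹ * (‖x‖ ^ 2)⁻¹ * radDeriv₂ (P i) x u * (∑ j, x j * x j)) := by
        simp only [Finset.mul_sum, ← Finset.sum_add_distrib, ← Finset.sum_sub_distrib]
        exact Finset.sum_congr rfl fun j _ => by simp only [if_true]; ring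
    _ = _ := by
        rw [e1, e2, e3, sum_mul_eq_inner, sum_mul_self_eq, ← radDeriv, ← radDeriv₂, sub_eq_add_neg]
        congr 1
        linear_combination (4 * ψ i x * (‖x‖ ^ 2)⁻¹ * radDeriv (P i) x u - 8 * ψ i x * (‖x‖ ^ 2)⁻¹ * (‖x‖ ^ 2)⁻¹ * inner ℝ u x * radDeriv₂ (P i) x u) * hs

end Family

/-- The partial derivative of `P (R_x u)` with respect to `x_j`. -/
def reflectDeriv (P : MvPolynomial (Fin m) ℝ) (u : E m) (j : Fin m) (x : E m) : ℝ :=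
  -2 * (‖x‖ ^ 2)⁻¹ * (u j * radDeriv P x u
    + inner ℝ u x * polyFun m (MvPolynomial.pderiv j P) (reflect x u)
    - 2 * inner ℝ u x * (‖x‖ ^ 2)⁻¹ * x j * radDeriv P x u)

/-- Only the trace of the second derivatives has a short form, by harmonicity and the two Euler
relations; the individual derivatives are therefore left existential. -/
lemma laplacian_comp_reflect {k : ℕ} {P : MvPolynomial (Fin m) ℝ} (hP : IsHarmPoly P k) (u : E m)
    {x : E m} (hx : x ≠ 0) :
    ∃ q : Fin m → ℝ,
      (∀ j, HasLineDerivAt ℝ (reflectDeriv P u j) (q j) x (EuclideanSpace.single j 1)) ∧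
      ∑ j, q j = (‖x‖ ^ 2)⁻¹ * (-4 * k * polyFun m P (reflect x u)
        + 4 * (m + 2 * k - 4) * inner ℝ u x * (‖x‖ ^ 2)⁻¹ * radDeriv P x u
        + 4 * ‖u‖ ^ 2 * (‖x‖ ^ 2)⁻¹ * radDeriv₂ P x u) := by
  have hs : ‖x‖ ^ 2 * (‖x‖ ^ 2)⁻¹ = 1 := mul_inv_cancel₀ (by simpa using hx)
  refine ⟨_, fun j => hasLineDerivAt_mul
    (hasLineDerivAt_const_mul (-2) (hasLineDerivAt_inv_norm_pow 2 j hx))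
    (hasLineDerivAt_sub (hasLineDerivAt_add
      (hasLineDerivAt_const_mul (u j) (hasLineDerivAt_radDeriv_left P u hx j))
      (hasLineDerivAt_mul (hasLineDerivAt_inner_right j u x)
        (hasLineDerivAt_comp_reflect_left (MvPolynomial.pderiv j P) u hx j)))
      (hasLineDerivAt_mul (hasLineDerivAt_mul (hasLineDerivAt_mul
        (hasLineDerivAt_const_mul 2 (hasLineDerivAt_inner_right j u x))
        (hasLineDerivAt_inv_norm_pow 2 j hx)) (hasLineDerivAt_coord j j x))
        (hasLineDerivAt_radDeriv_left P u hx j))), ?_⟩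
  have e1 := hP.sum_mul_radDeriv_pderiv x u
  have e2 := hP.sum_pderiv_pderiv (reflect x u)
  have e3 : ∑ j : Fin m, (1 : ℝ) = m := by simp
  have e4 := hP.sum_mul_pderiv_reflect x u
  set i := inner ℝ u x
  set T := (‖x‖ ^ 2)⁻¹
  set A := radDeriv P x u with hA
  set B := radDeriv₂ P x u with hB
  calc _ = 4 * T ^ 2 * A * (∑ j, u j * x j)
        + 4 * T ^ 2 * i * (∑ j, x j * polyFun m (MvPolynomial.pderiv j P) (reflect x u))
        - 8 * i * T ^ 3 * A * (∑ j, x j * x j)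
        + (-2 * T) * (2 * (∑ j, u j * polyFun m (MvPolynomial.pderiv j P) (reflect x u))
          - 2 * T * (B * (∑ j, u j * u j)
            + i * (∑ j, u j * radDeriv (MvPolynomial.pderiv j P) x u)
            - 2 * i * T * B * (∑ j, u j * x j))
          - 2 * T * i * ((∑ j, u j * radDeriv (MvPolynomial.pderiv j P) x u)
            + i * (∑ j, polyFun m (MvPolynomial.pderiv j (MvPolynomial.pderiv j P)) (reflect x u))
            - 2 * i * T * (∑ j, x j * radDeriv (MvPolynomial.pderiv j P) x u))
          - 2 * T * A * (∑ j, u j * x j)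
          + 4 * i * T ^ 2 * A * (∑ j, x j * x j)
          - 2 * i * T * A * ∑ j : Fin m, (1 : ℝ)
          - 2 * i * T * ((∑ j, x j * polyFun m (MvPolynomial.pderiv j P) (reflect x u))
            - 2 * T * (B * (∑ j, u j * x j)
              + i * (∑ j, x j * radDeriv (MvPolynomial.pderiv j P) x u)
              - 2 * i * T * B * (∑ j, x j * x j)))) := by
        simp only [Finset.mul_sum, ← Finset.sum_add_distrib, ← Finset.sum_sub_distrib]
        exact Finset.sum_congr rfl fun j _ => by simp only [if_true]; push_cast; ring
    _ = _ := by
        rw [e1, e2, e3, e4, sum_mul_eq_inner, sum_mul_self_eq, sum_mul_self_eq, ← radDeriv,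
          ← radDeriv₂, ← hA, ← hB]
        linear_combination (-16 * i * T ^ 2 * A + 16 * i ^ 2 * T ^ 3 * B) * hs

end ReflectedPolynomials

/-! ### The null solutions x_e |x|^{-m} P(R_x u) -/

section KelvinTransform

variable {m : ℕ}

lemma hasLineDerivAt_coord_mul_inv_norm_pow (e j : Fin m) {x : E m} (hx : x ≠ 0) :
    HasLineDerivAt ℝ (fun z : E m => z e * (‖z‖ ^ m)⁻¹)
      ((if e = j then 1 else 0) * (‖x‖ ^ m)⁻¹ + x e * (-(m * x j * (‖x‖ ^ m)⁻¹ * (‖x‖ ^ 2)⁻¹))) x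
      (EuclideanSpace.single j 1) :=
  hasLineDerivAt_mul (hasLineDerivAt_coord e j x) (hasLineDerivAt_inv_norm_pow m j hx)

/-- The coefficients of `⟨D_u, D_x⟩` applied to `x_e |x|^{-m} P(R_x u)`. -/
def kelvinCoeff (k : ℕ) (e i : Fin m) (x : E m) : ℝ :=
  (if i = e then 1 else 0) * (‖x‖ ^ m)⁻¹
    - ((m : ℝ) + 2 * k - 2) * (x e * x i * (‖x‖ ^ m)⁻¹ * (‖x‖ ^ 2)⁻¹)

/-- The partial derivatives of `kelvinCoeff`. -/
def kelvinCoeffDeriv (k : ℕ) (e i j : Fin m) (x : E m) : ℝ :=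
  -((if i = e then 1 else 0) * (m * x j * (‖x‖ ^ m)⁻¹ * (‖x‖ ^ 2)⁻¹))
    - ((m : ℝ) + 2 * k - 2) * (((if e = j then 1 else 0) * x i + x e * (if i = j then 1 else 0))
      * (‖x‖ ^ m)⁻¹ * (‖x‖ ^ 2)⁻¹
      - (m + 2) * x e * x i * x j * (‖x‖ ^ m)⁻¹ * (‖x‖ ^ 2)⁻¹ * (‖x‖ ^ 2)⁻¹)

lemma hasLineDerivAt_kelvinCoeff (k : ℕ) (e i j : Fin m) {x : E m} (hx : x ≠ 0) :
    HasLineDerivAt ℝ (kelvinCoeff k e i) (kelvinCoeffDeriv k e i j x) x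
      (EuclideanSpace.single j 1) := by
  have := hasLineDerivAt_sub
    (hasLineDerivAt_const_mul (if i = e then 1 else 0) (hasLineDerivAt_inv_norm_pow m j hx))
    (hasLineDerivAt_const_mul ((m : ℝ) + 2 * k - 2) (hasLineDerivAt_mul (hasLineDerivAt_mul
      (hasLineDerivAt_mul (hasLineDerivAt_coord e j x) (hasLineDerivAt_coord i j x))
      (hasLineDerivAt_inv_norm_pow m j hx)) (hasLineDerivAt_inv_norm_pow 2 j hx)))
  unfold kelvinCoeff
  convert! this using 1
  unfold kelvinCoeffDeriv
  push_cast
  ring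

variable {k : ℕ} {P : MvPolynomial (Fin m) ℝ}

lemma sum_ite_left_mul (e : Fin m) (f : Fin m → ℝ) :
    ∑ i, (if i = e then (1 : ℝ) else 0) * f i = f e := by simp

lemma sum_ite_right_mul (e : Fin m) (f : Fin m → ℝ) :
    ∑ i, (if e = i then (1 : ℝ) else 0) * f i = f e := by simp

/-- The result is again a sum of functions of x times harmonic polynomials at R_x u, now of degree k
- 1, so `DuDx_family` and `uDx_family` can be applied a second time. -/
lemma DuDx_kelvin (hP : IsHarmPoly P k) (e : Fin m) {x : E m} (hx : x ≠ 0) (u : E m) :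
    DuDx (fun z w => z e * (‖z‖ ^ m)⁻¹ * polyFun m P (reflect z w)) x u =
      ∑ i, kelvinCoeff k e i x * polyFun m (MvPolynomial.pderiv i P) (reflect x u) := by
  have hs : ‖x‖ ^ 2 * (‖x‖ ^ 2)⁻¹ = 1 := mul_inv_cancel₀ (by simpa using hx)
  have h := DuDx_family (ι := Unit) (ψ := fun _ z => z e * (‖z‖ ^ m)⁻¹) (P := fun _ => P)
    (ψ' := fun _ j x => (if e = j then 1 else 0) * (‖x‖ ^ m)⁻¹
      + x e * (-(m * x j * (‖x‖ ^ m)⁻¹ * (‖x‖ ^ 2)⁻¹)))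
    (fun _ j x hx => hasLineDerivAt_coord_mul_inv_norm_pow e j hx) (fun _ => hP) hx u
  simp only [Finset.univ_unique, Finset.sum_singleton] at h
  rw [h]
  have h1 : ∑ j, x j * polyFun m (MvPolynomial.pderiv j P) (reflect x u) = radDeriv P x u := rfl
  have h2 := sum_ite_right_mul e fun j => polyFun m (MvPolynomial.pderiv j P) (reflect x u)
  have h3 := sum_ite_right_mul e fun j => x j
  have h4 := sum_ite_left_mul e fun j => polyFun m (MvPolynomial.pderiv j P) (reflect x u)
  have h5 := sum_mul_self_eq x
  set N := (‖x‖ ^ m)⁻¹ with hN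
  set T := (‖x‖ ^ 2)⁻¹ with hT
  set A := radDeriv P x u with hA
  calc _ = N * (∑ j, (if e = j then (1 : ℝ) else 0) *
          polyFun m (MvPolynomial.pderiv j P) (reflect x u))
        - 2 * T * A * N * (∑ j, (if e = j then (1 : ℝ) else 0) * x j)
        - x e * m * N * T * (∑ j, x j * polyFun m (MvPolynomial.pderiv j P) (reflect x u))
        + x e * m * N * T * 2 * T * A * (∑ j, x j * x j)
        - 2 * T * (x e * N) * (m + k - 2) * A := by
        congr 1
        simp only [Finset.mul_sum, ← Finset.sum_add_distrib, ← Finset.sum_sub_distrib]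
        exact Finset.sum_congr rfl fun j _ => by ring
    _ = N * (∑ j, (if j = e then (1 : ℝ) else 0) *
          polyFun m (MvPolynomial.pderiv j P) (reflect x u))
        - (m + 2 * k - 2) * x e * N * T *
          (∑ j, x j * polyFun m (MvPolynomial.pderiv j P) (reflect x u)) := by
        rw [h1, h2, h3, h4, h5]
        linear_combination (2 * x e * m * N * T * A) * hs
    _ = _ := by
        simp only [Finset.mul_sum, ← Finset.sum_sub_distrib]
        refine Finset.sum_congr rfl fun j _ => ?_
        rw [kelvinCoeff, ← hN, ← hT]
        ring

/-- The factor m + 2k - 4 appearing here is the one that the last term of 𝒟_k divides by. -/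
lemma DuDx_DuDx_kelvin (hk : 1 ≤ k) (hP : IsHarmPoly P k) (e : Fin m) {x : E m} (hx : x ≠ 0)
    (u : E m) :
    DuDx (DuDx (fun z w => z e * (‖z‖ ^ m)⁻¹ * polyFun m P (reflect z w))) x u =
      ((m : ℝ) + 2 * k - 4) * (‖x‖ ^ m)⁻¹ * (‖x‖ ^ 2)⁻¹ *
        (-2 * radDeriv (MvPolynomial.pderiv e P) x u
          + (m + 2 * k - 2) * x e * (‖x‖ ^ 2)⁻¹ * radDeriv₂ P x u) := by
  have hs : ‖x‖ ^ 2 * (‖x‖ ^ 2)⁻¹ = 1 := mul_inv_cancel₀ (by simpa using hx)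
  -- The partial derivatives of P have the natural-number degree k - 1; since k ≥ 1 it casts to the
  -- real k - 1.
  rw [DuDx_congr isOpen_ne_zero (fun x hx u => DuDx_kelvin hP e hx u) x hx u,
    DuDx_family (fun i j x hx => hasLineDerivAt_kelvinCoeff k e i j hx) (fun i => hP.pderiv i) hx u,
    Nat.cast_sub hk]
  have h0 : ∀ i, ∑ j, x j * polyFun m (MvPolynomial.pderiv j (MvPolynomial.pderiv i P))
      (reflect x u) = radDeriv (MvPolynomial.pderiv i P) x u := fun i => rfl
  have h1 := fun i => sum_ite_right_mul e fun j =>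
    polyFun m (MvPolynomial.pderiv j (MvPolynomial.pderiv i P)) (reflect x u)
  have h2 := fun i => sum_ite_right_mul i fun j =>
    polyFun m (MvPolynomial.pderiv j (MvPolynomial.pderiv i P)) (reflect x u)
  have h3 := sum_ite_right_mul e fun j => x j
  have h4 := fun i => sum_ite_right_mul i fun j => x j
  have h5 := sum_mul_self_eq x
  have h6 := sum_ite_left_mul e fun i => radDeriv (MvPolynomial.pderiv i P) x u
  have h7 : ∑ i, x i * polyFun m (MvPolynomial.pderiv e (MvPolynomial.pderiv i P)) (reflect x u) =
      radDeriv (MvPolynomial.pderiv e P) x u := (radDeriv_pderiv P x u e).symm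
  have h8 := hP.sum_pderiv_pderiv (reflect x u)
  have h9 : ∑ i, x i * radDeriv (MvPolynomial.pderiv i P) x u = radDeriv₂ P x u := rfl
  unfold kelvinCoeffDeriv kelvinCoeff
  set N := (‖x‖ ^ m)⁻¹ with hN
  set T := (‖x‖ ^ 2)⁻¹ with hT
  have key : ∀ i, ∑ j, (-((if i = e then (1 : ℝ) else 0) * (m * x j * N * T))
      - ((m : ℝ) + 2 * k - 2) * (((if e = j then 1 else 0) * x i + x e * (if i = j then 1 else 0))
      * N * T - (m + 2) * x e * x i * x j * N * T * T)) *
        (polyFun m (MvPolynomial.pderiv j (MvPolynomial.pderiv i P)) (reflect x u)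
        - 2 * T * x j * radDeriv (MvPolynomial.pderiv i P) x u) =
      (if i = e then (1 : ℝ) else 0) * (m * N * T * radDeriv (MvPolynomial.pderiv i P) x u)
      - ((m : ℝ) + 2 * k - 2) * N * T *
        (x i * polyFun m (MvPolynomial.pderiv e (MvPolynomial.pderiv i P)) (reflect x u)
        + x e * polyFun m (MvPolynomial.pderiv i (MvPolynomial.pderiv i P)) (reflect x u)
        + (m - 2) * x e * T * (x i * radDeriv (MvPolynomial.pderiv i P) x u)) := by
    intro i
    set c := radDeriv (MvPolynomial.pderiv i P) x u with hc
    calc _ = (-((if i = e then (1 : ℝ) else 0) * (m * N * T))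
          + ((m : ℝ) + 2 * k - 2) * (m + 2) * x e * x i * N * T * T) *
          ((∑ j, x j * polyFun m (MvPolynomial.pderiv j (MvPolynomial.pderiv i P)) (reflect x u))
            - 2 * T * c * (∑ j, x j * x j))
          - ((m : ℝ) + 2 * k - 2) * N * T * x i * ((∑ j, (if e = j then (1 : ℝ) else 0) *
            polyFun m (MvPolynomial.pderiv j (MvPolynomial.pderiv i P)) (reflect x u))
            - 2 * T * c * ∑ j, (if e = j then (1 : ℝ) else 0) * x j)
          - ((m : ℝ) + 2 * k - 2) * N * T * x e * ((∑ j, (if i = j then (1 : ℝ) else 0) *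
            polyFun m (MvPolynomial.pderiv j (MvPolynomial.pderiv i P)) (reflect x u))
            - 2 * T * c * ∑ j, (if i = j then (1 : ℝ) else 0) * x j) := by
          simp only [Finset.mul_sum, ← Finset.sum_sub_distrib]
          exact Finset.sum_congr rfl fun j _ => by ring
      _ = _ := by
          rw [h0, h1, h2, h3, h4, h5]
          linear_combination (-2 * c * (-((if i = e then (1 : ℝ) else 0) * (m * N * T))
          + ((m : ℝ) + 2 * k - 2) * (m + 2) * x e * x i * N * T * T)) * hs
  simp only [key]
  set D := radDeriv (MvPolynomial.pderiv e P) x u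
  set B := radDeriv₂ P x u
  calc _ = (m * N * T - 2 * T * N * (m + (k - 1) - 2)) *
          (∑ i, (if i = e then (1 : ℝ) else 0) * radDeriv (MvPolynomial.pderiv i P) x u)
        - ((m : ℝ) + 2 * k - 2) * N * T *
          ((∑ i, x i * polyFun m (MvPolynomial.pderiv e (MvPolynomial.pderiv i P)) (reflect x u))
          + x e *
            (∑ i, polyFun m (MvPolynomial.pderiv i (MvPolynomial.pderiv i P)) (reflect x u))
          + (m - 2) * x e * T * (∑ i, x i * radDeriv (MvPolynomial.pderiv i P) x u)
          - 2 * T * (m + (k - 1) - 2) * x e * (∑ i, x i * radDeriv (MvPolynomial.pderiv i P) x u)) := by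
        simp only [Finset.mul_sum, ← Finset.sum_add_distrib, ← Finset.sum_sub_distrib]
        exact Finset.sum_congr rfl fun j _ => by push_cast; ring
    _ = _ := by
        rw [h6, h7, h8, h9]
        ring

lemma uDx_DuDx_kelvin (hk : 1 ≤ k) (hP : IsHarmPoly P k) (e : Fin m) {x : E m} (hx : x ≠ 0)
    (u : E m) :
    uDx (DuDx (fun z w => z e * (‖z‖ ^ m)⁻¹ * polyFun m P (reflect z w))) x u =
      -(‖x‖ ^ m)⁻¹ * (‖x‖ ^ 2)⁻¹ * (
        (m + 2 * k - 2) * inner ℝ u x * polyFun m (MvPolynomial.pderiv e P) (reflect x u)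
        + 2 * ‖u‖ ^ 2 * radDeriv (MvPolynomial.pderiv e P) x u
        + (m + 2 * k - 2) * (u e * radDeriv P x u + k * x e * polyFun m P (reflect x u)
          - (m + 2 * k - 2) * x e * inner ℝ u x * (‖x‖ ^ 2)⁻¹ * radDeriv P x u
          - 2 * x e * ‖u‖ ^ 2 * (‖x‖ ^ 2)⁻¹ * radDeriv₂ P x u)) := by
  rw [uDx_congr isOpen_ne_zero (fun x hx u => DuDx_kelvin hP e hx u) x hx u,
    uDx_family (fun i j x hx => hasLineDerivAt_kelvinCoeff k e i j hx) (fun i => hP.pderiv i) hx u,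
    Nat.cast_sub hk]
  have h1 := sum_ite_right_mul e fun j => u j
  have h2 := fun i => sum_ite_right_mul i fun j => u j
  have h3 : ∑ i, x i * polyFun m (MvPolynomial.pderiv i P) (reflect x u) = radDeriv P x u := rfl
  have h4 := hP.sum_mul_pderiv_reflect x u
  have h5 := sum_mul_eq_inner x u
  have h6 := sum_ite_left_mul e fun i => radDeriv (MvPolynomial.pderiv i P) x u
  have h7 := sum_ite_left_mul e fun i => polyFun m (MvPolynomial.pderiv i P) (reflect x u)
  have h9 : ∑ i, x i * radDeriv (MvPolynomial.pderiv i P) x u = radDeriv₂ P x u := rfl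
  unfold kelvinCoeffDeriv kelvinCoeff
  set N := (‖x‖ ^ m)⁻¹ with hN
  set T := (‖x‖ ^ 2)⁻¹ with hT
  set I := inner ℝ u x
  have key : ∀ i, ∑ j, u j * (-((if i = e then (1 : ℝ) else 0) * (m * x j * N * T))
      - ((m : ℝ) + 2 * k - 2) * (((if e = j then 1 else 0) * x i + x e * (if i = j then 1 else 0))
      * N * T - (m + 2) * x e * x i * x j * N * T * T)) =
      -((if i = e then (1 : ℝ) else 0) * (m * I * N * T))
      - ((m : ℝ) + 2 * k - 2) * ((u e * x i + x e * u i) * N * T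
        - (m + 2) * x e * x i * I * N * T * T) := by
    intro i
    calc _ = -((if i = e then (1 : ℝ) else 0) * (m * (∑ j, u j * x j) * N * T))
      - ((m : ℝ) + 2 * k - 2) * (((∑ j, (if e = j then (1 : ℝ) else 0) * u j) * x i
          + x e * ∑ j, (if i = j then (1 : ℝ) else 0) * u j) * N * T
        - (m + 2) * x e * x i * (∑ j, u j * x j) * N * T * T) := by
          simp only [Finset.mul_sum, Finset.sum_mul, ← Finset.sum_add_distrib,
            ← Finset.sum_sub_distrib, ← Finset.sum_neg_distrib]
          exact Finset.sum_congr rfl fun j _ => by ring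
      _ = _ := by rw [h1, h2, h5]
  simp only [key]
  set C := polyFun m (MvPolynomial.pderiv e P) (reflect x u)
  calc _ = (-(m * I * N * T) - 2 * T * N * (k - 1) * I) *
          (∑ i, (if i = e then (1 : ℝ) else 0) * polyFun m (MvPolynomial.pderiv i P) (reflect x u))
        - 2 * T * N * ‖u‖ ^ 2 *
          (∑ i, (if i = e then (1 : ℝ) else 0) * radDeriv (MvPolynomial.pderiv i P) x u)
        - ((m : ℝ) + 2 * k - 2) * N * T *
          (u e * (∑ i, x i * polyFun m (MvPolynomial.pderiv i P) (reflect x u))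
          + x e * (∑ i, u i * polyFun m (MvPolynomial.pderiv i P) (reflect x u))
          - (m + 2) * x e * I * T * (∑ i, x i * polyFun m (MvPolynomial.pderiv i P) (reflect x u))
          - 2 * T * x e * (‖u‖ ^ 2 * (∑ i, x i * radDeriv (MvPolynomial.pderiv i P) x u)
            + (k - 1) * I *
              (∑ i, x i * polyFun m (MvPolynomial.pderiv i P) (reflect x u)))) := by
        simp only [Finset.mul_sum, ← Finset.sum_add_distrib, ← Finset.sum_sub_distrib]
        exact Finset.sum_congr rfl fun j _ => by push_cast; ring
    _ = _ := by
        rw [h3, h4, h6, h7, h9]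
        ring

lemma laplacian_kelvin (hP : IsHarmPoly P k) (e : Fin m) {x : E m} (hx : x ≠ 0) (u : E m) :
    ∑ j, dx j (dx j (fun z w => z e * (‖z‖ ^ m)⁻¹ * polyFun m P (reflect z w))) x u =
      (‖x‖ ^ m)⁻¹ * (‖x‖ ^ 2)⁻¹ * (
        -4 * (u e * radDeriv P x u
          + inner ℝ u x * polyFun m (MvPolynomial.pderiv e P) (reflect x u))
        - 4 * k * x e * polyFun m P (reflect x u)
        + 4 * (m + 2 * k - 2) * x e * inner ℝ u x * (‖x‖ ^ 2)⁻¹ * radDeriv P x u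
        + 4 * x e * ‖u‖ ^ 2 * (‖x‖ ^ 2)⁻¹ * radDeriv₂ P x u) := by
  have hs : ‖x‖ ^ 2 * (‖x‖ ^ 2)⁻¹ = 1 := mul_inv_cancel₀ (by simpa using hx)
  obtain ⟨q, hq, hqs⟩ := laplacian_comp_reflect hP u hx
  have hd1 : ∀ j, ∀ x ∈ {x : E m | x ≠ 0}, ∀ u,
      dx j (fun z w => z e * (‖z‖ ^ m)⁻¹ * polyFun m P (reflect z w)) x u =
      ((if e = j then 1 else 0) * (‖x‖ ^ m)⁻¹ + x e * (-(m * x j * (‖x‖ ^ m)⁻¹ * (‖x‖ ^ 2)⁻¹))) *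
        polyFun m P (reflect x u) + x e * (‖x‖ ^ m)⁻¹ * reflectDeriv P u j x := fun j x hx u =>
    (hasLineDerivAt_mul (hasLineDerivAt_coord_mul_inv_norm_pow e j hx)
      (hasLineDerivAt_comp_reflect_left P u hx j)).lineDeriv
  have H := fun j => hasLineDerivAt_add (hasLineDerivAt_mul (hasLineDerivAt_add
      (hasLineDerivAt_const_mul (if e = j then 1 else 0) (hasLineDerivAt_inv_norm_pow m j hx))
      (hasLineDerivAt_mul (hasLineDerivAt_coord e j x) (hasLineDerivAt_const_mul (-1)
        (hasLineDerivAt_mul (hasLineDerivAt_mul (hasLineDerivAt_const_mul (m : ℝ)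
          (hasLineDerivAt_coord j j x)) (hasLineDerivAt_inv_norm_pow m j hx))
          (hasLineDerivAt_inv_norm_pow 2 j hx)))))
      (hasLineDerivAt_comp_reflect_left P u hx j))
    (hasLineDerivAt_mul (hasLineDerivAt_coord_mul_inv_norm_pow e j hx) (hq j))
  have hd2 : ∀ j, dx j (dx j (fun z w => z e * (‖z‖ ^ m)⁻¹ * polyFun m P (reflect z w))) x u = _ :=
    fun j => (dx_congr isOpen_ne_zero (hd1 j) j x hx u).trans
      (Eq.trans (by simp only [dx, neg_one_mul]) (H j).lineDeriv)
  rw [Finset.sum_congr rfl fun j _ => hd2 j]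
  have h1 := sum_ite_right_mul e fun j => u j
  have h2 := sum_ite_right_mul e fun j => x j
  have h3 := sum_ite_right_mul e fun j => polyFun m (MvPolynomial.pderiv j P) (reflect x u)
  have h4 : ∑ i, x i * polyFun m (MvPolynomial.pderiv i P) (reflect x u) = radDeriv P x u := rfl
  have h5 := sum_mul_eq_inner x u
  have h6 := sum_mul_self_eq x
  have h7 : ∑ j : Fin m, (1 : ℝ) = m := by simp
  unfold reflectDeriv
  set N := (‖x‖ ^ m)⁻¹ with hN
  set T := (‖x‖ ^ 2)⁻¹ with hT
  set I := inner ℝ u x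
  set A := radDeriv P x u
  set h := polyFun m P (reflect x u)
  calc _ = h * N * T * (-2 * m * (∑ j, (if e = j then (1 : ℝ) else 0) * x j)
          - x e * m * (∑ j : Fin m, (1 : ℝ)) + x e * m * (m + 2) * T * (∑ j, x j * x j))
        - 4 * N * T * ((∑ j, (if e = j then (1 : ℝ) else 0) * u j) * A
          + I * (∑ j, (if e = j then (1 : ℝ) else 0) *
            polyFun m (MvPolynomial.pderiv j P) (reflect x u))
          - 2 * I * T * A * (∑ j, (if e = j then (1 : ℝ) else 0) * x j))
        + 4 * N * T * T * m * x e * ((∑ j, u j * x j) * A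
          + I * (∑ j, x j * polyFun m (MvPolynomial.pderiv j P) (reflect x u))
          - 2 * I * T * A * (∑ j, x j * x j))
        + x e * N * ∑ j, q j := by
        simp only [Finset.mul_sum, Finset.sum_mul, ← Finset.sum_add_distrib,
          ← Finset.sum_sub_distrib]
        exact Finset.sum_congr rfl fun j _ => by simp only [if_true]; push_cast; ring
    _ = _ := by
        rw [h1, h2, h3, h4, h5, h6, h7, hqs]
        linear_combination (h * N * T * x e * m * (m + 2) - 8 * N * T * T * m * x e * I * A) * hs

/-- `x_e |x|^{-m} P(R_x u)` is a null solution of the bosonic Laplacian. -/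
theorem bosonicLaplacian_kelvin (hm : 3 ≤ m) (hk : 1 ≤ k) (hP : IsHarmPoly P k) (e : Fin m)
    {x : E m} (hx : x ≠ 0) (u : E m) :
    bosonicLaplacian m k (fun z w => z e * (‖z‖ ^ m)⁻¹ * polyFun m P (reflect z w)) x u = 0 := by
  have hm' : (3 : ℝ) ≤ m := by exact_mod_cast hm
  have hk' : (1 : ℝ) ≤ k := by exact_mod_cast hk
  have e1 : (m : ℝ) + 2 * k - 2 ≠ 0 := by linarith
  have e2 : (m : ℝ) + 2 * k - 4 ≠ 0 := by linarith
  rw [bosonicLaplacian, laplacian_kelvin hP e hx, uDx_DuDx_kelvin hk hP e hx,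
    DuDx_DuDx_kelvin hk hP e hx]
  -- All three terms carry the factor |x|^{-m} |x|^{-2}. Once β = m + 2k - 4 cancels, the
  -- coefficients of P and its derivatives cancel identically in α = m + 2k - 2.
  generalize (‖x‖ ^ m)⁻¹ = N
  generalize (‖x‖ ^ 2)⁻¹ = T
  generalize (m : ℝ) + 2 * k - 2 = α at *
  generalize (m : ℝ) + 2 * k - 4 = β at *
  field_simp
  ring

end KelvinTransform

/-! ### Invariance of the surface measure and the reproducing property -/

section Sphere

variable {m : ℕ}

instance : IsFiniteMeasure (surf m) := by unfold surf; infer_instance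

/-- A linear isometry as a map of the unit sphere. -/
def sphereMap (A : E m ≃ₗᵢ[ℝ] E m) (u : Metric.sphere (0 : E m) 1) : Metric.sphere (0 : E m) 1 :=
  ⟨A u, by simp⟩

-- The measure of a subset of the sphere is a multiple of the volume of the cone over it; isometries
-- map cones to cones and preserve volume.
open scoped Pointwise in
lemma measurePreserving_sphereMap (A : E m ≃ₗᵢ[ℝ] E m) :
    MeasurePreserving (sphereMap A) (surf m) (surf m) := by
  have hc : Continuous (sphereMap A) :=
    (A.continuous.comp continuous_subtype_val).subtype_mk _
  refine ⟨hc.measurable, ?_⟩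
  ext s hs
  have h : Ioo (0 : ℝ) 1 • (Subtype.val '' (sphereMap A ⁻¹' s) : Set (E m)) =
      A ⁻¹' (Ioo (0 : ℝ) 1 • (Subtype.val '' s : Set (E m))) := by
    ext u
    simp only [Set.mem_smul, Set.mem_image, Set.mem_preimage]
    constructor
    · rintro ⟨r, hr, _, ⟨w, h1, rfl⟩, rfl⟩
      exact ⟨r, hr, _, ⟨_, h1, rfl⟩, (map_smul A r (w : E m)).symm⟩
    · rintro ⟨r, hr, _, ⟨w, h1, rfl⟩, h3⟩
      have hw : sphereMap A (sphereMap A.symm w) = w := Subtype.ext (A.apply_symm_apply w)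
      refine ⟨r, hr, _, ⟨sphereMap A.symm w, by rwa [hw], rfl⟩, A.injective ?_⟩
      rw [map_smul, ← h3]
      exact congrArg (fun z : Metric.sphere (0 : E m) 1 => r • (z : E m)) hw
  rw [Measure.map_apply hc.measurable hs, surf, Measure.toSphere_apply' _ hs,
    Measure.toSphere_apply' _ (hc.measurable hs), h,
    A.measurePreserving.measure_preimage_emb A.toHomeomorph.measurableEmbedding]

lemma measurableEmbedding_sphereMap (A : E m ≃ₗᵢ[ℝ] E m) : MeasurableEmbedding (sphereMap A) := by
  have hc : ∀ A : E m ≃ₗᵢ[ℝ] E m, Continuous (sphereMap A) := fun A =>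
    (A.continuous.comp continuous_subtype_val).subtype_mk _
  refine MeasurableEmbedding.of_measurable_inverse (g := sphereMap A.symm) (hc A).measurable ?_
    (hc A.symm).measurable fun u => Subtype.ext (A.symm_apply_apply u)
  rw [Function.Surjective.range_eq fun u =>
    ⟨sphereMap A.symm u, Subtype.ext (A.apply_symm_apply u)⟩]
  exact MeasurableSet.univ

lemma integral_sphere_reflect (φ : E m → ℝ) (x : E m) :
    ∫ u : Metric.sphere (0 : E m) 1, φ (reflect x u) ∂(surf m) =
      ∫ u : Metric.sphere (0 : E m) 1, φ u ∂(surf m) := by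
  simpa [sphereMap, reflectIso_apply] using
    (measurePreserving_sphereMap (reflectIso x)).integral_comp
      (measurableEmbedding_sphereMap (reflectIso x)) fun u => φ u

/-- Substituting R_x u for u moves the reflection from the kernel to f, which stays in ℋ_k. -/
lemma Z_reflect_reproducing {k : ℕ} [NeZero m] {f : E m → ℝ} (hf : f ∈ Harm m k) (x v : E m) :
    ∫ u : Metric.sphere (0 : E m) 1, Z m k (reflect x u) v * f u ∂(surf m) = f (reflect x v) := by
  rw [← Z_reproducing m k _ (Harm.comp_reflect hf x) v,
    ← integral_sphere_reflect (fun u => Z m k u v * f (reflect x u)) x]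
  simp only [reflect_reflect]

lemma sphereArea_pos [NeZero m] : 0 < sphereArea m := by
  have : Nontrivial (E m) := ⟨EuclideanSpace.single 0 1, 0, by
    rw [Ne, PiLp.single_eq_zero_iff]; exact one_ne_zero⟩
  rw [sphereArea, measureReal_def, ENNReal.toReal_pos_iff]
  refine ⟨?_, measure_lt_top _ _⟩
  rw [Measure.measure_univ_pos, surf]
  exact Measure.toSphere_ne_zero _

end Sphere

/-! ### Coordinates (x', y) of the half-space -/

section Join

variable {n : ℕ}

@[simp] lemma join_last (a : E n) (y : ℝ) : join a y (Fin.last n) = y := by simp [join]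

@[simp] lemma join_castSucc (a : E n) (y : ℝ) (i : Fin n) : join a y i.castSucc = a i := by
  simp [join]

lemma ext_join {x z : E (n + 1)} (h1 : ∀ i : Fin n, x i.castSucc = z i.castSucc)
    (h2 : x (Fin.last n) = z (Fin.last n)) : x = z := by
  ext i
  exact Fin.lastCases h2 h1 i

lemma join_sub_join (a b : E n) (y z : ℝ) : join a y - join b z = join (a - b) (y - z) :=
  ext_join (by simp) (by simp)

lemma smul_join (r : ℝ) (a : E n) (y : ℝ) : r • join a y = join (r • a) (r * y) :=
  ext_join (by simp) (by simp)

lemma norm_join_sq (a : E n) (y : ℝ) : ‖join a y‖ ^ 2 = ‖a‖ ^ 2 + y ^ 2 := by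
  rw [EuclideanSpace.real_norm_sq_eq, EuclideanSpace.real_norm_sq_eq, Fin.sum_univ_castSucc]
  simp

lemma continuous_join : Continuous fun z : E n × ℝ => join z.1 z.2 := by
  refine (PiLp.continuous_toLp 2 _).comp (continuous_pi fun i => ?_)
  refine Fin.lastCases ?_ (fun i => ?_) i
  · simpa using continuous_snd
  · simp only [Fin.snoc_castSucc]
    fun_prop

lemma join_ne_zero (a : E n) {y : ℝ} (hy : y ≠ 0) : join a y ≠ 0 := fun h =>
  hy (by simpa using congrArg (fun x : E (n + 1) => x (Fin.last n)) h)

lemma abs_le_norm_join (a : E n) (y : ℝ) : |y| ≤ ‖join a y‖ :=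
  abs_le_of_sq_le_sq (by rw [norm_join_sq]; linarith [sq_nonneg ‖a‖]) (norm_nonneg _)

lemma norm_le_norm_join (a : E n) (y : ℝ) : ‖a‖ ≤ ‖join a y‖ :=
  le_of_abs_le (abs_le_of_sq_le_sq (by rw [norm_join_sq]; linarith [sq_nonneg y]) (norm_nonneg _))

end Join

/-! ### The Poisson integral as an average of translated, reflected data -/

section Poisson

variable {n k : ℕ}

lemma cConst_pos (hn : 2 ≤ n) : 0 < cConst (n + 1) k := by
  have : (2 : ℝ) ≤ n := by exact_mod_cast hn
  have := sphereArea_pos (m := n + 1)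
  have hk : (0 : ℝ) ≤ k := k.cast_nonneg
  unfold cConst
  push_cast
  refine div_pos (by linarith) (mul_pos (by linarith) this)

/-- The spherical integral is evaluated by the reproducing property, leaving the datum at the
reflected point. -/
lemma poissonIntegral_eq {f : E n → E (n + 1) → ℝ} (hf : ∀ t, f t ∈ Harm (n + 1) k)
    (x v : E (n + 1)) :
    poissonIntegral n k f x v = ∫ t : E n,
      cConst (n + 1) k * (x (Fin.last n) / ‖x - join t 0‖ ^ (n + 1)) *
        f t (reflect (x - join t 0) v) := by
  unfold poissonIntegral poissonKernel
  congr 1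
  ext t
  simp_rw [mul_assoc, integral_const_mul]
  rw [Z_reflect_reproducing (hf t)]

/-- The Poisson kernel at height one, without the zonal factor. -/
def weight (n k : ℕ) (s : E n) : ℝ := cConst (n + 1) k * (‖join s 1‖ ^ (n + 1))⁻¹

/-- Substitute t = x' - y s: then x - t = y (s, 1), the Jacobian y^n and the numerator y cancel
y^{n+1} from the norm, and the reflection depends only on the line through (s, 1). -/
lemma poissonIntegral_join_eq {f : E n → E (n + 1) → ℝ} (hf : ∀ t, f t ∈ Harm (n + 1) k)
    (x' : E n) {y : ℝ} (hy : 0 < y) (v : E (n + 1)) :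
    poissonIntegral n k f (join x' y) v = ∫ s : E n,
      weight n k s * f (x' - y • s) (reflect (join s 1) v) := by
  rw [poissonIntegral_eq hf, ← integral_sub_left_eq_self _ _ x']
  have h := Measure.integral_comp_smul (volume : Measure (E n)) (fun t => cConst (n + 1) k *
    (join x' y (Fin.last n) / ‖join x' y - join (x' - t) 0‖ ^ (n + 1)) *
        f (x' - t) (reflect (join x' y - join (x' - t) 0) v)) y
  have hy0 : y ≠ 0 := hy.ne'
  rw [finrank_euclideanSpace_fin, smul_eq_mul, abs_of_pos (by positivity)] at h
  have h2 := congrArg (fun r => y ^ n * r) h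
  rw [mul_inv_cancel_left₀ (by positivity), ← integral_const_mul] at h2
  rw [← h2]
  congr 1
  ext s
  have e1 : join x' y - join (x' - y • s) 0 = y • join s 1 := by
    rw [join_sub_join, smul_join]
    simp
  rw [e1, reflect_smul_left hy0, norm_smul, Real.norm_of_nonneg hy.le, weight, join_last]
  have : ‖join s 1‖ ≠ 0 := norm_ne_zero_iff.2 (join_ne_zero s one_ne_zero)
  rw [mul_pow, pow_succ y]
  field_simp

end Poisson

/-! ### Gaussian integrals of reflected harmonic polynomials -/

section Gaussian

variable {m : ℕ}

/-- A polynomial is bounded by the corresponding power of `1 + ‖u‖`. -/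
lemma exists_polyFun_bound (Q : MvPolynomial (Fin m) ℝ) :
    ∃ C : ℝ, 0 ≤ C ∧ ∀ u : E m, |polyFun m Q u| ≤ C * (1 + ‖u‖) ^ Q.totalDegree := by
  refine ⟨∑ d ∈ Q.support, |Q.coeff d|, Finset.sum_nonneg fun _ _ => abs_nonneg _, fun u => ?_⟩
  rw [polyFun_apply, MvPolynomial.eval_eq', Finset.sum_mul]
  refine (Finset.abs_sum_le_sum_abs _ _).trans (Finset.sum_le_sum fun d hd => ?_)
  rw [abs_mul, Finset.abs_prod]
  refine mul_le_mul_of_nonneg_left ?_ (abs_nonneg _)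
  have h1 : ∀ i, |u i ^ d i| ≤ (1 + ‖u‖) ^ d i := fun i => by
    rw [abs_pow]
    have := PiLp.norm_apply_le u i
    rw [Real.norm_eq_abs] at this
    gcongr
    linarith
  refine (Finset.prod_le_prod (fun _ _ => abs_nonneg _) fun i _ => h1 i).trans ?_
  rw [Finset.prod_pow_eq_pow_sum]
  refine pow_le_pow_right₀ (by linarith [norm_nonneg u]) ?_
  have := MvPolynomial.le_totalDegree hd
  rwa [Finsupp.sum_fintype _ _ fun _ => rfl] at this

lemma exists_pow_mul_exp_bound (N : ℕ) :
    ∃ C : ℝ, ∀ r : ℝ, 0 ≤ r → (1 + r) ^ N * Real.exp (-r ^ 2) ≤ C := by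
  -- From (1 + r)^N ≤ N! exp(1 + r) and 1 + r - r² ≤ 2.
  refine ⟨N.factorial * Real.exp 2, fun r hr => ?_⟩
  have h1 := Real.pow_div_factorial_le_exp (1 + r) (by linarith) N
  have h2 : (0 : ℝ) < N.factorial := by exact_mod_cast N.factorial_pos
  rw [div_le_iff₀ h2] at h1
  calc (1 + r) ^ N * Real.exp (-r ^ 2) ≤ Real.exp (1 + r) * N.factorial * Real.exp (-r ^ 2) := by
        gcongr
    _ = N.factorial * Real.exp (1 + r + -r ^ 2) := by rw [Real.exp_add (1 + r)]; ring
    _ ≤ _ := by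
        gcongr
        nlinarith [sq_nonneg (r - 1)]

lemma integrable_polyFun_mul_gaussian (Q : MvPolynomial (Fin m) ℝ) :
    Integrable fun x : E m => polyFun m Q x * Real.exp (-‖x‖ ^ 2) := by
  obtain ⟨C, hC, hQ⟩ := exists_polyFun_bound Q
  obtain ⟨D, hD⟩ := exists_pow_mul_exp_bound (Q.totalDegree + (m + 1))
  have hint : Integrable fun x : E m => (1 + ‖x‖) ^ (-((m + 1 : ℕ) : ℝ)) :=
    integrable_one_add_norm (by simp)
  refine (hint.const_mul (C * D)).mono'
    ((continuous_polyFun Q).mul (by fun_prop)).aestronglyMeasurable (ae_of_all _ fun x => ?_)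
  have h0 : (0 : ℝ) < 1 + ‖x‖ := by linarith [norm_nonneg x]
  rw [norm_mul, Real.norm_eq_abs, Real.norm_eq_abs, Real.abs_exp, Real.rpow_neg h0.le,
    Real.rpow_natCast]
  have h1 := hD ‖x‖ (norm_nonneg x)
  rw [← div_eq_mul_inv, le_div_iff₀ (by positivity)]
  calc _ ≤ C * (1 + ‖x‖) ^ Q.totalDegree * Real.exp (-‖x‖ ^ 2) * (1 + ‖x‖) ^ (m + 1) := by
        gcongr
        exact hQ x
    _ = C * ((1 + ‖x‖) ^ (Q.totalDegree + (m + 1)) * Real.exp (-‖x‖ ^ 2)) := by ring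
    _ ≤ _ := by gcongr

/-- Integration of polynomials against `exp (-|x|²)`. -/
def gaussInt (m : ℕ) : MvPolynomial (Fin m) ℝ →ₗ[ℝ] ℝ where
  toFun Q := ∫ x : E m, polyFun m Q x * Real.exp (-‖x‖ ^ 2)
  map_add' P Q := by
    rw [← integral_add (integrable_polyFun_mul_gaussian P) (integrable_polyFun_mul_gaussian Q)]
    simp [add_mul]
  map_smul' r P := by
    simp [mul_assoc, integral_const_mul]

lemma gaussInt_apply (Q : MvPolynomial (Fin m) ℝ) :
    gaussInt m Q = ∫ x : E m, polyFun m Q x * Real.exp (-‖x‖ ^ 2) := rfl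

lemma gaussInt_C_mul (a : ℝ) (Q : MvPolynomial (Fin m) ℝ) :
    gaussInt m (MvPolynomial.C a * Q) = a * gaussInt m Q := by
  rw [MvPolynomial.C_mul', map_smul, smul_eq_mul]

/-- Integration by parts. -/
lemma gaussInt_pderiv (i : Fin m) (Q : MvPolynomial (Fin m) ℝ) :
    gaussInt m (MvPolynomial.pderiv i Q) = 2 * gaussInt m (MvPolynomial.X i * Q) := by
  have hg : ∀ x : E m, HasFDerivAt (fun x : E m => Real.exp (-‖x‖ ^ 2))
      (Real.exp (-‖x‖ ^ 2) • (-((2 : ℕ) • innerSL ℝ x) : E m →L[ℝ] ℝ)) x := fun x =>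
    ((hasStrictFDerivAt_norm_sq x).hasFDerivAt.neg).exp
  have hg' : ∀ x : E m, fderiv ℝ (fun x : E m => Real.exp (-‖x‖ ^ 2)) x
      (EuclideanSpace.single i 1) = -2 * x i * Real.exp (-‖x‖ ^ 2) := fun x => by
    rw [(hg x).fderiv]
    simp [EuclideanSpace.inner_single_right]
    ring
  have hf' : ∀ x : E m, fderiv ℝ (polyFun m Q) x (EuclideanSpace.single i 1) =
      polyFun m (MvPolynomial.pderiv i Q) x := fun x => by
    rw [(hasFDerivAt_polyFun Q x).fderiv]
    simp
  have h2 := integrable_polyFun_mul_gaussian (MvPolynomial.C (-2) * (MvPolynomial.X i * Q))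
  have e2 : (fun x : E m => polyFun m (MvPolynomial.C (-2) * (MvPolynomial.X i * Q)) x *
      Real.exp (-‖x‖ ^ 2)) = fun x => polyFun m Q x * (-2 * x i * Real.exp (-‖x‖ ^ 2)) := by
    ext x
    simp only [polyFun_mul, polyFun_C, polyFun_X]
    ring
  have h := integral_mul_fderiv_eq_neg_fderiv_mul_of_integrable (μ := (volume : Measure (E m)))
    (f := polyFun m Q) (g := fun x => Real.exp (-‖x‖ ^ 2)) (v := EuclideanSpace.single i 1)
    (by simpa only [hf'] using integrable_polyFun_mul_gaussian (MvPolynomial.pderiv i Q))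
    (by simpa only [hg', e2] using h2)
    (integrable_polyFun_mul_gaussian Q)
    (fun x _ => (hasFDerivAt_polyFun Q x).differentiableAt) (fun x _ => (hg x).differentiableAt)
  simp only [hf', hg'] at h
  rw [← e2, ← gaussInt_apply, ← gaussInt_apply, gaussInt_C_mul] at h
  linarith

lemma pderiv_aeval {σ : Type*} [Fintype σ] (g : σ → MvPolynomial (Fin m) ℝ) (P : MvPolynomial σ ℝ)
    (j : Fin m) :
    MvPolynomial.pderiv j (MvPolynomial.aeval g P) =
      ∑ l, MvPolynomial.aeval g (MvPolynomial.pderiv l P) * MvPolynomial.pderiv j (g l) := by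
  classical
  induction P using MvPolynomial.induction_on with
  | C a => simp [MvPolynomial.algebraMap_eq]
  | add P Q hP hQ => simp only [map_add, hP, hQ, add_mul, Finset.sum_add_distrib]
  | mul_X P l hP =>
    simp only [map_mul, Derivation.leibniz, hP, smul_eq_mul, map_add, MvPolynomial.aeval_X,
      add_mul, Finset.sum_add_distrib, MvPolynomial.pderiv_X]
    congr 1
    · rw [Finset.sum_eq_single l]
      · simp
      · intro b _ hb
        simp [Ne.symm hb]
      · simp
    · rw [Finset.mul_sum]
      exact Finset.sum_congr rfl fun i _ => by ring

/-- The components of `|x|² v - 2 ⟨v, x⟩ x`, as polynomials in `x`. -/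
def reflPoly (v : E m) (i : Fin m) : MvPolynomial (Fin m) ℝ :=
  MvPolynomial.C (v i) * (∑ j, MvPolynomial.X j * MvPolynomial.X j)
    - MvPolynomial.C 2 * (∑ j, MvPolynomial.C (v j) * MvPolynomial.X j) * MvPolynomial.X i

/-- Arranges the product as the monomials X_i X_i Q and X_j X_l Q to which the two integrations by
parts below apply. -/
lemma reflPoly_mul (v : E m) (j : Fin m) (Q : MvPolynomial (Fin m) ℝ) :
    reflPoly v j * Q = MvPolynomial.C (v j) * (∑ i, MvPolynomial.X i * (MvPolynomial.X i * Q))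
      - MvPolynomial.C 2 * ∑ l, MvPolynomial.C (v l) * (MvPolynomial.X j * (MvPolynomial.X l * Q)) := by
  have h1 : ∑ i, MvPolynomial.X i * (MvPolynomial.X i * Q) =
      (∑ i, MvPolynomial.X i * MvPolynomial.X i) * Q := by
    rw [Finset.sum_mul]
    exact Finset.sum_congr rfl fun i _ => by ring
  have h2 : ∑ l, MvPolynomial.C (v l) * (MvPolynomial.X j * (MvPolynomial.X l * Q)) =
      (∑ l, MvPolynomial.C (v l) * MvPolynomial.X l) * MvPolynomial.X j * Q := by
    rw [Finset.sum_mul, Finset.sum_mul]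
    exact Finset.sum_congr rfl fun i _ => by ring
  rw [h1, h2, reflPoly]
  ring

lemma isHomogeneous_reflPoly (v : E m) (i : Fin m) : (reflPoly v i).IsHomogeneous 2 := by
  have hX := fun j => MvPolynomial.isHomogeneous_X (σ := Fin m) ℝ j
  have hC := fun a => MvPolynomial.isHomogeneous_C (Fin m) (R := ℝ) a
  refine MvPolynomial.IsHomogeneous.sub ?_ ?_
  · simpa using (hC (v i)).mul
      (MvPolynomial.IsHomogeneous.sum Finset.univ _ 2 fun j _ => (hX j).mul (hX j))
  · simpa using ((hC 2).mul (MvPolynomial.IsHomogeneous.sum Finset.univ _ 1 fun j _ => by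
      simpa using (hC (v j)).mul (hX j))).mul (hX i)

lemma pderiv_reflPoly (v : E m) (i l : Fin m) :
    MvPolynomial.pderiv i (reflPoly v l) =
      MvPolynomial.C 2 * (MvPolynomial.C (v l) * MvPolynomial.X i)
        - MvPolynomial.C 2 * (MvPolynomial.C (v i) * MvPolynomial.X l)
        - MvPolynomial.C 2 * (∑ j, MvPolynomial.C (v j) * MvPolynomial.X j) *
          (if i = l then 1 else 0) := by
  classical
  have h1 : MvPolynomial.pderiv i (∑ j, MvPolynomial.X j * MvPolynomial.X j :
      MvPolynomial (Fin m) ℝ) = MvPolynomial.C 2 * MvPolynomial.X i := by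
    rw [map_sum, Finset.sum_eq_single i]
    · simp only [Derivation.leibniz, MvPolynomial.pderiv_X_self, smul_eq_mul, mul_one]
      rw [← two_mul]
      rfl
    · intro b _ hb
      simp [hb]
    · simp
  have h2 : MvPolynomial.pderiv i (∑ j, MvPolynomial.C (v j) * MvPolynomial.X j :
      MvPolynomial (Fin m) ℝ) = MvPolynomial.C (v i) := by
    rw [map_sum, Finset.sum_eq_single i]
    · simp
    · intro b _ hb
      simp [hb]
    · simp
  rw [reflPoly, map_sub, MvPolynomial.pderiv_C_mul, h1, mul_assoc, MvPolynomial.pderiv_C_mul,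
    Derivation.leibniz, h2, MvPolynomial.pderiv_X, smul_eq_mul, smul_eq_mul]
  by_cases h : i = l
  · subst h
    simp only [Pi.single_eq_same, if_true]
    ring
  · rw [Pi.single_eq_of_ne (Ne.symm h)]
    simp only [h, if_false]
    ring

lemma polyFun_aeval_reflPoly (v x : E m) (P : MvPolynomial (Fin m) ℝ) :
    polyFun m (MvPolynomial.aeval (reflPoly v) P) x =
      polyFun m P (‖x‖ ^ 2 • v - (2 * inner ℝ v x) • x) := by
  induction P using MvPolynomial.induction_on with
  | C a => simp [MvPolynomial.algebraMap_eq]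
  | add P Q hP hQ => simp only [map_add, Pi.add_apply, hP, hQ]
  | mul_X P i hP =>
    rw [map_mul, polyFun_mul, hP, polyFun_mul, polyFun_X, MvPolynomial.aeval_X]
    congr 1
    have h1 : polyFun m (reflPoly v i) x =
        v i * (∑ j, x j * x j) - 2 * (∑ j, v j * x j) * x i := by
      simp only [reflPoly, map_sub, Pi.sub_apply, polyFun_mul, polyFun_C, polyFun_sum, polyFun_X]
    rw [h1, sum_mul_self_eq, sum_mul_eq_inner]
    simp [mul_comm]

namespace IsHarmPoly

variable {k : ℕ} {P : MvPolynomial (Fin m) ℝ}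

/-- Let S(x) = |x|² v - 2⟨v, x⟩ x. Its Jacobian is an antisymmetric matrix minus 2⟨v, x⟩ times the
identity. Contracted with the symmetric Hessian of P at S(x), the first part gives zero and the
second a multiple of ΔP = 0. So the gradient of P at S(x), as a vector field in x, is divergence
free. -/
lemma sum_pderiv_aeval_reflPoly (h : IsHarmPoly P k) (v : E m) :
    ∑ i, MvPolynomial.pderiv i (MvPolynomial.aeval (reflPoly v) (MvPolynomial.pderiv i P)) = 0 := by
  have h1 : ∑ i, MvPolynomial.aeval (reflPoly v)
      (MvPolynomial.pderiv i (MvPolynomial.pderiv i P)) = 0 := by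
    rw [← map_sum, ← polyLaplacian_apply, h.laplacian, map_zero]
  simp_rw [pderiv_aeval, pderiv_reflPoly, mul_sub, Finset.sum_sub_distrib]
  have h2 : ∑ i, ∑ l, MvPolynomial.aeval (reflPoly v)
        (MvPolynomial.pderiv l (MvPolynomial.pderiv i P)) *
          (MvPolynomial.C 2 * (MvPolynomial.C (v l) * MvPolynomial.X i)) =
      ∑ i, ∑ l, MvPolynomial.aeval (reflPoly v)
        (MvPolynomial.pderiv l (MvPolynomial.pderiv i P)) *
          (MvPolynomial.C 2 * (MvPolynomial.C (v i) * MvPolynomial.X l)) := by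
    rw [Finset.sum_comm]
    exact Finset.sum_congr rfl fun i _ => Finset.sum_congr rfl fun l _ => by
      rw [pderiv_pderiv_comm i l]
  rw [h2, sub_self, zero_sub, neg_eq_zero]
  simp_rw [mul_ite, mul_one, mul_zero, Finset.sum_ite_eq, Finset.mem_univ, if_true,
    ← Finset.sum_mul]
  rw [h1, zero_mul]

/-- Integration by parts in x_i: the divergence vanishes, and only the derivative of the factor x_j
with i = j remains. -/
lemma gaussInt_pderiv_refl (h : IsHarmPoly P k) (v : E m) (j : Fin m) :
    2 * ∑ i, gaussInt m (MvPolynomial.X i *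
        (MvPolynomial.X j * MvPolynomial.aeval (reflPoly v) (MvPolynomial.pderiv i P))) =
      gaussInt m (MvPolynomial.aeval (reflPoly v) (MvPolynomial.pderiv j P)) := by
  classical
  rw [Finset.mul_sum]
  simp_rw [← gaussInt_pderiv, Derivation.leibniz, map_add, smul_eq_mul]
  rw [Finset.sum_add_distrib, ← map_sum, ← Finset.mul_sum, h.sum_pderiv_aeval_reflPoly, mul_zero,
    map_zero, zero_add, ← map_sum, Finset.sum_eq_single j]
  · simp
  · intro b _ hb
    simp [MvPolynomial.pderiv_X_of_ne (Ne.symm hb)]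
  · simp

end IsHarmPoly

/-- Integration by parts and Euler's relation: m comes from the derivatives of x_i, d from the
homogeneity of Q. -/
lemma gaussInt_sum_X_mul_X {d : ℕ} {Q : MvPolynomial (Fin m) ℝ} (hQ : Q.IsHomogeneous d) :
    2 * ∑ i, gaussInt m (MvPolynomial.X i * (MvPolynomial.X i * Q)) =
      ((m : ℝ) + d) * gaussInt m Q := by
  rw [Finset.mul_sum]
  simp_rw [← gaussInt_pderiv, Derivation.leibniz, map_add, smul_eq_mul]
  rw [Finset.sum_add_distrib, ← map_sum, hQ.sum_X_mul_pderiv, map_nsmul]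
  simp only [MvPolynomial.pderiv_X_self, mul_one, Finset.sum_const, Finset.card_univ,
    Fintype.card_fin, nsmul_eq_mul]
  ring

/-- The eigenvalues of the averaging operators over reflections, with a Gaussian weight. -/
def gaussConst (m : ℕ) : ℕ → ℝ
  | 0 => gaussInt m 1
  | k + 1 => ((m : ℝ) + 2 * k - 2) / 2 * gaussConst m k

/-- Induction on the degree. With S(x) = |x|² v - 2⟨v, x⟩ x, Euler's relation expresses (k + 1) P(S)
through the products of S_j with the derivative ∂_j P at S, which is homogeneous of degree 2k in x.
The part |x|² v_j contributes (m + 2k)/2 and the part -2⟨v, x⟩ x_j contributes -1, each times the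
previous constant and Σ v_j ∂_j P(v). Euler's relation at v closes the step. -/
lemma gaussInt_refl {k : ℕ} : ∀ {P : MvPolynomial (Fin m) ℝ}, IsHarmPoly P k → ∀ v : E m,
    gaussInt m (MvPolynomial.aeval (reflPoly v) P) = gaussConst m k * polyFun m P v := by
  induction k with
  | zero =>
    intro P hP v
    obtain ⟨a, rfl⟩ : ∃ a, P = MvPolynomial.C a :=
      ⟨_, MvPolynomial.totalDegree_eq_zero_iff_eq_C.1 (Nat.le_zero.1 hP.homogeneous.totalDegree_le)⟩
    rw [polyFun_C, gaussConst]
    have := gaussInt_C_mul a (1 : MvPolynomial (Fin m) ℝ)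
    rw [mul_one] at this
    simpa [MvPolynomial.algebraMap_eq, mul_comm] using this
  | succ k ih =>
    intro P hP v
    set S := MvPolynomial.aeval (R := ℝ) (reflPoly v) with hS
    have hQ : ∀ j, (S (MvPolynomial.pderiv j P)).IsHomogeneous (2 * k) := fun j =>
      (hP.pderiv j).homogeneous.aeval _ (isHomogeneous_reflPoly v)
    have h1 : ∀ j, gaussInt m (S (MvPolynomial.pderiv j P)) =
        gaussConst m k * polyFun m (MvPolynomial.pderiv j P) v := fun j => ih (hP.pderiv j) v
    have e1 := congrArg (fun Q => gaussInt m (S Q)) hP.homogeneous.sum_X_mul_pderiv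
    simp only [map_sum, map_mul, map_nsmul] at e1
    have hX : ∀ j, S (MvPolynomial.X j) = reflPoly v j := fun j => MvPolynomial.aeval_X _ _
    have e2 : ∀ j, gaussInt m (S (MvPolynomial.X j) * S (MvPolynomial.pderiv j P)) =
        v j * (∑ i, gaussInt m (MvPolynomial.X i *
          (MvPolynomial.X i * S (MvPolynomial.pderiv j P))))
        - 2 * ∑ l, v l * gaussInt m (MvPolynomial.X j *
          (MvPolynomial.X l * S (MvPolynomial.pderiv j P))) := by
      intro j
      rw [hX, reflPoly_mul, map_sub, gaussInt_C_mul, map_sum, gaussInt_C_mul, map_sum,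
        Finset.sum_congr rfl fun l _ => gaussInt_C_mul _ _]
    have e3 := fun j => gaussInt_sum_X_mul_X (hQ j)
    have e4 := fun l => hP.gaussInt_pderiv_refl v l
    rw [Finset.sum_congr rfl fun j _ => e2 j, Finset.sum_sub_distrib, ← Finset.mul_sum,
      Finset.sum_comm (γ := Fin m) (f := fun j l => v l * gaussInt m (MvPolynomial.X j *
          (MvPolynomial.X l * S (MvPolynomial.pderiv j P)))),
      Finset.sum_congr rfl fun l _ => (Finset.mul_sum Finset.univ (fun j => gaussInt m
        (MvPolynomial.X j * (MvPolynomial.X l * S (MvPolynomial.pderiv j P)))) (v l)).symm] at e1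
    have e5 : ∑ j, v j * (∑ i, gaussInt m (MvPolynomial.X i *
          (MvPolynomial.X i * S (MvPolynomial.pderiv j P)))) =
        ((m : ℝ) + 2 * k) / 2 * gaussConst m k *
          ∑ j, v j * polyFun m (MvPolynomial.pderiv j P) v := by
      rw [Finset.mul_sum]
      refine Finset.sum_congr rfl fun j _ => ?_
      have := e3 j
      rw [h1] at this
      push_cast at this
      linear_combination (v j / 2) * this
    have e6 : ∑ l, v l * (∑ j, gaussInt m (MvPolynomial.X j *
          (MvPolynomial.X l * S (MvPolynomial.pderiv j P)))) =
        1 / 2 * gaussConst m k * ∑ j, v j * polyFun m (MvPolynomial.pderiv j P) v := by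
      rw [Finset.mul_sum]
      refine Finset.sum_congr rfl fun l _ => ?_
      have := e4 l
      rw [h1] at this
      linear_combination (v l / 2) * this
    rw [e5, e6, hP.euler, nsmul_eq_mul] at e1
    have hk : ((k + 1 : ℕ) : ℝ) ≠ 0 := by positivity
    rw [gaussConst]
    apply mul_left_cancel₀ hk
    linear_combination -e1

lemma gaussInt_one : gaussInt m 1 = Real.pi ^ ((m : ℝ) / 2) := by
  have := GaussianFourier.integral_rexp_neg_mul_sq_norm (V := E m) one_pos
  simpa [gaussInt_apply, polyFun_apply] using this

lemma sphereArea_eq [NeZero m] : sphereArea m * Real.Gamma (m / 2) = 2 * Real.pi ^ ((m : ℝ) / 2) := by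
  have : Nonempty (Fin m) := ⟨0⟩
  have hm : (0 : ℝ) < m := by exact_mod_cast Nat.pos_of_ne_zero (NeZero.ne m)
  have hΓ : 0 < Real.Gamma (m / 2) := Real.Gamma_pos_of_pos (by positivity)
  rw [sphereArea, surf, Measure.toSphere_real_apply_univ, measureReal_def,
    EuclideanSpace.volume_ball, finrank_euclideanSpace_fin, Fintype.card_fin,
    Real.Gamma_add_one (by positivity)]
  rw [ENNReal.ofReal_one, one_pow, one_mul, ENNReal.toReal_ofReal (by positivity),
    Real.sqrt_eq_rpow, ← Real.rpow_natCast, ← Real.rpow_mul Real.pi_pos.le,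
    one_div_mul_eq_div]
  field_simp

/-- Solves the recursion. The factors m + 2k - 2 telescope up to an index shift against Γ(m/2 + k +
1) = (m/2 + k) Γ(m/2 + k); multiplying out avoids dividing by m - 2. -/
lemma gaussConst_eq [NeZero m] (k : ℕ) :
    gaussConst m k * (2 * ((m : ℝ) + 2 * k - 2)) =
      ((m : ℝ) - 2) * sphereArea m * Real.Gamma (m / 2 + k) := by
  have hm : (0 : ℝ) < m := by exact_mod_cast Nat.pos_of_ne_zero (NeZero.ne m)
  induction k with
  | zero =>
    have := sphereArea_eq (m := m)
    rw [gaussConst, gaussInt_one]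
    push_cast
    rw [add_zero, mul_assoc, this]
    ring
  | succ k ih =>
    rw [gaussConst]
    push_cast
    rw [← add_assoc, Real.Gamma_add_one (by positivity)]
    linear_combination ((m : ℝ) / 2 + k) * ih

end Gaussian

/-! ### The Poisson average reproduces ℋ_k -/

section Normalization

variable {n k : ℕ}

lemma measurePreserving_join :
    MeasurePreserving (fun z : E n × ℝ => join z.1 z.2)
      ((volume : Measure (E n)).prod (volume : Measure ℝ)) volume := by
  have h1 := (PiLp.volume_preserving_ofLp (Fin n)).prod (MeasurePreserving.id (volume : Measure ℝ))
  have h2 := Measure.measurePreserving_swap (μ := (volume : Measure (Fin n → ℝ)))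
    (ν := (volume : Measure ℝ))
  have h3 := (volume_preserving_piFinSuccAbove (fun _ : Fin (n + 1) => ℝ) (Fin.last n)).symm
  have h4 := PiLp.volume_preserving_toLp (Fin (n + 1))
  convert! h4.comp (h3.comp (h2.comp h1)) using 1
  ext z i
  refine Fin.lastCases ?_ (fun i => ?_) i
  · simp [MeasurableEquiv.piFinSuccAbove, Fin.insertNthEquiv]
  · simp [MeasurableEquiv.piFinSuccAbove, Fin.insertNthEquiv, Fin.insertNth_last']

lemma integrable_abs_pow_mul_exp (N : ℕ) {b : ℝ} (hb : 0 < b) :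
    Integrable fun s : ℝ => |s| ^ N * Real.exp (-b * s ^ 2) := by
  have hN : (-1 : ℝ) < N := by linarith [N.cast_nonneg (α := ℝ)]
  have := (integrable_rpow_mul_exp_neg_mul_sq hb hN).norm
  simpa [Real.rpow_natCast] using this

lemma integral_abs_pow_mul_exp (N : ℕ) {r : ℝ} (hr : 0 < r) :
    ∫ s : ℝ, |s| ^ N * Real.exp (-r ^ 2 * s ^ 2) =
      Real.Gamma (((N : ℝ) + 1) / 2) * (r ^ (N + 1))⁻¹ := by
  have hN : (-1 : ℝ) < N := by linarith [N.cast_nonneg (α := ℝ)]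
  have h1 := integral_comp_abs (f := fun s : ℝ => s ^ N * Real.exp (-r ^ 2 * s ^ 2))
  have h2 := integral_rpow_mul_exp_neg_mul_rpow (p := 2) (q := N) (b := r ^ 2) two_pos hN
    (by positivity)
  simp only [Real.rpow_natCast, Real.rpow_ofNat] at h2
  simp only [sq_abs] at h1
  rw [h1, h2]
  have h3 : (r ^ 2) ^ (-((N : ℝ) + 1) / 2) = (r ^ (N + 1))⁻¹ := by
    rw [← Real.rpow_natCast r 2, ← Real.rpow_mul hr.le, ← Real.rpow_natCast, ← Real.rpow_neg hr.le]
    congr 1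
    push_cast
    ring
  rw [h3]
  ring

lemma continuous_join_left (y : ℝ) : Continuous fun t : E n => join t y :=
  continuous_join.comp (continuous_id.prodMk continuous_const)

lemma one_le_norm_join (t : E n) : 1 ≤ ‖join t 1‖ := by simpa using abs_le_norm_join t 1

lemma one_add_norm_le (t : E n) : 1 + ‖t‖ ≤ 2 * ‖join t 1‖ := by
  linarith [one_le_norm_join t, norm_le_norm_join t 1]

lemma integrable_inv_norm_join_pow : Integrable fun t : E n => (‖join t 1‖ ^ (n + 1))⁻¹ := by
  have hint : Integrable fun x : E n => (1 + ‖x‖) ^ (-((n + 1 : ℕ) : ℝ)) :=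
    integrable_one_add_norm (by simp)
  have hc := continuous_join_left (n := n) 1
  refine (hint.const_mul (2 ^ (n + 1))).mono' ?_ (ae_of_all _ fun t => ?_)
  · exact (Continuous.inv₀ (by fun_prop) fun t =>
      pow_ne_zero _ (norm_ne_zero_iff.2 (join_ne_zero t one_ne_zero))).aestronglyMeasurable
  · have h0 : (0 : ℝ) < 1 + ‖t‖ := by linarith [norm_nonneg t]
    have h1 := one_le_norm_join t
    rw [Real.norm_of_nonneg (by positivity), Real.rpow_neg h0.le, Real.rpow_natCast,
      ← div_eq_mul_inv, inv_le_comm₀ (by positivity) (by positivity), inv_div,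
      div_le_iff₀ (by positivity), ← mul_pow, mul_comm]
    exact pow_le_pow_left₀ h0.le (one_add_norm_le t) _

/-- The integral over the upper half-sphere in stereographic form, as a Gaussian integral. -/
lemma gaussInt_eq_integral_join {Q : MvPolynomial (Fin (n + 1)) ℝ}
    (hQ : ∀ (r : ℝ) (x : E (n + 1)), polyFun (n + 1) Q (r • x) = r ^ (2 * k) * polyFun (n + 1) Q x)
    {C : ℝ} (hC : ∀ x, |polyFun (n + 1) Q x| ≤ C * ‖x‖ ^ (2 * k)) :
    gaussInt (n + 1) Q = Real.Gamma (((n + 1 : ℕ) : ℝ) / 2 + k) *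
      ∫ t : E n, polyFun (n + 1) Q (join t 1) * (‖join t 1‖ ^ (n + 2 * k + 1))⁻¹ := by
  set Φ := polyFun (n + 1) Q with hΦ
  have hΦc : Continuous Φ := continuous_polyFun Q
  have hjc := continuous_join_left (n := n) 1
  have hpos : ∀ t : E n, 0 < ‖join t 1‖ := fun t => by linarith [one_le_norm_join t]
  -- The Gaussian integrand at x = s (t, 1): the dilation of t by s has Jacobian |s|^n, and
  -- homogeneity gives s^{2k}.
  let F : E n → ℝ → ℝ := fun t s =>
    |s| ^ (n + 2 * k) * Φ (join t 1) * Real.exp (-‖join t 1‖ ^ 2 * s ^ 2)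
  have hFi : ∀ t, ∫ s, F t s = Real.Gamma (((n + 1 : ℕ) : ℝ) / 2 + k) *
      (Φ (join t 1) * (‖join t 1‖ ^ (n + 2 * k + 1))⁻¹) := fun t => by
    have h1 := integral_abs_pow_mul_exp (n + 2 * k) (hpos t)
    have h2 : (((n + 2 * k : ℕ) : ℝ) + 1) / 2 = ((n + 1 : ℕ) : ℝ) / 2 + k := by
      push_cast; ring
    rw [h2] at h1
    simp only [F, mul_right_comm _ (Φ _)]
    rw [integral_mul_const, h1]
    ring
  have hFn : ∀ t, ∫ s, ‖F t s‖ = Real.Gamma (((n + 1 : ℕ) : ℝ) / 2 + k) *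
      (|Φ (join t 1)| * (‖join t 1‖ ^ (n + 2 * k + 1))⁻¹) := fun t => by
    have h1 := integral_abs_pow_mul_exp (n + 2 * k) (hpos t)
    have h2 : (((n + 2 * k : ℕ) : ℝ) + 1) / 2 = ((n + 1 : ℕ) : ℝ) / 2 + k := by
      push_cast; ring
    rw [h2] at h1
    simp only [F, mul_right_comm _ (Φ _), norm_mul, norm_pow, Real.norm_eq_abs, abs_abs,
      Real.abs_exp]
    rw [integral_mul_const, h1]
    ring
  have hFc : Continuous (Function.uncurry F) := by
    have := hΦc.comp hjc
    simp only [F, Function.uncurry_def]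
    fun_prop
  have hF : Integrable (Function.uncurry F)
      ((volume : Measure (E n)).prod (volume : Measure ℝ)) := by
    rw [integrable_prod_iff hFc.aestronglyMeasurable]
    refine ⟨ae_of_all _ fun t => ?_, ?_⟩
    · have h1 := (integrable_abs_pow_mul_exp (n + 2 * k) (pow_pos (hpos t) 2)).mul_const
        (Φ (join t 1))
      simpa only [Function.uncurry, F, mul_right_comm _ (Φ _)] using h1
    · simp only [Function.uncurry, hFn]
      refine Integrable.const_mul ?_ _
      refine (integrable_inv_norm_join_pow.const_mul C).mono' ?_ (ae_of_all _ fun t => ?_)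
      · refine Continuous.aestronglyMeasurable ?_
        have := hΦc.comp hjc
        exact (this.abs).mul (Continuous.inv₀ (by fun_prop) fun t => (pow_pos (hpos t) _).ne')
      · have h2 := hpos t
        rw [Real.norm_of_nonneg (by positivity)]
        calc _ ≤ C * ‖join t 1‖ ^ (2 * k) * (‖join t 1‖ ^ (n + 2 * k + 1))⁻¹ := by
              gcongr
              exact hC _
          _ = _ := by
              rw [show n + 2 * k + 1 = 2 * k + (n + 1) by ring, pow_add]
              field_simp
  have hG : Integrable (fun z : E n × ℝ => Φ (join z.1 z.2) * Real.exp (-‖join z.1 z.2‖ ^ 2))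
      ((volume : Measure (E n)).prod (volume : Measure ℝ)) :=
    (measurePreserving_join.integrable_comp
      (integrable_polyFun_mul_gaussian Q).aestronglyMeasurable).2 (integrable_polyFun_mul_gaussian Q)
  have hinner : ∀ s : ℝ, s ≠ 0 →
      ∫ t : E n, Φ (join t s) * Real.exp (-‖join t s‖ ^ 2) = ∫ t : E n, F t s := by
    intro s hs
    have h1 := Measure.integral_comp_smul (volume : Measure (E n))
      (fun t => Φ (join t s) * Real.exp (-‖join t s‖ ^ 2)) s
    rw [finrank_euclideanSpace_fin, smul_eq_mul, abs_inv, abs_pow] at h1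
    have h2 := congrArg (fun r => |s| ^ n * r) h1
    have hs' : 0 < |s| := abs_pos.2 hs
    rw [mul_inv_cancel_left₀ (by positivity), ← integral_const_mul] at h2
    rw [← h2]
    congr 1
    ext t
    have e1 : join (s • t) s = s • join t 1 := by rw [smul_join, mul_one]
    rw [e1, hQ, norm_smul, mul_pow, Real.norm_eq_abs, sq_abs]
    simp only [F, pow_add, (even_two_mul k).pow_abs]
    rw [show -(s ^ 2 * ‖join t 1‖ ^ 2) = -‖join t 1‖ ^ 2 * s ^ 2 by ring]
    ring
  calc gaussInt (n + 1) Q = ∫ z : E n × ℝ, Φ (join z.1 z.2) * Real.exp (-‖join z.1 z.2‖ ^ 2)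
        ∂((volume : Measure (E n)).prod (volume : Measure ℝ)) := by
        rw [gaussInt_apply, ← measurePreserving_join.map_eq, integral_map
          measurePreserving_join.measurable.aemeasurable]
        rw [measurePreserving_join.map_eq]
        exact (integrable_polyFun_mul_gaussian Q).aestronglyMeasurable
    _ = ∫ s : ℝ, ∫ t : E n, Φ (join t s) * Real.exp (-‖join t s‖ ^ 2) :=
        integral_prod_symm _ hG
    _ = ∫ s : ℝ, ∫ t : E n, F t s := by
        refine integral_congr_ae ?_
        filter_upwards [Measure.ae_ne volume (0 : ℝ)] with s hs using hinner s hs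
    _ = ∫ t : E n, ∫ s : ℝ, F t s := (integral_integral_swap hF).symm
    _ = _ := by
        simp_rw [hFi]
        rw [integral_const_mul]

lemma exists_sphere_bound {m k : ℕ} {h : E m → ℝ} (hh : h ∈ Harm m k) :
    ∃ C : ℝ, 0 ≤ C ∧ ∀ u, |h u| ≤ C * ‖u‖ ^ k := by
  obtain ⟨C, hC⟩ := (isCompact_closedBall (0 : E m) 1).exists_bound_of_continuousOn
    (Harm.continuous hh).continuousOn
  refine ⟨C, (norm_nonneg _).trans (hC 0 (by simp)), fun u => ?_⟩
  by_cases hu : u = 0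
  · subst hu
    have h1 := Harm.smul_apply hh 0 (0 : E m)
    have h2 := hC 0 (by simp)
    rw [smul_zero] at h1
    rw [Real.norm_eq_abs] at h2
    -- For k = 0 the bound at the origin reads C · 0^0 = C; for larger k the function vanishes
    -- there.
    rcases k with _ | k
    · simpa using h2
    · rw [h1]
      simp
  · have hu' : 0 < ‖u‖ := norm_pos_iff.2 hu
    have h1 : h u = ‖u‖ ^ k * h (‖u‖⁻¹ • u) := by
      rw [← Harm.smul_apply hh, smul_smul, mul_inv_cancel₀ hu'.ne', one_smul]
    have h2 := hC (‖u‖⁻¹ • u) (by simp [norm_smul, hu'.ne'])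
    rw [Real.norm_eq_abs] at h2
    rw [h1, abs_mul, abs_pow, abs_norm, mul_comm]
    gcongr

lemma reflect_scaled {m : ℕ} (v : E m) {x : E m} (hx : x ≠ 0) :
    ‖x‖ ^ 2 • v - (2 * inner ℝ v x) • x = ‖x‖ ^ 2 • reflect x v := by
  have : ‖x‖ ^ 2 ≠ 0 := by simpa using hx
  rw [reflect, smul_sub, smul_smul, mul_div_cancel₀ _ this]

/-- The Poisson kernel reproduces functions that do not depend on the boundary point. -/
theorem integral_weight_mul (hn : 2 ≤ n) {h : E (n + 1) → ℝ} (hh : h ∈ Harm (n + 1) k)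
    (v : E (n + 1)) :
    ∫ s : E n, weight n k s * h (reflect (join s 1) v) = h v := by
  obtain ⟨P, hP, rfl⟩ := mem_Harm_iff.1 hh
  -- The polynomial Q below equals |x|^{2k} P(R_x v) for x ≠ 0; this bound supplies the growth
  -- estimate for its integral over t.
  obtain ⟨C, hC0, hC⟩ := exists_sphere_bound hh
  set Q := MvPolynomial.aeval (R := ℝ) (reflPoly v) P with hQ
  have hscale : ∀ x : E (n + 1), x ≠ 0 →
      polyFun (n + 1) Q x = ‖x‖ ^ (2 * k) * polyFun (n + 1) P (reflect x v) := fun x hx => by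
    rw [hQ, polyFun_aeval_reflPoly, reflect_scaled v hx, Harm.smul_apply hh, pow_mul]
  have h1 : ∀ (r : ℝ) (x : E (n + 1)),
      polyFun (n + 1) Q (r • x) = r ^ (2 * k) * polyFun (n + 1) Q x := fun r x => by
    have e : ‖r • x‖ ^ 2 • v - (2 * inner ℝ v (r • x)) • r • x =
        r ^ 2 • (‖x‖ ^ 2 • v - (2 * inner ℝ v x) • x) := by
      rw [norm_smul, mul_pow, Real.norm_eq_abs, sq_abs, inner_smul_right, smul_sub, smul_smul,
        smul_smul, smul_smul, show 2 * (r * inner ℝ v x) * r = r ^ 2 * (2 * inner ℝ v x) by ring]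
    rw [hQ, polyFun_aeval_reflPoly, polyFun_aeval_reflPoly, pow_mul, ← Harm.smul_apply hh, e]
  have h2 : ∀ x, |polyFun (n + 1) Q x| ≤ (C * ‖v‖ ^ k * 3 ^ k) * ‖x‖ ^ (2 * k) := fun x => by
    rw [hQ, polyFun_aeval_reflPoly]
    refine (hC _).trans ?_
    have h3 : ‖‖x‖ ^ 2 • v - (2 * inner ℝ v x) • x‖ ≤ 3 * ‖v‖ * ‖x‖ ^ 2 := by
      refine (norm_sub_le _ _).trans ?_
      rw [norm_smul, norm_smul, norm_mul, Real.norm_of_nonneg (by positivity : 0 ≤ ‖x‖ ^ 2)]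
      have := abs_real_inner_le_norm v x
      rw [Real.norm_eq_abs (inner ℝ v x), Real.norm_of_nonneg (by norm_num : (0 : ℝ) ≤ 2)]
      nlinarith [norm_nonneg x]
    calc _ ≤ C * (3 * ‖v‖ * ‖x‖ ^ 2) ^ k := by gcongr
      _ = _ := by rw [mul_pow, mul_pow, pow_mul]; ring
  have h3 := gaussInt_eq_integral_join h1 h2
  rw [gaussInt_refl hP v] at h3
  have h4 : ∀ t : E n, polyFun (n + 1) Q (join t 1) * (‖join t 1‖ ^ (n + 2 * k + 1))⁻¹ =
      (‖join t 1‖ ^ (n + 1))⁻¹ * polyFun (n + 1) P (reflect (join t 1) v) := fun t => by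
    have h5 : ‖join t 1‖ ≠ 0 := norm_ne_zero_iff.2 (join_ne_zero t one_ne_zero)
    rw [hscale _ (join_ne_zero t one_ne_zero), show n + 2 * k + 1 = 2 * k + (n + 1) by ring,
      pow_add]
    field_simp
  simp_rw [h4] at h3
  simp_rw [weight, mul_assoc]
  rw [integral_const_mul, cConst]
  -- This says that `gaussConst` divided by Γ(m/2 + k) is the reciprocal of c_{m,k}.
  have h6 := gaussConst_eq (m := n + 1) k
  have hn' : (2 : ℝ) ≤ n := by exact_mod_cast hn
  have hS := sphereArea_pos (m := n + 1)
  have hΓ : 0 < Real.Gamma (((n + 1 : ℕ) : ℝ) / 2 + k) := Real.Gamma_pos_of_pos (by positivity)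
  have hm : (((n + 1 : ℕ) : ℝ) - 2) ≠ 0 := by push_cast; linarith
  rw [div_mul_eq_mul_div, div_eq_iff (mul_ne_zero hm hS.ne')]
  apply mul_left_cancel₀ hΓ.ne'
  linear_combination (-(2 * (((n + 1 : ℕ) : ℝ) + 2 * k - 2))) * h3 +
    polyFun (n + 1) P v * h6

end Normalization

/-! ### The kernels Q(z) |z|^{-s}, closed under differentiation -/

section RationalKernels

variable {m : ℕ}

lemma hasFDerivAt_of_hasLineDerivAt {f : E m → ℝ} {x : E m} {d : Fin m → ℝ}
    (hf : DifferentiableAt ℝ f x)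
    (hd : ∀ j, HasLineDerivAt ℝ f (d j) x (EuclideanSpace.single j 1)) :
    HasFDerivAt f (∑ j, d j • (coord j : E m →L[ℝ] ℝ)) x := by
  have h1 := hf.hasFDerivAt
  convert! h1 using 1
  ext v
  have hv : v = ∑ j, v j • EuclideanSpace.single j (1 : ℝ) := by
    ext i
    simp [Finset.sum_apply, Pi.single_apply]
  have h2 : ∀ j, fderiv ℝ f x (EuclideanSpace.single j 1) = d j := fun j => by
    rw [← (hd j).lineDeriv, hf.lineDeriv_eq_fderiv]
  conv_rhs => rw [hv]
  simp [h2, mul_comm]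

lemma hasLineDerivAt_of_hasFDerivAt {f : E m → ℝ} {x : E m} {d : Fin m → ℝ}
    (h : HasFDerivAt f (∑ j, d j • (coord j : E m →L[ℝ] ℝ)) x) (j : Fin m) :
    HasLineDerivAt ℝ f (d j) x (EuclideanSpace.single j 1) := by
  have := h.hasLineDerivAt (EuclideanSpace.single j 1)
  simpa using this

/-- The function `Q(z) / |z|^s`. -/
def ratKer (Q : MvPolynomial (Fin m) ℝ) (s : ℕ) (z : E m) : ℝ := polyFun m Q z * (‖z‖ ^ s)⁻¹

/-- The numerator of `∂_j (Q / |z|^s)`, over the denominator `|z|^{s+2}`. -/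
def ratNum (j : Fin m) (Q : MvPolynomial (Fin m) ℝ) (s : ℕ) : MvPolynomial (Fin m) ℝ :=
  (∑ i, MvPolynomial.X i * MvPolynomial.X i) * MvPolynomial.pderiv j Q
    - MvPolynomial.C (s : ℝ) * MvPolynomial.X j * Q

lemma isHomogeneous_ratNum {d s : ℕ} {Q : MvPolynomial (Fin m) ℝ} (hQ : Q.IsHomogeneous d)
    (j : Fin m) : (ratNum j Q s).IsHomogeneous (d + 1) := by
  have hX := fun j => MvPolynomial.isHomogeneous_X (σ := Fin m) ℝ j
  refine MvPolynomial.IsHomogeneous.sub ?_ ?_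
  -- For d = 0 the truncated degree of the derivative would be off by one, but the derivative is
  -- zero.
  · rcases d with _ | d
    · rw [MvPolynomial.totalDegree_eq_zero_iff_eq_C.1 (Nat.le_zero.1 hQ.totalDegree_le)]
      simpa using MvPolynomial.isHomogeneous_zero _ _ _
    · have h1 := (MvPolynomial.IsHomogeneous.sum Finset.univ _ 2
        fun i _ => (hX i).mul (hX i)).mul (hQ.pderiv (i := j))
      rwa [show 2 + (d + 1 - 1) = d + 1 + 1 by omega] at h1
  · have h1 := ((MvPolynomial.isHomogeneous_C (Fin m) (s : ℝ)).mul (hX j)).mul hQ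
    rwa [show 0 + 1 + d = d + 1 by omega] at h1

lemma hasLineDerivAt_ratKer (Q : MvPolynomial (Fin m) ℝ) (s : ℕ) (j : Fin m) {z : E m}
    (hz : z ≠ 0) :
    HasLineDerivAt ℝ (ratKer Q s) (ratKer (ratNum j Q s) (s + 2) z) z
      (EuclideanSpace.single j 1) := by
  have h1 : HasLineDerivAt ℝ (polyFun m Q) (polyFun m (MvPolynomial.pderiv j Q) z) z
      (EuclideanSpace.single j 1) :=
    hasLineDerivAt_of_hasFDerivAt (hasFDerivAt_polyFun Q z) j
  have h2 := hasLineDerivAt_mul h1 (hasLineDerivAt_inv_norm_pow s j hz)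
  have hn : ‖z‖ ≠ 0 := norm_ne_zero_iff.2 hz
  unfold ratKer
  convert! h2 using 1
  simp only [ratNum, map_sub, Pi.sub_apply, polyFun_mul, polyFun_sum, polyFun_X, polyFun_C,
    sum_mul_self_eq]
  field_simp
  ring

lemma differentiableAt_ratKer (Q : MvPolynomial (Fin m) ℝ) (s : ℕ) {z : E m} (hz : z ≠ 0) :
    DifferentiableAt ℝ (ratKer Q s) z := by
  have hn : ‖z‖ ^ s ≠ 0 := pow_ne_zero _ (norm_ne_zero_iff.2 hz)
  exact (hasFDerivAt_polyFun Q z).differentiableAt.mul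
    (((differentiableAt_id.norm ℝ hz).pow s).inv hn)

lemma hasFDerivAt_ratKer (Q : MvPolynomial (Fin m) ℝ) (s : ℕ) {z : E m} (hz : z ≠ 0) :
    HasFDerivAt (ratKer Q s) (∑ j, ratKer (ratNum j Q s) (s + 2) z • (coord j : E m →L[ℝ] ℝ)) z :=
  hasFDerivAt_of_hasLineDerivAt (differentiableAt_ratKer Q s hz)
    fun j => hasLineDerivAt_ratKer Q s j hz

lemma measurable_ratKer (Q : MvPolynomial (Fin m) ℝ) (s : ℕ) : Measurable (ratKer Q s) :=
  (continuous_polyFun Q).measurable.mul (by fun_prop)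

end RationalKernels

/-! ### Integrals of these kernels against boundary data -/

section KernelIntegrals

variable {n : ℕ}

/-- The integral of `Q(x - t) / |x - t|^s` against boundary data. -/
def kerInt (Q : MvPolynomial (Fin (n + 1)) ℝ) (s : ℕ) (a : E n → ℝ) (x : E (n + 1)) : ℝ :=
  ∫ t : E n, ratKer Q s (x - join t 0) * a t

/-- Boundary data whose Poisson integral converges absolutely. -/
def WeightIntegrable (a : E n → ℝ) : Prop :=
  Integrable fun t : E n => ((1 + ‖t‖) ^ (n + 1))⁻¹ * a t

lemma WeightIntegrable.aestronglyMeasurable {a : E n → ℝ} (ha : WeightIntegrable a) :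
    AEStronglyMeasurable a volume := by
  have h1 : Continuous fun t : E n => (1 + ‖t‖) ^ (n + 1) := by fun_prop
  have h2 := h1.aestronglyMeasurable.mul (Integrable.aestronglyMeasurable ha)
  refine h2.congr (ae_of_all _ fun t => ?_)
  have h0 : (0 : ℝ) < 1 + ‖t‖ := by linarith [norm_nonneg t]
  simp only [Pi.mul_apply]
  rw [mul_inv_cancel_left₀ (by positivity)]

lemma isOpen_upperHalf : IsOpen (upperHalf n) :=
  isOpen_lt continuous_const (by fun_prop)

lemma sub_join_last (x : E (n + 1)) (t : E n) : (x - join t 0) (Fin.last n) = x (Fin.last n) := by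
  simp

lemma sub_join_ne_zero {x : E (n + 1)} (hx : x ∈ upperHalf n) (t : E n) : x - join t 0 ≠ 0 := by
  intro h
  have := sub_join_last x t
  rw [h] at this
  exact (ne_of_gt hx) this.symm

lemma norm_join_zero (t : E n) : ‖join t 0‖ = ‖t‖ := by
  have := norm_join_sq t 0
  have h2 : ‖join t 0‖ ^ 2 = ‖t‖ ^ 2 := by linarith
  exact (sq_eq_sq₀ (norm_nonneg _) (norm_nonneg _)).1 h2

/-- Put z = x - t. From |z| ≥ δ, the norm |z| is comparable to 1 + |z|; from |x| ≤ R, 1 + |t| is at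
most a multiple of 1 + |z|. The degree condition leaves decay of order n + 1. The constant is
uniform in x, as differentiation under the integral requires. -/
lemma exists_ratKer_bound {d s : ℕ} {Q : MvPolynomial (Fin (n + 1)) ℝ} (hQ : Q.IsHomogeneous d)
    (hs : d + (n + 1) ≤ s) {δ R : ℝ} (hδ : 0 < δ) (hR : 0 ≤ R) :
    ∃ C : ℝ, 0 ≤ C ∧ ∀ x : E (n + 1), δ ≤ x (Fin.last n) → ‖x‖ ≤ R → ∀ t : E n,
      |ratKer Q s (x - join t 0)| ≤ C * ((1 + ‖t‖) ^ (n + 1))⁻¹ := by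
  obtain ⟨C, hC0, hC⟩ := exists_polyFun_bound Q
  refine ⟨C * (1 / δ + 1) ^ s * (1 + R) ^ (n + 1), by positivity, fun x hx hxR t => ?_⟩
  set z := x - join t 0 with hz
  have h1 : δ ≤ ‖z‖ := by
    have h := PiLp.norm_apply_le z (Fin.last n)
    rw [hz, sub_join_last, Real.norm_eq_abs] at h
    exact hx.trans ((le_abs_self _).trans h)
  have hz0 : 0 < ‖z‖ := hδ.trans_le h1
  have h2 : 1 + ‖z‖ ≤ (1 / δ + 1) * ‖z‖ := by
    have : 1 ≤ 1 / δ * ‖z‖ := by rw [one_div_mul_eq_div, one_le_div hδ]; exact h1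
    linarith
  have h3 : 1 + ‖t‖ ≤ (1 + R) * (1 + ‖z‖) := by
    have : ‖join t 0‖ ≤ ‖x‖ + ‖z‖ := by
      have e : join t 0 = x - z := by rw [hz]; abel
      rw [e]
      exact norm_sub_le _ _
    rw [norm_join_zero] at this
    nlinarith [norm_nonneg z]
  have h0 : (0 : ℝ) < 1 + ‖t‖ := by linarith [norm_nonneg t]
  have h01 : (1 : ℝ) ≤ 1 + ‖z‖ := by linarith
  have hδ' : 0 < 1 / δ + 1 := by positivity
  rw [ratKer, abs_mul, abs_of_pos (by positivity : 0 < (‖z‖ ^ s)⁻¹), ← div_eq_mul_inv,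
    ← div_eq_mul_inv, div_le_div_iff₀ (by positivity) (by positivity)]
  calc |polyFun (n + 1) Q z| * (1 + ‖t‖) ^ (n + 1)
      ≤ C * (1 + ‖z‖) ^ d * ((1 + R) * (1 + ‖z‖)) ^ (n + 1) := by
        gcongr
        refine (hC z).trans ?_
        gcongr
        exact hQ.totalDegree_le
    _ = C * (1 + R) ^ (n + 1) * (1 + ‖z‖) ^ (d + (n + 1)) := by rw [mul_pow, pow_add]; ring
    _ ≤ C * (1 + R) ^ (n + 1) * (1 + ‖z‖) ^ s := by gcongr
    _ ≤ C * (1 + R) ^ (n + 1) * ((1 / δ + 1) * ‖z‖) ^ s := by gcongr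
    _ = _ := by rw [mul_pow]; ring

lemma integrable_ratKer_mul {d s : ℕ} {Q : MvPolynomial (Fin (n + 1)) ℝ} (hQ : Q.IsHomogeneous d)
    (hs : d + (n + 1) ≤ s) {a : E n → ℝ} (ha : WeightIntegrable a) {x : E (n + 1)}
    (hx : x ∈ upperHalf n) : Integrable fun t : E n => ratKer Q s (x - join t 0) * a t := by
  obtain ⟨C, hC0, hC⟩ := exists_ratKer_bound hQ hs hx (norm_nonneg x)
  have hm : Measurable fun t : E n => ratKer Q s (x - join t 0) :=
    (measurable_ratKer Q s).comp (continuous_const.sub (continuous_join_left 0)).measurable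
  refine (ha.norm.const_mul C).mono' (hm.aestronglyMeasurable.mul ha.aestronglyMeasurable)
    (ae_of_all _ fun t => ?_)
  have h0 : (0 : ℝ) < 1 + ‖t‖ := by linarith [norm_nonneg t]
  rw [norm_mul, norm_mul, Real.norm_of_nonneg (by positivity : 0 ≤ ((1 + ‖t‖) ^ (n + 1))⁻¹),
    ← mul_assoc]
  gcongr
  exact hC x le_rfl le_rfl t

lemma hasFDerivAt_kerInt {d s : ℕ} {Q : MvPolynomial (Fin (n + 1)) ℝ} (hQ : Q.IsHomogeneous d)
    (hs : d + (n + 1) ≤ s) {a : E n → ℝ} (ha : WeightIntegrable a) {x : E (n + 1)}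
    (hx : x ∈ upperHalf n) :
    HasFDerivAt (kerInt Q s a)
      (∑ j, kerInt (ratNum j Q s) (s + 2) a x • (coord j : E (n + 1) →L[ℝ] ℝ)) x := by
  have hx' : 0 < x (Fin.last n) := hx
  -- In the ball of this radius about x the last coordinate stays above x_m / 2, so one bound
  -- dominates all derivatives.
  have hδ : 0 < x (Fin.last n) / 2 := by linarith
  have hQ' := fun j => isHomogeneous_ratNum (s := s) hQ j
  have hs' : d + 1 + (n + 1) ≤ s + 2 := by omega
  choose C hC0 hC using fun j => exists_ratKer_bound (hQ' j) hs' hδ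
    (by positivity : 0 ≤ ‖x‖ + x (Fin.last n) / 2)
  have hball : ∀ z ∈ Metric.ball x (x (Fin.last n) / 2),
      x (Fin.last n) / 2 ≤ z (Fin.last n) ∧ ‖z‖ ≤ ‖x‖ + x (Fin.last n) / 2 := by
    intro z hz
    rw [Metric.mem_ball, dist_eq_norm] at hz
    constructor
    · have h := PiLp.norm_apply_le (z - x) (Fin.last n)
      rw [Real.norm_eq_abs, PiLp.sub_apply] at h
      linarith [neg_abs_le (z (Fin.last n) - x (Fin.last n))]
    · have := norm_le_norm_add_norm_sub' z x
      linarith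
  have hup : ∀ z ∈ Metric.ball x (x (Fin.last n) / 2), z ∈ upperHalf n := fun z hz =>
    hδ.trans_le (hball z hz).1
  have hmeas : ∀ (Q : MvPolynomial (Fin (n + 1)) ℝ) (s : ℕ) (z : E (n + 1)),
      AEStronglyMeasurable (fun t : E n => ratKer Q s (z - join t 0) * a t) volume := fun Q s z =>
    (((measurable_ratKer Q s).comp (continuous_const.sub
      (continuous_join_left 0)).measurable).aestronglyMeasurable).mul ha.aestronglyMeasurable
  have key := hasFDerivAt_integral_of_dominated_of_fderiv_le (𝕜 := ℝ) (μ := (volume : Measure (E n)))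
    (F := fun z t => ratKer Q s (z - join t 0) * a t) (x₀ := x)
    (F' := fun z t => ∑ j, (ratKer (ratNum j Q s) (s + 2) (z - join t 0) * a t) •
      (coord j : E (n + 1) →L[ℝ] ℝ))
    (bound := fun t => ∑ j, C j * ‖((1 + ‖t‖) ^ (n + 1))⁻¹ * a t‖ *
      ‖(coord j : E (n + 1) →L[ℝ] ℝ)‖)
    (Metric.ball_mem_nhds x hδ) (Eventually.of_forall fun z => hmeas Q s z)
    (integrable_ratKer_mul hQ hs ha hx) ?_ ?_ ?_ ?_
  · rw [integral_finsetSum] at key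
    · simp_rw [integral_smul_const] at key
      exact key
    · intro j _
      exact (integrable_ratKer_mul (hQ' j) hs' ha hx).smul_const _
  · exact Finset.aestronglyMeasurable_fun_sum _ fun j _ => (hmeas _ _ x).smul_const _
  · refine ae_of_all _ fun t z hz => (norm_sum_le _ _).trans (Finset.sum_le_sum fun j _ => ?_)
    have h0 : (0 : ℝ) < 1 + ‖t‖ := by linarith [norm_nonneg t]
    rw [norm_smul, norm_mul, norm_mul,
      Real.norm_of_nonneg (by positivity : 0 ≤ ((1 + ‖t‖) ^ (n + 1))⁻¹), ← mul_assoc (C j)]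
    gcongr
    exact hC j z (hball z hz).1 (hball z hz).2 t
  · exact integrable_finsetSum _ fun j _ => (ha.norm.const_mul (C j)).mul_const _
  · refine ae_of_all _ fun t z hz => ?_
    have h1 := (hasFDerivAt_ratKer Q s (sub_join_ne_zero (hup z hz) t)).comp z
      ((hasFDerivAt_id z).sub_const (join t 0))
    have h2 := h1.mul_const (a t)
    convert! h2 using 1
    ext v
    simp [Finset.mul_sum, mul_comm, mul_left_comm]

/-- Differentiation turns (d, s) into (d + 1, s + 2), which preserves d + (n + 1) ≤ s; the partial
derivatives are again kernel integrals and the induction closes. -/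
lemma contDiffOn_kerInt {a : E n → ℝ} (ha : WeightIntegrable a) (N : ℕ) :
    ∀ {d s : ℕ} {Q : MvPolynomial (Fin (n + 1)) ℝ}, Q.IsHomogeneous d → d + (n + 1) ≤ s →
      ContDiffOn ℝ N (kerInt Q s a) (upperHalf n) := by
  induction N with
  | zero =>
    intro d s Q hQ hs
    exact contDiffOn_zero.2 fun x hx =>
      (hasFDerivAt_kerInt hQ hs ha hx).continuousAt.continuousWithinAt
  | succ N ih =>
    intro d s Q hQ hs
    push_cast
    rw [contDiffOn_succ_iff_fderiv_of_isOpen isOpen_upperHalf]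
    refine ⟨fun x hx =>
      (hasFDerivAt_kerInt hQ hs ha hx).differentiableAt.differentiableWithinAt, by simp, ?_⟩
    have h1 : ContDiffOn ℝ N (fun x => ∑ j, kerInt (ratNum j Q s) (s + 2) a x •
        (coord j : E (n + 1) →L[ℝ] ℝ)) (upperHalf n) :=
      ContDiffOn.sum fun j _ => (ih (isHomogeneous_ratNum hQ j) (by omega)).smul contDiffOn_const
    exact h1.congr fun x hx => (hasFDerivAt_kerInt hQ hs ha hx).fderiv

end KernelIntegrals

/-! ### The bosonic Laplacian on sums of G_i(x) P_i(u) -/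

section Separated

variable {m : ℕ} {ι : Type*} [Fintype ι] {U : Set (E m)} {G : ι → E m → ℝ}
  {G' : ι → Fin m → E m → ℝ} {G'' : ι → Fin m → Fin m → E m → ℝ}

lemma dx_sum_mul (hG : ∀ i j, ∀ x ∈ U, HasLineDerivAt ℝ (G i) (G' i j x) x
    (EuclideanSpace.single j 1)) (b : ι → E m → ℝ) (j : Fin m) :
    ∀ x ∈ U, ∀ u, dx j (fun x u => ∑ i, G i x * b i u) x u = ∑ i, G' i j x * b i u := by
  intro x hx u
  refine (HasLineDerivAt.lineDeriv (hasLineDerivAt_sum fun i _ =>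
    hasLineDerivAt_mul (hG i j x hx) (hasLineDerivAt_const (b i u) _ _))).trans ?_
  simp

lemma DuDx_sum_mul (hG : ∀ i j, ∀ x ∈ U, HasLineDerivAt ℝ (G i) (G' i j x) x
    (EuclideanSpace.single j 1)) (P : ι → MvPolynomial (Fin m) ℝ) :
    ∀ x ∈ U, ∀ u, DuDx (fun x u => ∑ i, G i x * polyFun m (P i) u) x u =
      ∑ q : ι × Fin m, G' q.1 q.2 x * polyFun m (MvPolynomial.pderiv q.2 (P q.1)) u := by
  intro x hx u
  rw [Fintype.sum_prod_type_right]
  refine Finset.sum_congr rfl fun j _ => ?_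
  have h1 : dx j (fun x u => ∑ i, G i x * polyFun m (P i) u) x =
      fun u => ∑ i, G' i j x * polyFun m (P i) u :=
    funext fun u => dx_sum_mul hG _ j x hx u
  rw [du, h1]
  exact HasLineDerivAt.lineDeriv (hasLineDerivAt_sum fun i _ =>
    hasLineDerivAt_const_mul _ (hasLineDerivAt_of_hasFDerivAt (hasFDerivAt_polyFun (P i) u) j))

lemma bosonicLaplacian_congr (hU : IsOpen U) {F₁ F₂ : E m → E m → ℝ}
    (h : ∀ x ∈ U, ∀ u, F₁ x u = F₂ x u) (k : ℕ) {x : E m} (hx : x ∈ U) (u : E m) :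
    bosonicLaplacian m k F₁ x u = bosonicLaplacian m k F₂ x u := by
  have h1 := DuDx_congr hU h
  rw [bosonicLaplacian, bosonicLaplacian, uDx_congr hU h1 x hx u, DuDx_congr hU h1 x hx u,
    Finset.sum_congr rfl fun j _ => dx_congr hU (dx_congr hU h j) j x hx u]

/-- The bosonic Laplacian of `∑ G_i(x) P_i(u)` is a linear combination of second derivatives of
the functions `G_i`; these are the coefficients. -/
def bosonicCoeff (k : ℕ) (P : ι → MvPolynomial (Fin m) ℝ) (u : E m) (i : ι) (j l : Fin m) : ℝ :=
  (if j = l then polyFun m (P i) u else 0)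
    - 4 / ((m : ℝ) + 2 * k - 2) * (u l * polyFun m (MvPolynomial.pderiv j (P i)) u)
    + 4 * ‖u‖ ^ 2 / (((m : ℝ) + 2 * k - 2) * ((m : ℝ) + 2 * k - 4)) *
      polyFun m (MvPolynomial.pderiv l (MvPolynomial.pderiv j (P i))) u

/-- With the variables separated, 𝒟_k is a linear form in the second derivatives of the G_i, with
coefficients depending only on u. The same formula serves the kernel and its integral, so one
vanishing implies the other. -/
lemma bosonicLaplacian_sum_mul (hU : IsOpen U)
    (hG : ∀ i j, ∀ x ∈ U, HasLineDerivAt ℝ (G i) (G' i j x) x (EuclideanSpace.single j 1))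
    (hG' : ∀ i j l, ∀ x ∈ U, HasLineDerivAt ℝ (G' i j) (G'' i j l x) x
      (EuclideanSpace.single l 1)) (k : ℕ) (P : ι → MvPolynomial (Fin m) ℝ) {x : E m}
    (hx : x ∈ U) (u : E m) :
    bosonicLaplacian m k (fun x u => ∑ i, G i x * polyFun m (P i) u) x u =
      ∑ i, ∑ j, ∑ l, bosonicCoeff k P u i j l * G'' i j l x := by
  have hD := DuDx_sum_mul hG P
  have hGp : ∀ (q : ι × Fin m) l, ∀ x ∈ U, HasLineDerivAt ℝ (G' q.1 q.2) (G'' q.1 q.2 l x) x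
      (EuclideanSpace.single l 1) := fun q l => hG' q.1 q.2 l
  have h1 : ∀ j, dx j (dx j (fun x u => ∑ i, G i x * polyFun m (P i) u)) x u =
      ∑ i, G'' i j j x * polyFun m (P i) u := fun j =>
    (dx_congr hU (dx_sum_mul hG _ j) j x hx u).trans
      (dx_sum_mul (G := fun i => G' i j) (fun i l => hG' i j l) _ j x hx u)
  have h2 := uDx_congr hU hD x hx u
  have h3 := (DuDx_congr hU hD x hx u).trans
    (DuDx_sum_mul hGp (fun q => MvPolynomial.pderiv q.2 (P q.1)) x hx u)
  rw [bosonicLaplacian, Finset.sum_congr rfl fun j _ => h1 j, h2, h3, uDx,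
    Finset.sum_congr rfl fun l _ => congrArg (u l * ·) (dx_sum_mul hGp _ l x hx u)]
  simp only [bosonicCoeff]
  generalize 4 / ((m : ℝ) + 2 * k - 2) = c₁
  generalize 4 * ‖u‖ ^ 2 / (((m : ℝ) + 2 * k - 2) * ((m : ℝ) + 2 * k - 4)) = c₂
  simp only [Fintype.sum_prod_type, add_mul, sub_mul, Finset.sum_add_distrib,
    Finset.sum_sub_distrib, Finset.mul_sum]
  refine congrArg₂ (· + ·) (congrArg₂ (· - ·) ?_ ?_) ?_
  · rw [Finset.sum_comm]
    refine Finset.sum_congr rfl fun i _ => Finset.sum_congr rfl fun j _ => ?_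
    simp [mul_comm]
  · rw [Finset.sum_comm]
    refine Finset.sum_congr rfl fun i _ => ?_
    rw [Finset.sum_comm]
    exact Finset.sum_congr rfl fun j _ => Finset.sum_congr rfl fun l _ => by ring
  · exact Finset.sum_congr rfl fun i _ => Finset.sum_congr rfl fun j _ =>
      Finset.sum_congr rfl fun l _ => by ring

/-- The factor x_m is kept outside the rational kernels: x and x - t have the same last coordinate,
so this product rule applies before and after integration. -/
lemma coord_mul_hasLineDerivAt {S : E m → ℝ} {S' : Fin m → E m → ℝ} {S'' : Fin m → Fin m → E m → ℝ}
    (e : Fin m)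
    (hS : ∀ j, ∀ x ∈ U, HasLineDerivAt ℝ S (S' j x) x (EuclideanSpace.single j 1))
    (hS' : ∀ j l, ∀ x ∈ U, HasLineDerivAt ℝ (S' j) (S'' j l x) x (EuclideanSpace.single l 1)) :
    (∀ j, ∀ x ∈ U, HasLineDerivAt ℝ (fun x => x e * S x)
      ((if e = j then 1 else 0) * S x + x e * S' j x) x (EuclideanSpace.single j 1)) ∧
    ∀ j l, ∀ x ∈ U, HasLineDerivAt ℝ (fun x => (if e = j then 1 else 0) * S x + x e * S' j x)
      ((if e = j then 1 else 0) * S' l x + ((if e = l then 1 else 0) * S' j x + x e * S'' j l x)) x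
      (EuclideanSpace.single l 1) :=
  ⟨fun j x hx => hasLineDerivAt_mul (hasLineDerivAt_coord e j x) (hS j x hx), fun j l x hx =>
    hasLineDerivAt_add (hasLineDerivAt_const_mul _ (hS l x hx))
      (hasLineDerivAt_mul (hasLineDerivAt_coord e l x) (hS' j l x hx))⟩

end Separated

/-! ### Interpolation nodes and separation of variables in the kernel -/

section Nodes

variable {m : ℕ}

/-- Nodes in the unit ball at which `ℋ_k` can be interpolated, with the cardinal polynomials. -/
structure IsNodes (k : ℕ) {N : ℕ} (w : Fin N → E m) (P : Fin N → MvPolynomial (Fin m) ℝ) :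
    Prop where
  mem_ball : ∀ i, w i ∈ Metric.ball (0 : E m) 1
  harm : ∀ i, IsHarmPoly (P i) k
  expand : ∀ h ∈ Harm m k, ∀ v, h v = ∑ i, h (w i) * polyFun m (P i) v

/-- Arbitrary nodes are scaled into the unit ball, where measurability of the data is assumed;
homogeneity compensates by a factor in the cardinal polynomials. -/
lemma exists_isNodes (m k : ℕ) :
    ∃ (N : ℕ) (w : Fin N → E m) (P : Fin N → MvPolynomial (Fin m) ℝ), IsNodes k w P := by
  obtain ⟨N, x, b, hb, hN⟩ := exists_interpolation (Harm m k)
  have hr : ∀ i, 0 < (1 + ‖x i‖)⁻¹ := fun i => by positivity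
  have hb' : ∀ i, (((1 + ‖x i‖)⁻¹ ^ k)⁻¹ • b i) ∈ Harm m k := fun i =>
    Submodule.smul_mem _ _ (hb i)
  choose P hP hPb using fun i => mem_Harm_iff.1 (hb' i)
  refine ⟨N, fun i => (1 + ‖x i‖)⁻¹ • x i, P, fun i => ?_, hP, fun h hh v => ?_⟩
  · rw [mem_ball_zero_iff, norm_smul, Real.norm_of_nonneg (hr i).le, inv_mul_lt_iff₀ (by positivity)]
    linarith
  · rw [hN h hh v]
    refine Finset.sum_congr rfl fun i _ => ?_
    rw [Harm.smul_apply hh, hPb, Pi.smul_apply, smul_eq_mul]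
    have := (pow_pos (hr i) k).ne'
    field_simp

/-- The numerator of the rational function `z ↦ P (R_z v)`. -/
def reflNum (P : MvPolynomial (Fin m) ℝ) (v : E m) : MvPolynomial (Fin m) ℝ :=
  MvPolynomial.aeval (reflPoly v) P

lemma IsHarmPoly.isHomogeneous_reflNum {k : ℕ} {P : MvPolynomial (Fin m) ℝ} (hP : IsHarmPoly P k)
    (v : E m) : (reflNum P v).IsHomogeneous (2 * k) :=
  hP.1.aeval (reflPoly v) (isHomogeneous_reflPoly v)

lemma IsHarmPoly.polyFun_reflect_eq {k : ℕ} {P : MvPolynomial (Fin m) ℝ} (hP : IsHarmPoly P k)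
    (v : E m) {z : E m} (hz : z ≠ 0) (s : ℕ) :
    (‖z‖ ^ s)⁻¹ * polyFun m P (reflect z v) = ratKer (reflNum P v) (2 * k + s) z := by
  have hz' : ‖z‖ ≠ 0 := norm_ne_zero_iff.2 hz
  rw [ratKer, reflNum, polyFun_aeval_reflPoly, reflect_scaled v hz,
    Harm.smul_apply (mem_Harm_iff.2 ⟨P, hP, rfl⟩), pow_add, ← pow_mul]
  field_simp

/-- P_i(R_z v) is in ℋ_k as a function of v, so interpolation separates z from v; the values at the
nodes are rational kernels in z. -/
lemma IsNodes.polyFun_reflect_eq {k N : ℕ} {w : Fin N → E m}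
    {P : Fin N → MvPolynomial (Fin m) ℝ} (h : IsNodes k w P) (i : Fin N) {z : E m} (hz : z ≠ 0)
    (s : ℕ) (v : E m) : (‖z‖ ^ s)⁻¹ * polyFun m (P i) (reflect z v) =
      ∑ j, ratKer (reflNum (P i) (w j)) (2 * k + s) z * polyFun m (P j) v := by
  rw [h.expand _ (Harm.comp_reflect (mem_Harm_iff.2 ⟨P i, h.harm i, rfl⟩) z) v, Finset.mul_sum]
  exact Finset.sum_congr rfl fun j _ => by rw [← mul_assoc, (h.harm i).polyFun_reflect_eq _ hz]

end Nodes

/-! ### Smoothness and the differential equation for the Poisson integral -/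

section PoissonRepresentation

variable {n k : ℕ}

/-- The second derivatives of `z ↦ z_m Q(z) / |z|^s`. -/
def kerSnd (Q : MvPolynomial (Fin (n + 1)) ℝ) (s : ℕ) (j l : Fin (n + 1)) (z : E (n + 1)) : ℝ :=
  (if Fin.last n = j then 1 else 0) * ratKer (ratNum l Q s) (s + 2) z
    + ((if Fin.last n = l then 1 else 0) * ratKer (ratNum j Q s) (s + 2) z
      + z (Fin.last n) * ratKer (ratNum l (ratNum j Q s) (s + 2)) (s + 2 + 2) z)

/-- This is `bosonicLaplacian_kelvin` with the variables separated: a pointwise linear relation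
between second derivatives of scalar kernels, ready to be integrated. -/
lemma IsNodes.sum_bosonicCoeff_mul_kerSnd {N : ℕ} {w : Fin N → E (n + 1)}
    {P : Fin N → MvPolynomial (Fin (n + 1)) ℝ} (h : IsNodes k w P) (hn : 2 ≤ n) (hk : 1 ≤ k)
    (i : Fin N) {z : E (n + 1)} (hz : z ≠ 0) (u : E (n + 1)) :
    ∑ i', ∑ j, ∑ l, bosonicCoeff k P u i' j l *
      kerSnd (reflNum (P i) (w i')) (2 * k + (n + 1)) j l z = 0 := by
  have hd := fun i' => coord_mul_hasLineDerivAt (U := {z : E (n + 1) | z ≠ 0}) (Fin.last n)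
    (S := ratKer (reflNum (P i) (w i')) (2 * k + (n + 1)))
    (fun j z hz => hasLineDerivAt_ratKer _ _ j hz)
    (fun j l z hz => hasLineDerivAt_ratKer _ _ l hz)
  have h1 := bosonicLaplacian_sum_mul isOpen_ne_zero (fun i' => (hd i').1)
    (fun i' => (hd i').2) k P hz u
  refine h1.symm.trans (Eq.trans ?_ (bosonicLaplacian_kelvin (by omega) hk (h.harm i)
    (Fin.last n) hz u))
  refine bosonicLaplacian_congr isOpen_ne_zero (fun z hz u => ?_) k hz u
  rw [mul_assoc, h.polyFun_reflect_eq i hz, Finset.mul_sum]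
  exact Finset.sum_congr rfl fun i' _ => by rw [mul_assoc]

/-- The factor z_m equals x_m and leaves the integral; the right-hand side is the second derivative
of x_m times the kernel integral. -/
lemma integrable_kerSnd_mul {d s : ℕ} {Q : MvPolynomial (Fin (n + 1)) ℝ} (hQ : Q.IsHomogeneous d)
    (hs : d + (n + 1) ≤ s) {a : E n → ℝ} (ha : WeightIntegrable a) {x : E (n + 1)}
    (hx : x ∈ upperHalf n) (j l : Fin (n + 1)) :
    Integrable (fun t : E n => kerSnd Q s j l (x - join t 0) * a t) ∧
    ∫ t : E n, kerSnd Q s j l (x - join t 0) * a t =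
      (if Fin.last n = j then 1 else 0) * kerInt (ratNum l Q s) (s + 2) a x
        + ((if Fin.last n = l then 1 else 0) * kerInt (ratNum j Q s) (s + 2) a x
        + x (Fin.last n) * kerInt (ratNum l (ratNum j Q s) (s + 2)) (s + 2 + 2) a x) := by
  have i1 := fun l => integrable_ratKer_mul (isHomogeneous_ratNum (s := s) hQ l)
    (s := s + 2) (by omega) ha hx
  have i2 := integrable_ratKer_mul (isHomogeneous_ratNum (s := s + 2)
    (isHomogeneous_ratNum (s := s) hQ j) l) (s := s + 2 + 2) (by omega) ha hx
  have e : (fun t : E n => kerSnd Q s j l (x - join t 0) * a t) = fun t =>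
      (if Fin.last n = j then 1 else 0) * (ratKer (ratNum l Q s) (s + 2) (x - join t 0) * a t)
        + ((if Fin.last n = l then 1 else 0) *
            (ratKer (ratNum j Q s) (s + 2) (x - join t 0) * a t)
          + x (Fin.last n) * (ratKer (ratNum l (ratNum j Q s) (s + 2)) (s + 2 + 2)
            (x - join t 0) * a t)) := by
    funext t
    rw [kerSnd, sub_join_last]
    ring
  have j1 := ((i1 l).const_mul (if Fin.last n = j then 1 else 0))
  have j2 := ((i1 j).const_mul (if Fin.last n = l then 1 else 0))
  have j3 := i2.const_mul (x (Fin.last n))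
  rw [e]
  refine ⟨j1.add (j2.add j3), ?_⟩
  refine (integral_add j1 (j2.add j3)).trans ((congrArg (_ + ·) (integral_add j2 j3)).trans ?_)
  rw [integral_const_mul, integral_const_mul,
    integral_const_mul]
  rfl

variable {N : ℕ} {w : Fin N → E (n + 1)} {P : Fin N → MvPolynomial (Fin (n + 1)) ℝ}
  {f : E n → E (n + 1) → ℝ}

/-- Interpolation is used twice: for the data f(t, ·), giving the scalar functions f(t, w_i), and
for the reflected cardinal polynomials. -/
lemma IsNodes.poissonIntegral_eq_sum (h : IsNodes k w P) (hf : ∀ t, f t ∈ Harm (n + 1) k)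
    (ha : ∀ i, WeightIntegrable fun t => cConst (n + 1) k * f t (w i)) {x : E (n + 1)}
    (hx : x ∈ upperHalf n) (v : E (n + 1)) :
    poissonIntegral n k f x v = ∑ q : Fin N × Fin N,
      (x (Fin.last n) * kerInt (reflNum (P q.1) (w q.2)) (2 * k + (n + 1))
        (fun t => cConst (n + 1) k * f t (w q.1)) x) * polyFun (n + 1) (P q.2) v := by
  have hi := fun q : Fin N × Fin N => ((integrable_ratKer_mul
    ((h.harm q.1).isHomogeneous_reflNum (w q.2)) le_rfl (ha q.1) hx).const_mul
      (x (Fin.last n))).mul_const (polyFun (n + 1) (P q.2) v)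
  simp_rw [kerInt, ← integral_const_mul, ← integral_mul_const]
  rw [poissonIntegral_eq hf, ← integral_finsetSum _ fun q _ => hi q]
  congr 1
  funext t
  have hz := sub_join_ne_zero hx t
  rw [h.expand _ (hf t), Fintype.sum_prod_type, Finset.mul_sum]
  refine Finset.sum_congr rfl fun i _ => ?_
  calc _ = x (Fin.last n) * (cConst (n + 1) k * f t (w i)) * ((‖x - join t 0‖ ^ (n + 1))⁻¹ *
        polyFun (n + 1) (P i) (reflect (x - join t 0) v)) := by ring
    _ = _ := by
        rw [h.polyFun_reflect_eq i hz, Finset.mul_sum]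
        exact Finset.sum_congr rfl fun j _ => by ring

lemma IsNodes.poissonIntegral_mem_Harm (h : IsNodes k w P) (hf : ∀ t, f t ∈ Harm (n + 1) k)
    (ha : ∀ i, WeightIntegrable fun t => cConst (n + 1) k * f t (w i)) {x : E (n + 1)}
    (hx : x ∈ upperHalf n) : (fun v => poissonIntegral n k f x v) ∈ Harm (n + 1) k := by
  have e : (fun v => poissonIntegral n k f x v) = ∑ q : Fin N × Fin N,
      (x (Fin.last n) * kerInt (reflNum (P q.1) (w q.2)) (2 * k + (n + 1))
        (fun t => cConst (n + 1) k * f t (w q.1)) x) • polyFun (n + 1) (P q.2) := by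
    funext v
    rw [h.poissonIntegral_eq_sum hf ha hx, Finset.sum_apply]
    rfl
  rw [e]
  exact Submodule.sum_mem _ fun q _ =>
    Submodule.smul_mem _ _ (mem_Harm_iff.2 ⟨P q.2, h.harm q.2, rfl⟩)

lemma IsNodes.contDiffOn_poissonIntegral (h : IsNodes k w P) (hf : ∀ t, f t ∈ Harm (n + 1) k)
    (ha : ∀ i, WeightIntegrable fun t => cConst (n + 1) k * f t (w i)) :
    ContDiffOn ℝ (⊤ : ℕ∞) (fun z : E (n + 1) × E (n + 1) => poissonIntegral n k f z.1 z.2)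
      (upperHalf n ×ˢ univ) := by
  refine ContDiffOn.congr (f := fun z : E (n + 1) × E (n + 1) => ∑ q : Fin N × Fin N,
      (z.1 (Fin.last n) * kerInt (reflNum (P q.1) (w q.2)) (2 * k + (n + 1))
        (fun t => cConst (n + 1) k * f t (w q.1)) z.1) * polyFun (n + 1) (P q.2) z.2) ?_
    fun z hz => h.poissonIntegral_eq_sum hf ha hz.1 z.2
  refine ContDiffOn.sum fun q _ => ContDiffOn.mul (ContDiffOn.mul ?_ ?_) ?_
  · exact (((coord (Fin.last n)).contDiff).comp contDiff_fst).contDiffOn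
  · have h1 : ContDiffOn ℝ (⊤ : ℕ∞) (kerInt (reflNum (P q.1) (w q.2)) (2 * k + (n + 1))
        fun t => cConst (n + 1) k * f t (w q.1)) (upperHalf n) :=
      contDiffOn_infty.2 fun M => contDiffOn_kerInt (ha q.1) M
        ((h.harm q.1).isHomogeneous_reflNum (w q.2)) le_rfl
    exact h1.comp contDiffOn_fst fun z hz => hz.1
  · exact ((contDiff_polyFun (P q.2)).comp contDiff_snd).contDiffOn

/-- For each data node separately, the second derivatives are collected under one integral, whose
integrand vanishes by the relation for the kernel. -/
lemma IsNodes.bosonicLaplacian_poissonIntegral (h : IsNodes k w P) (hn : 2 ≤ n) (hk : 1 ≤ k)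
    (hf : ∀ t, f t ∈ Harm (n + 1) k)
    (ha : ∀ i, WeightIntegrable fun t => cConst (n + 1) k * f t (w i)) {x : E (n + 1)}
    (hx : x ∈ upperHalf n) (v : E (n + 1)) :
    bosonicLaplacian (n + 1) k (poissonIntegral n k f) x v = 0 := by
  have hQ := fun q : Fin N × Fin N => (h.harm q.1).isHomogeneous_reflNum (w q.2)
  have hd := fun q : Fin N × Fin N => coord_mul_hasLineDerivAt (U := upperHalf n) (Fin.last n)
    (S := kerInt (reflNum (P q.1) (w q.2)) (2 * k + (n + 1))
        fun t => cConst (n + 1) k * f t (w q.1))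
    (fun j z hz => hasLineDerivAt_of_hasFDerivAt (hasFDerivAt_kerInt (hQ q) le_rfl (ha q.1) hz) j)
    (fun j l z hz => hasLineDerivAt_of_hasFDerivAt (hasFDerivAt_kerInt
      (isHomogeneous_ratNum (hQ q) j) (by omega) (ha q.1) hz) l)
  rw [bosonicLaplacian_congr isOpen_upperHalf
      (fun x hx v => h.poissonIntegral_eq_sum hf ha hx v) k hx v,
    bosonicLaplacian_sum_mul isOpen_upperHalf (fun q => (hd q).1) (fun q => (hd q).2) k
      (fun q : Fin N × Fin N => P q.2) hx v, Fintype.sum_prod_type]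
  refine Finset.sum_eq_zero fun i _ => ?_
  have hI := fun (i' : Fin N) => integrable_kerSnd_mul (hQ (i, i')) le_rfl (ha i) hx
  have hI' := fun (i' : Fin N) j l => ((hI i' j l).1.const_mul (bosonicCoeff k P v i' j l))
  calc _ = ∑ i', ∑ j, ∑ l, ∫ t, bosonicCoeff k P v i' j l *
        (kerSnd (reflNum (P i) (w i')) (2 * k + (n + 1)) j l (x - join t 0) *
          (cConst (n + 1) k * f t (w i))) := by
        refine Finset.sum_congr rfl fun i' _ => Finset.sum_congr rfl fun j _ =>
          Finset.sum_congr rfl fun l _ => ?_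
        rw [integral_const_mul, (hI i' j l).2]
        rfl
    _ = ∫ t, ∑ i', ∑ j, ∑ l, bosonicCoeff k P v i' j l *
        (kerSnd (reflNum (P i) (w i')) (2 * k + (n + 1)) j l (x - join t 0) *
          (cConst (n + 1) k * f t (w i))) := by
        rw [integral_finsetSum _ fun i' _ => integrable_finsetSum _ fun j _ =>
          integrable_finsetSum _ fun l _ => hI' i' j l]
        refine Finset.sum_congr rfl fun i' _ => ?_
        rw [integral_finsetSum _ fun j _ => integrable_finsetSum _ fun l _ => hI' i' j l]
        refine Finset.sum_congr rfl fun j _ => ?_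
        rw [integral_finsetSum _ fun l _ => hI' i' j l]
    _ = ∫ t : E n, (0 : ℝ) := by
        congr 1
        funext t
        have h0 := h.sum_bosonicCoeff_mul_kerSnd hn hk i (sub_join_ne_zero hx t) v
        refine Eq.trans ?_ ((congrArg (· * (cConst (n + 1) k * f t (w i))) h0).trans (zero_mul _))
        simp only [Finset.sum_mul, mul_assoc]
    _ = 0 := integral_zero _ _

end PoissonRepresentation

/-! ### Jensen's inequality for finite measures -/

section Jensen

variable {X S : Type*} [MeasurableSpace X] [MeasurableSpace S]

/-- Comparison of the L^1 and L^r norms on a finite measure space; the power of the mass appears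
because the measure is not normalized. -/
lemma enorm_integral_rpow_le (ν : Measure S) {r : ℝ} (hr : 1 ≤ r) {g : S → ℝ}
    (hg : AEStronglyMeasurable g ν) :
    ‖∫ s, g s ∂ν‖ₑ ^ r ≤ ν univ ^ (r - 1) * ∫⁻ s, ‖g s‖ₑ ^ r ∂ν := by
  have hr0 : 0 < r := by linarith
  have h1 := eLpNorm'_le_eLpNorm'_mul_rpow_measure_univ one_pos hr hg
  have h2 : ‖∫ s, g s ∂ν‖ₑ ≤ eLpNorm' g 1 ν := by
    simpa [eLpNorm'] using enorm_integral_le_lintegral_enorm g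
  calc ‖∫ s, g s ∂ν‖ₑ ^ r ≤ (eLpNorm' g r ν * ν univ ^ (1 / 1 - 1 / r)) ^ r :=
        ENNReal.rpow_le_rpow (h2.trans h1) hr0.le
    _ = _ := by
        rw [ENNReal.mul_rpow_of_nonneg _ _ hr0.le, ← ENNReal.rpow_mul,
          ← lintegral_rpow_enorm_eq_rpow_eLpNorm' hr0, mul_comm,
          show (1 / 1 - 1 / r) * r = r - 1 by field_simp]

lemma lintegral_enorm_integral_rpow_le (μ : Measure X) [SFinite μ] (ν : Measure S)
    [IsFiniteMeasure ν] {r : ℝ} (hr : 1 ≤ r) {K : X → S → ℝ}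
    (hK : Measurable fun z : X × S => K z.1 z.2) :
    ∫⁻ x, ‖∫ s, K x s ∂ν‖ₑ ^ r ∂μ ≤ ν univ ^ (r - 1) * ∫⁻ s, ∫⁻ x, ‖K x s‖ₑ ^ r ∂μ ∂ν := by
  have hm : Measurable fun z : X × S => ‖K z.1 z.2‖ₑ ^ r := hK.enorm.pow_const r
  rw [← lintegral_lintegral_swap hm.aemeasurable, ← lintegral_const_mul _ hm.lintegral_prod_right']
  exact lintegral_mono fun x =>
    enorm_integral_rpow_le ν hr (hK.comp measurable_prodMk_left).aestronglyMeasurable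

end Jensen

/-! ### Consequences of membership in L^p: measurability and integrability -/

section BoundaryData

variable {n k : ℕ} {p : ℝ≥0∞} {f : E n → E (n + 1) → ℝ}

lemma measurable_reflect {m : ℕ} : Measurable fun z : E m × E m => reflect z.1 z.2 := by
  unfold reflect
  have h1 : Measurable fun z : E m × E m => 2 * inner ℝ z.2 z.1 / ‖z.1‖ ^ 2 :=
    ((Continuous.inner continuous_snd continuous_fst).measurable.const_mul 2).div
      (by fun_prop)
  exact measurable_snd.sub (h1.smul measurable_fst)

lemma one_le_toReal (hp : 1 ≤ p) (hp' : p ≠ ∞) : 1 ≤ p.toReal := by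
  simpa using ENNReal.toReal_mono hp' hp

lemma normLp_rpow (hp : 1 ≤ p) (hp' : p ≠ ∞) (f : E n → E (n + 1) → ℝ) :
    normLp n p f ^ p.toReal = ∫⁻ z : E n × Metric.sphere (0 : E (n + 1)) 1,
      ‖f z.1 z.2‖ₑ ^ p.toReal ∂((volume : Measure (E n)).prod (surf (n + 1))) := by
  have h0 : p ≠ 0 := (zero_lt_one.trans_le hp).ne'
  rw [normLp, eLpNorm_eq_lintegral_rpow_enorm_toReal h0 hp', ← ENNReal.rpow_mul,
    one_div_mul_cancel (ENNReal.toReal_pos h0 hp').ne', ENNReal.rpow_one]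

/-- The nodes lie in the unit ball, so interpolation extends measurability from the ball to all v.
-/
lemma MemLpHarm.measurable_uncurry (hf : MemLpHarm n k p f) :
    Measurable fun z : E n × E (n + 1) => f z.1 z.2 := by
  obtain ⟨N, w, P, h⟩ := exists_isNodes (n + 1) k
  have e : (fun z : E n × E (n + 1) => f z.1 z.2) =
      fun z => ∑ i, f z.1 (w i) * polyFun (n + 1) (P i) z.2 :=
    funext fun z => h.expand _ (hf.mem_harm z.1) z.2
  rw [e]
  refine Finset.measurable_sum _ fun i _ => Measurable.mul ?_
    ((continuous_polyFun (P i)).measurable.comp measurable_snd)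
  exact hf.measurable.comp
    ((measurable_id.prodMk measurable_const :
      Measurable fun t : E n => (t, (⟨w i, h.mem_ball i⟩ : Metric.ball (0 : E (n + 1)) 1))).comp
      measurable_fst)

/-- The value f(t, v) is the spherical integral of Z(u, v) f(t, u), and Z(·, v) is bounded on the
sphere; Jensen's inequality bounds it by the norm of f. -/
lemma MemLpHarm.memLp_slice (hp : 1 ≤ p) (hp' : p ≠ ∞) (hf : MemLpHarm n k p f) (v : E (n + 1)) :
    MemLp (fun t => f t v) p volume := by
  have hr := one_le_toReal hp hp'
  have hr0 : 0 ≤ p.toReal := by linarith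
  have h0 : p ≠ 0 := (zero_lt_one.trans_le hp).ne'
  have hm := hf.measurable_uncurry
  have hm1 : Measurable fun t => f t v := hm.comp (measurable_id.prodMk measurable_const)
  refine ⟨hm1.aestronglyMeasurable, ?_⟩
  rw [eLpNorm_lt_top_iff_lintegral_rpow_enorm_lt_top h0 hp']
  obtain ⟨C, hC0, hC⟩ := exists_sphere_bound (Z_mem (n + 1) k v)
  have hZ := (Harm.continuous (Z_mem (n + 1) k v)).measurable
  have hms : Measurable fun z : E n × Metric.sphere (0 : E (n + 1)) 1 => f z.1 z.2 :=
    hm.comp (measurable_fst.prodMk (measurable_subtype_coe.comp measurable_snd))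
  have hK : Measurable fun z : E n × Metric.sphere (0 : E (n + 1)) 1 =>
      Z (n + 1) k z.2 v * f z.1 z.2 :=
    (hZ.comp (measurable_subtype_coe.comp measurable_snd)).mul hms
  have h1 := lintegral_enorm_integral_rpow_le (volume : Measure (E n)) (surf (n + 1)) hr
    (K := fun t u => Z (n + 1) k u v * f t u) hK
  simp only [Z_reproducing (n + 1) k _ (hf.mem_harm _) v] at h1
  refine h1.trans_lt (ENNReal.mul_lt_top
    (ENNReal.rpow_lt_top_of_nonneg (by linarith) (measure_ne_top _ _)) ?_)
  have h2 : ∫⁻ u : Metric.sphere (0 : E (n + 1)) 1, (∫⁻ t : E n,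
      ‖Z (n + 1) k u v * f t u‖ₑ ^ p.toReal) ∂(surf (n + 1)) ≤
      ∫⁻ u : Metric.sphere (0 : E (n + 1)) 1, (∫⁻ t : E n,
        ENNReal.ofReal C ^ p.toReal * ‖f t u‖ₑ ^ p.toReal) ∂(surf (n + 1)) := by
    refine lintegral_mono fun u => lintegral_mono fun t => ?_
    have hu : |Z (n + 1) k u v| ≤ C := by simpa using hC u
    rw [← ENNReal.mul_rpow_of_nonneg _ _ hr0, enorm_mul, Real.enorm_eq_ofReal_abs (Z _ _ _ _)]
    gcongr
  refine h2.trans_lt ?_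
  have hmp : Measurable fun z : E n × Metric.sphere (0 : E (n + 1)) 1 =>
      ‖f z.1 z.2‖ₑ ^ p.toReal := hms.enorm.pow_const _
  have h3 := lintegral_prod_symm' (μ := (volume : Measure (E n))) (ν := surf (n + 1)) _
    (hmp.const_mul (ENNReal.ofReal C ^ p.toReal))
  rw [← h3, lintegral_const_mul _ hmp, ← normLp_rpow hp hp']
  exact ENNReal.mul_lt_top (ENNReal.rpow_lt_top_of_nonneg hr0 ENNReal.ofReal_ne_top)
    (ENNReal.rpow_lt_top_of_nonneg hr0 hf.normLp_lt_top.ne)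

/-- With w = (1 + |t|)^{-(n+1)} ≤ 1 one has w |a| ≤ w + |a|^p, checked separately for |a| ≤ 1 and
|a| ≥ 1; this covers all finite p ≥ 1 without Hölder's inequality. -/
lemma weightIntegrable_of_memLp (hp : 1 ≤ p) (hp' : p ≠ ∞) {a : E n → ℝ} (ha : MemLp a p volume) :
    WeightIntegrable a := by
  have h0 : p ≠ 0 := (zero_lt_one.trans_le hp).ne'
  have hr := one_le_toReal hp hp'
  have hint : Integrable fun x : E n => (1 + ‖x‖) ^ (-((n + 1 : ℕ) : ℝ)) :=
    integrable_one_add_norm (by simp)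
  have h1 := ha.integrable_norm_rpow h0 hp'
  have hc : Continuous fun t : E n => ((1 + ‖t‖) ^ (n + 1))⁻¹ :=
    Continuous.inv₀ (by fun_prop) fun t => by positivity
  refine (hint.add h1).mono' (hc.aestronglyMeasurable.mul ha.1) (ae_of_all _ fun t => ?_)
  have ht : (1 : ℝ) ≤ 1 + ‖t‖ := by linarith [norm_nonneg t]
  have e : (1 + ‖t‖) ^ (-((n + 1 : ℕ) : ℝ)) = ((1 + ‖t‖) ^ (n + 1))⁻¹ := by
    rw [Real.rpow_neg (by linarith), Real.rpow_natCast]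
  have hw0 : 0 ≤ ((1 + ‖t‖) ^ (n + 1))⁻¹ := by positivity
  have hw1 : ((1 + ‖t‖) ^ (n + 1))⁻¹ ≤ 1 := inv_le_one_of_one_le₀ (one_le_pow₀ ht)
  rw [Pi.add_apply, e, norm_mul, Real.norm_of_nonneg hw0]
  have hq : 0 ≤ ‖a t‖ ^ p.toReal := by positivity
  rcases le_total ‖a t‖ 1 with h | h
  · nlinarith
  · have : ‖a t‖ ≤ ‖a t‖ ^ p.toReal := Real.self_le_rpow_of_one_le h hr
    nlinarith

lemma MemLpHarm.weightIntegrable (hp : 1 ≤ p) (hp' : p ≠ ∞) (hf : MemLpHarm n k p f) (c : ℝ)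
    (v : E (n + 1)) : WeightIntegrable fun t => c * f t v :=
  weightIntegrable_of_memLp hp hp' ((hf.memLp_slice hp hp' v).const_mul c)

/-- On the sphere Z and the cardinal polynomials are bounded, and reflections preserve it; what
remains is the kernel |x - t|^{-(n+1)} against |f(t, w_i)|. -/
lemma MemLpHarm.integrable_poissonKernel_mul (hp : 1 ≤ p) (hp' : p ≠ ∞) (hf : MemLpHarm n k p f)
    {x : E (n + 1)} (hx : x ∈ upperHalf n) (v : E (n + 1)) :
    Integrable (fun z : E n × Metric.sphere (0 : E (n + 1)) 1 =>
      poissonKernel n k x z.1 z.2 v * f z.1 z.2)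
      ((volume : Measure (E n)).prod (surf (n + 1))) := by
  obtain ⟨N, w, P, h⟩ := exists_isNodes (n + 1) k
  obtain ⟨C, hC0, hC⟩ := exists_sphere_bound (Z_mem (n + 1) k v)
  choose B hB0 hB using fun i => exists_sphere_bound (mem_Harm_iff.2 ⟨P i, h.harm i, rfl⟩)
  have hi := fun i => ((integrable_ratKer_mul (MvPolynomial.isHomogeneous_one (Fin (n + 1)) ℝ)
    (s := n + 1) (by omega) (hf.weightIntegrable hp hp' 1 (w i)) hx).norm.const_mul
      (|cConst (n + 1) k| * x (Fin.last n) * C * B i)).comp_fst (surf (n + 1))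
  have hms : Measurable fun z : E n × Metric.sphere (0 : E (n + 1)) 1 => f z.1 z.2 :=
    hf.measurable_uncurry.comp
      (measurable_fst.prodMk (measurable_subtype_coe.comp measurable_snd))
  have hsub : Measurable fun z : E n × Metric.sphere (0 : E (n + 1)) 1 => x - join z.1 0 :=
    (continuous_const.sub (continuous_join_left 0)).measurable.comp measurable_fst
  have hmk : Measurable fun z : E n × Metric.sphere (0 : E (n + 1)) 1 =>
      poissonKernel n k x z.1 z.2 v := by
    refine Measurable.mul (measurable_const.mul (measurable_const.div (hsub.norm.pow_const _))) ?_
    exact (Harm.continuous (Z_mem (n + 1) k v)).measurable.comp (measurable_reflect.comp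
      (hsub.prodMk (measurable_subtype_coe.comp measurable_snd)))
  refine (integrable_finsetSum Finset.univ fun i _ => hi i).mono'
    (hmk.mul hms).aestronglyMeasurable (ae_of_all _ fun z => ?_)
  have hx0 : 0 < x (Fin.last n) := hx
  have hz2 : ‖(z.2 : E (n + 1))‖ = 1 := by simp
  have h1 : |Z (n + 1) k (reflect (x - join z.1 0) z.2) v| ≤ C := by
    simpa [norm_reflect] using hC (reflect (x - join z.1 0) z.2)
  rw [h.expand _ (hf.mem_harm z.1) z.2, Finset.mul_sum]
  refine (norm_sum_le _ _).trans (Finset.sum_le_sum fun i _ => ?_)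
  have h2 : |polyFun (n + 1) (P i) z.2| ≤ B i := by simpa using hB i z.2
  simp only [poissonKernel, ratKer, ← MvPolynomial.C_1, polyFun_C, one_mul, Real.norm_eq_abs, abs_mul,
    abs_inv, abs_pow, abs_norm, abs_of_pos hx0, div_eq_mul_inv]
  calc _ = |cConst (n + 1) k| * x (Fin.last n) * (‖x - join z.1 0‖ ^ (n + 1))⁻¹ *
        |f z.1 (w i)| * (|Z (n + 1) k (reflect (x - join z.1 0) z.2) v| *
          |polyFun (n + 1) (P i) z.2|) := by ring
    _ ≤ |cConst (n + 1) k| * x (Fin.last n) * (‖x - join z.1 0‖ ^ (n + 1))⁻¹ *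
        |f z.1 (w i)| * (C * B i) := by gcongr
    _ = _ := by ring

end BoundaryData

/-! ### The finite measure ν on the boundary -/

section PoissonMeasure

variable {n k : ℕ}

/-- The Poisson kernel at height one, as a measure. -/
def poissonMeasure (n k : ℕ) : Measure (E n) :=
  (volume : Measure (E n)).withDensity fun s => ENNReal.ofReal (weight n k s)

lemma measurable_weight : Measurable (weight n k) :=
  (((continuous_join_left 1).measurable.norm.pow_const _).inv).const_mul _

instance : IsFiniteMeasure (poissonMeasure n k) :=
  isFiniteMeasure_withDensity_ofReal (integrable_inv_norm_join_pow.const_mul _).2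

lemma integral_poissonMeasure (hn : 2 ≤ n) (g : E n → ℝ) :
    ∫ s, g s ∂(poissonMeasure n k) = ∫ s, weight n k s * g s := by
  rw [poissonMeasure, integral_withDensity_eq_integral_toReal_smul
    measurable_weight.ennreal_ofReal (ae_of_all _ fun _ => ENNReal.ofReal_lt_top)]
  congr 1
  funext s
  have : 0 ≤ weight n k s := mul_nonneg (cConst_pos hn).le (by positivity)
  rw [ENNReal.toReal_ofReal this, smul_eq_mul]

end PoissonMeasure

/-! ### Norm bounds and convergence of the slices -/

section Slices

variable {n k : ℕ} {p : ℝ≥0∞} {f : E n → E (n + 1) → ℝ}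

/-- The transformation `(x', u) ↦ (x' - h, R_z u)`. -/
lemma measurePreserving_sub_reflect (h : E n) (z : E (n + 1)) :
    MeasurePreserving (fun q : E n × Metric.sphere (0 : E (n + 1)) 1 =>
      (q.1 - h, sphereMap (reflectIso z) q.2))
      ((volume : Measure (E n)).prod (surf (n + 1)))
      ((volume : Measure (E n)).prod (surf (n + 1))) :=
  (measurePreserving_sub_right volume h).prod (measurePreserving_sphereMap (reflectIso z))

lemma measurable_sphere_restrict {F : E n → E (n + 1) → ℝ}
    (hF : Measurable fun z : E n × E (n + 1) => F z.1 z.2) :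
    Measurable fun z : E n × Metric.sphere (0 : E (n + 1)) 1 => F z.1 z.2 :=
  hF.comp (measurable_fst.prodMk (measurable_subtype_coe.comp measurable_snd))

lemma lintegral_sub_reflect {F : E n → E (n + 1) → ℝ}
    (hF : Measurable fun z : E n × E (n + 1) => F z.1 z.2) (hp : 1 ≤ p) (hp' : p ≠ ∞) (h : E n)
    (z : E (n + 1)) :
    ∫⁻ q : E n × Metric.sphere (0 : E (n + 1)) 1, ‖F (q.1 - h) (reflect z q.2)‖ₑ ^ p.toReal
      ∂((volume : Measure (E n)).prod (surf (n + 1))) = normLp n p F ^ p.toReal := by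
  rw [normLp_rpow hp hp', ← (measurePreserving_sub_reflect h z).lintegral_comp
    ((measurable_sphere_restrict hF).enorm.pow_const _)]
  simp only [sphereMap, reflectIso_apply]

lemma measurable_reflect_join : Measurable fun z : E (n + 1) × E n => reflect (join z.2 1) z.1 :=
  measurable_reflect.comp
    (((continuous_join_left 1).measurable.comp measurable_snd).prodMk measurable_fst)

/-- Averages over the Poisson measure are bounded in the mean. -/
lemma normLp_integral_rpow_le {K : E n → E n → E (n + 1) → ℝ}
    (hK : Measurable fun z : (E n × E (n + 1)) × E n => K z.2 z.1.1 z.1.2) (hp : 1 ≤ p)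
    (hp' : p ≠ ∞) (ν : Measure (E n)) [IsFiniteMeasure ν] :
    normLp n p (fun x v => ∫ s, K s x v ∂ν) ^ p.toReal ≤
      ν univ ^ (p.toReal - 1) * ∫⁻ s, normLp n p (K s) ^ p.toReal ∂ν := by
  rw [normLp_rpow hp hp']
  simp only [normLp_rpow hp hp']
  have hm : Measurable fun z : (E n × Metric.sphere (0 : E (n + 1)) 1) × E n =>
      K z.2 z.1.1 z.1.2 :=
    hK.comp (((measurable_fst.comp measurable_fst).prodMk
      (measurable_subtype_coe.comp (measurable_snd.comp measurable_fst))).prodMk measurable_snd)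
  exact lintegral_enorm_integral_rpow_le ((volume : Measure (E n)).prod (surf (n + 1))) ν
    (one_le_toReal hp hp')
    (K := fun (q : E n × Metric.sphere (0 : E (n + 1)) 1) s => K s q.1 q.2) hm

lemma poissonIntegral_join (hn : 2 ≤ n) (hf : ∀ t, f t ∈ Harm (n + 1) k) (x' : E n) {y : ℝ}
    (hy : 0 < y) (v : E (n + 1)) : poissonIntegral n k f (join x' y) v =
      ∫ s, f (x' - y • s) (reflect (join s 1) v) ∂(poissonMeasure n k) := by
  rw [poissonIntegral_join_eq hf x' hy, integral_poissonMeasure hn]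

lemma MemLpHarm.measurable_kernel (hf : MemLpHarm n k p f) (y : ℝ) :
    Measurable fun z : (E n × E (n + 1)) × E n =>
      f (z.1.1 - y • z.2) (reflect (join z.2 1) z.1.2) := by
  refine hf.measurable_uncurry.comp (Measurable.prodMk ?_ ?_)
  · exact (measurable_fst.comp measurable_fst).sub (measurable_snd.const_smul y)
  · exact measurable_reflect_join.comp ((measurable_snd.comp measurable_fst).prodMk measurable_snd)

/-- Since 1 + |x' - y s| ≤ 2(1 + |x'| + y) |(s, 1)|, the density of ν is dominated by a translated
and dilated copy of the weight for which the node values of f are integrable. -/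
lemma MemLpHarm.integrable_kernel (hp : 1 ≤ p) (hp' : p ≠ ∞) (hf : MemLpHarm n k p f) (x' : E n)
    {y : ℝ} (hy : 0 < y) (v : E (n + 1)) :
    Integrable (fun s => f (x' - y • s) (reflect (join s 1) v)) (poissonMeasure n k) := by
  rw [poissonMeasure, integrable_withDensity_iff_integrable_smul'
    measurable_weight.ennreal_ofReal (ae_of_all _ fun _ => ENNReal.ofReal_lt_top)]
  obtain ⟨N, w, P, h⟩ := exists_isNodes (n + 1) k
  choose B hB0 hB using fun i => exists_sphere_bound (mem_Harm_iff.2 ⟨P i, h.harm i, rfl⟩)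
  have hi := fun i => ((((hf.weightIntegrable hp hp' 1 (w i)).norm.comp_sub_left x').comp_smul
    hy.ne').const_mul (|cConst (n + 1) k| * (2 * (1 + ‖x'‖ + y)) ^ (n + 1) * (B i * ‖v‖ ^ k)))
  have hm : Measurable fun s => f (x' - y • s) (reflect (join s 1) v) :=
    (hf.measurable_kernel y).comp (measurable_const.prodMk measurable_id :
      Measurable fun s : E n => ((x', v), s))
  refine (integrable_finsetSum Finset.univ fun i _ => hi i).mono'
    (measurable_weight.ennreal_ofReal.ennreal_toReal.smul hm).aestronglyMeasurable
    (ae_of_all _ fun s => ?_)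
  have hj : 0 < ‖join s 1‖ := by linarith [one_le_norm_join s]
  have h1 : 1 + ‖x' - y • s‖ ≤ 2 * (1 + ‖x'‖ + y) * ‖join s 1‖ := by
    have e1 := norm_sub_le x' (y • s)
    rw [norm_smul, Real.norm_of_nonneg hy.le] at e1
    have e2 := one_add_norm_le s
    nlinarith [norm_nonneg s, norm_nonneg x']
  have h2 : (‖join s 1‖ ^ (n + 1))⁻¹ ≤
      (2 * (1 + ‖x'‖ + y)) ^ (n + 1) * ((1 + ‖x' - y • s‖) ^ (n + 1))⁻¹ := by
    rw [← div_eq_mul_inv, inv_le_iff_one_le_mul₀ (by positivity), ← mul_div_right_comm,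
      one_le_div (by positivity), ← mul_pow]
    gcongr
  have h3 : (ENNReal.ofReal (weight n k s)).toReal ≤
      |cConst (n + 1) k| * ((2 * (1 + ‖x'‖ + y)) ^ (n + 1) * ((1 + ‖x' - y • s‖) ^ (n + 1))⁻¹) := by
    rw [ENNReal.toReal_ofReal', max_le_iff]
    refine ⟨?_, by positivity⟩
    rw [weight]
    gcongr
    exact le_abs_self _
  rw [norm_smul, Real.norm_of_nonneg ENNReal.toReal_nonneg, h.expand _ (hf.mem_harm _)]
  refine (mul_le_mul_of_nonneg_left (norm_sum_le _ _) ENNReal.toReal_nonneg).trans ?_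
  rw [Finset.mul_sum]
  refine Finset.sum_le_sum fun i _ => ?_
  have h4 : |polyFun (n + 1) (P i) (reflect (join s 1) v)| ≤ B i * ‖v‖ ^ k := by
    simpa [norm_reflect] using hB i (reflect (join s 1) v)
  simp only [norm_mul, Real.norm_eq_abs, one_mul]
  rw [abs_of_pos (by positivity : 0 < ((1 + ‖x' - y • s‖) ^ (n + 1))⁻¹)]
  calc _ ≤ |cConst (n + 1) k| * ((2 * (1 + ‖x'‖ + y)) ^ (n + 1) *
        ((1 + ‖x' - y • s‖) ^ (n + 1))⁻¹) * (|f (x' - y • s) (w i)| * (B i * ‖v‖ ^ k)) := by gcongr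
    _ = _ := by ring

lemma integrable_comp_reflect {h : E (n + 1) → ℝ} (hh : h ∈ Harm (n + 1) k) (v : E (n + 1)) :
    Integrable (fun s => h (reflect (join s 1) v)) (poissonMeasure n k) := by
  obtain ⟨C, hC0, hC⟩ := exists_sphere_bound hh
  have hm : Measurable fun s : E n => h (reflect (join s 1) v) :=
    (Harm.continuous hh).measurable.comp (measurable_reflect_join.comp
      (measurable_const.prodMk measurable_id : Measurable fun s : E n => (v, s)))
  refine (integrable_const (C * ‖v‖ ^ k)).mono' hm.aestronglyMeasurable (ae_of_all _ fun s => ?_)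
  simpa [norm_reflect] using hC (reflect (join s 1) v)

/-- Every function in the average has the norm of f, so Jensen's inequality gives the mass of ν as
the constant. For k ≥ 1 this mass exceeds 1: the reproducing identity holds only together with the
reflections. -/
lemma MemLpHarm.normLp_poissonIntegral_le (hn : 2 ≤ n) (hp : 1 ≤ p) (hp' : p ≠ ∞)
    (hf : MemLpHarm n k p f) {y : ℝ} (hy : 0 < y) :
    normLp n p (fun x' v => poissonIntegral n k f (join x' y) v) ≤
      poissonMeasure n k univ * normLp n p f := by
  have hr := one_le_toReal hp hp'
  have hr0 : 0 < p.toReal := by linarith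
  simp only [poissonIntegral_join hn hf.mem_harm _ hy]
  rw [← ENNReal.rpow_le_rpow_iff hr0, ENNReal.mul_rpow_of_nonneg _ _ hr0.le]
  refine (normLp_integral_rpow_le (hf.measurable_kernel y) hp hp' _).trans_eq ?_
  have h1 : ∀ s : E n, normLp n p (fun x v => f (x - y • s) (reflect (join s 1) v)) ^ p.toReal =
      normLp n p f ^ p.toReal := fun s => by
    rw [normLp_rpow hp hp', lintegral_sub_reflect hf.measurable_uncurry hp hp']
  simp only [h1, lintegral_const]
  rw [mul_comm (normLp n p f ^ p.toReal), ← mul_assoc]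
  congr 1
  -- Adding the exponents p - 1 and 1 in `ℝ≥0∞` requires a nonzero base.
  rcases eq_or_ne (poissonMeasure n k univ) 0 with h0 | h0
  · rw [h0, mul_zero, ENNReal.zero_rpow_of_pos hr0]
  · conv_lhs => rw [← ENNReal.rpow_one (poissonMeasure n k univ), ← ENNReal.rpow_mul, one_mul]
    rw [← ENNReal.rpow_add _ _ h0 (measure_ne_top _ _), sub_add_cancel]

/-- Continuity of the translation action on L^p for finite p; the element -h acts as a ↦ a(· - h).
-/
lemma tendsto_eLpNorm_sub_translate (hp : 1 ≤ p) (hp' : p ≠ ∞) {a : E n → ℝ}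
    (ha : MemLp a p volume) :
    Tendsto (fun h : E n => eLpNorm (fun x => a (x - h) - a x) p volume) (𝓝 0) (𝓝 0) := by
  have : Fact (1 ≤ p) := ⟨hp⟩
  have : Fact (p ≠ ∞) := ⟨hp'⟩
  have hc : Continuous fun h : E n => DomAddAct.mk (-h) +ᵥ ha.toLp a :=
    (DomAddAct.continuous_mk.comp continuous_neg).vadd continuous_const
  have h1 := (hc.tendsto 0).edist (tendsto_const_nhds (x := ha.toLp a))
  have h0 : edist (DomAddAct.mk (-(0 : E n)) +ᵥ ha.toLp a) (ha.toLp a) = 0 := by simp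
  rw [h0] at h1
  refine h1.congr fun h => ?_
  rw [DomAddAct.mk_vadd_toLp, Lp.edist_toLp_toLp]
  refine eLpNorm_congr_ae (ae_of_all _ fun x => ?_)
  simp [vadd_eq_add, sub_eq_neg_add]

/-- Interpolation reduces the claim to the scalar functions f(·, w_i): the cardinal polynomials are
bounded on the sphere, and a function of x' alone has its L^p norm multiplied by a power of the area
of the sphere. -/
lemma MemLpHarm.tendsto_normLp_sub_translate (hp : 1 ≤ p) (hp' : p ≠ ∞)
    (hf : MemLpHarm n k p f) :
    Tendsto (fun h : E n => normLp n p fun x v => f (x - h) v - f x v) (𝓝 0) (𝓝 0) := by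
  obtain ⟨N, w, P, hw⟩ := exists_isNodes (n + 1) k
  choose B hB0 hB using fun i => exists_sphere_bound (mem_Harm_iff.2 ⟨P i, hw.harm i, rfl⟩)
  have ha := fun i => hf.memLp_slice hp hp' (w i)
  set c := surf (n + 1) univ ^ (1 / p).toReal with hc
  have hc' : c ≠ ∞ := ENNReal.rpow_ne_top_of_nonneg ENNReal.toReal_nonneg (measure_ne_top _ _)
  have key : Tendsto (fun h : E n => ∑ i, ENNReal.ofReal (B i) *
      (c * eLpNorm (fun x => f (x - h) (w i) - f x (w i)) p volume)) (𝓝 0) (𝓝 0) := by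
    have := tendsto_finsetSum Finset.univ fun i (_ : i ∈ Finset.univ) =>
      ENNReal.Tendsto.const_mul (ENNReal.Tendsto.const_mul
        (tendsto_eLpNorm_sub_translate hp hp' (ha i)) (Or.inr hc'))
        (Or.inr (ENNReal.ofReal_ne_top (r := B i)))
    simpa using this
  refine tendsto_of_tendsto_of_tendsto_of_le_of_le tendsto_const_nhds key (fun _ => zero_le)
    fun h => ?_
  have hD : ∀ i, AEStronglyMeasurable (fun x => f (x - h) (w i) - f x (w i)) volume := fun i =>
    ((ha i).1.comp_measurePreserving (measurePreserving_sub_right volume h)).sub (ha i).1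
  have hP : ∀ i, AEStronglyMeasurable
      (fun u : Metric.sphere (0 : E (n + 1)) 1 => polyFun (n + 1) (P i) u) (surf (n + 1)) := fun i =>
    ((continuous_polyFun (P i)).comp continuous_subtype_val).aestronglyMeasurable
  have e : (fun q : E n × Metric.sphere (0 : E (n + 1)) 1 => f (q.1 - h) q.2 - f q.1 q.2) =
      ∑ i, fun q => (f (q.1 - h) (w i) - f q.1 (w i)) * polyFun (n + 1) (P i) q.2 := by
    funext q
    rw [Finset.sum_apply, hw.expand _ (hf.mem_harm (q.1 - h)), hw.expand _ (hf.mem_harm q.1),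
      ← Finset.sum_sub_distrib]
    exact Finset.sum_congr rfl fun i _ => by ring
  rw [normLp, e]
  refine (eLpNorm_sum_le (fun i _ => (hD i).comp_fst.mul (hP i).comp_snd) hp).trans
    (Finset.sum_le_sum fun i _ => ?_)
  refine (eLpNorm_le_mul_eLpNorm_of_ae_le_mul (c := B i)
    (g := fun q : E n × Metric.sphere (0 : E (n + 1)) 1 => f (q.1 - h) (w i) - f q.1 (w i))
    (ae_of_all _ fun q => ?_) p).trans_eq ?_
  · have hq : |polyFun (n + 1) (P i) q.2| ≤ B i := by simpa using hB i q.2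
    rw [Pi.mul_apply, norm_mul, mul_comm, Real.norm_eq_abs (polyFun _ _ _)]
    gcongr
  · congr 1
    have h2 : AEStronglyMeasurable (fun x => f (x - h) (w i) - f x (w i))
        (Measure.map Prod.fst ((volume : Measure (E n)).prod (surf (n + 1)))) := by
      rw [Measure.map_fst_prod]
      exact (hD i).smul_measure _
    have h3 := eLpNorm_map_measure (p := p) h2 measurable_fst.aemeasurable
    rw [Measure.map_fst_prod, eLpNorm_smul_measure_of_ne_top hp'] at h3
    exact h3.symm

/-- Because ν reproduces f(x', ·), the difference is an average of reflected translation
differences. Reflections do not change the norm, so Jensen's inequality leaves ∫ ω(y s) dν(s), where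
ω is the p-th power of the modulus of continuity under translation. It is bounded by (2‖f‖)^p and
tends to zero at 0, so dominated convergence applies. -/
lemma MemLpHarm.tendsto_normLp_poissonIntegral_sub (hn : 2 ≤ n) (hp : 1 ≤ p) (hp' : p ≠ ∞)
    (hf : MemLpHarm n k p f) :
    Tendsto (fun y : ℝ => normLp n p fun x' v => poissonIntegral n k f (join x' y) v - f x' v)
      (𝓝[>] 0) (𝓝 0) := by
  have hr := one_le_toReal hp hp'
  have hr0 : 0 < p.toReal := by linarith
  set ν := poissonMeasure n k with hν
  set ω : E n → ℝ≥0∞ := fun h => normLp n p (fun x v => f (x - h) v - f x v) ^ p.toReal with hω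
  have hmu := hf.measurable_uncurry
  have hmd : Measurable fun z : (E n × E (n + 1)) × E n =>
      f (z.1.1 - z.2) z.1.2 - f z.1.1 z.1.2 :=
    (hmu.comp (((measurable_fst.comp measurable_fst).sub measurable_snd).prodMk
      (measurable_snd.comp measurable_fst))).sub (hmu.comp measurable_fst)
  have hωm : Measurable ω := by
    simp only [hω, normLp_rpow hp hp']
    have h1 : Measurable fun z : E n × (E n × Metric.sphere (0 : E (n + 1)) 1) =>
        f (z.2.1 - z.1) z.2.2 - f z.2.1 z.2.2 :=
      hmd.comp ((((measurable_fst.comp measurable_snd).prodMk (measurable_subtype_coe.comp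
        (measurable_snd.comp measurable_snd)))).prodMk measurable_fst)
    exact (h1.enorm.pow_const p.toReal).lintegral_prod_right'
  have hms := measurable_sphere_restrict hmu
  have hωb : ∀ h, ω h ≤ (normLp n p f + normLp n p f) ^ p.toReal := fun h => by
    refine ENNReal.rpow_le_rpow ?_ hr0.le
    have h0 := measurePreserving_sub_reflect h (0 : E (n + 1))
    have h1 : normLp n p (fun x v => f (x - h) v) = normLp n p f := by
      -- The reflection in z = 0 is the identity, since its correction term is a multiple of 0; only
      -- the translation acts.
      have := lintegral_sub_reflect hmu hp hp' h 0
      simp only [reflect, smul_zero, sub_zero] at this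
      rw [← normLp_rpow hp hp' fun x v => f (x - h) v] at this
      exact ENNReal.rpow_left_injective hr0.ne' this
    have hm1 : Measurable fun z : E n × E (n + 1) => f (z.1 - h) z.2 :=
      hmu.comp ((measurable_fst.sub_const h).prodMk measurable_snd)
    have h2 := eLpNorm_sub_le (μ := (volume : Measure (E n)).prod (surf (n + 1)))
      (measurable_sphere_restrict (F := fun x v => f (x - h) v) hm1).aestronglyMeasurable hms.aestronglyMeasurable hp
    exact h2.trans_eq (congrArg (· + normLp n p f) h1)
  have hωt : Tendsto ω (𝓝 0) (𝓝 0) := by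
    have := (ENNReal.continuous_rpow_const (y := p.toReal)).tendsto 0
    rw [ENNReal.zero_rpow_of_pos hr0] at this
    exact this.comp (hf.tendsto_normLp_sub_translate hp hp')
  have hdom : Tendsto (fun y : ℝ => ∫⁻ s, ω (y • s) ∂ν) (𝓝[>] 0) (𝓝 0) := by
    have := tendsto_lintegral_filter_of_dominated_convergence (μ := ν) (l := 𝓝[>] (0 : ℝ))
      (F := fun y s => ω (y • s)) (f := fun _ => 0)
      (fun _ => (normLp n p f + normLp n p f) ^ p.toReal)
      (Eventually.of_forall fun y => hωm.comp (measurable_const_smul y))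
      (Eventually.of_forall fun y => ae_of_all _ fun s => hωb _) ?_ (ae_of_all _ fun s => ?_)
    · simpa using this
    · rw [lintegral_const]
      have := hf.normLp_lt_top.ne
      exact ENNReal.mul_ne_top (ENNReal.rpow_ne_top_of_nonneg hr0.le
        (ENNReal.add_ne_top.2 ⟨this, this⟩)) (measure_ne_top _ _)
    · refine hωt.comp ?_
      have : Continuous fun y : ℝ => y • s := by fun_prop
      have h1 := this.tendsto 0
      rw [zero_smul] at h1
      exact h1.mono_left nhdsWithin_le_nhds
  have hbound : ∀ y : ℝ, 0 < y →
      normLp n p (fun x' v => poissonIntegral n k f (join x' y) v - f x' v) ^ p.toReal ≤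
        ν univ ^ (p.toReal - 1) * ∫⁻ s, ω (y • s) ∂ν := by
    intro y hy
    have e : ∀ x' v, poissonIntegral n k f (join x' y) v - f x' v =
        ∫ s, f (x' - y • s) (reflect (join s 1) v) - f x' (reflect (join s 1) v) ∂ν := by
      intro x' v
      rw [integral_sub (hf.integrable_kernel hp hp' x' hy v)
        (integrable_comp_reflect (hf.mem_harm x') v), ← poissonIntegral_join hn hf.mem_harm x' hy,
        integral_poissonMeasure hn, integral_weight_mul hn (hf.mem_harm x')]
    simp only [e]
    refine (normLp_integral_rpow_le ?_ hp hp' ν).trans_eq ?_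
    · exact (hf.measurable_kernel y).sub (hmu.comp ((measurable_fst.comp measurable_fst).prodMk
        (measurable_reflect_join.comp ((measurable_snd.comp measurable_fst).prodMk
          measurable_snd))))
    · congr 1
      refine lintegral_congr fun s => ?_
      have hms : Measurable fun z : E n × E (n + 1) => f (z.1 - y • s) z.2 - f z.1 z.2 :=
        hmd.comp (measurable_id.prodMk measurable_const :
          Measurable fun z : E n × E (n + 1) => (z, y • s))
      -- Here the translation is by 0 and only the reflection acts.
      have := lintegral_sub_reflect (F := fun x v => f (x - y • s) v - f x v) hms hp hp' 0
        (join s 1)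
      simp only [sub_zero] at this
      rw [normLp_rpow hp hp']
      exact this
  have hlim : Tendsto (fun y : ℝ => normLp n p
      (fun x' v => poissonIntegral n k f (join x' y) v - f x' v) ^ p.toReal) (𝓝[>] 0) (𝓝 0) := by
    have hu := ENNReal.Tendsto.const_mul (a := ν univ ^ (p.toReal - 1)) hdom
      (Or.inr (ENNReal.rpow_ne_top_of_nonneg (by linarith) (measure_ne_top _ _)))
    rw [mul_zero] at hu
    refine tendsto_of_tendsto_of_tendsto_of_le_of_le' tendsto_const_nhds hu
      (Eventually.of_forall fun _ => zero_le) ?_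
    filter_upwards [self_mem_nhdsWithin] with y hy using hbound y hy
  have h1 := ((ENNReal.continuous_rpow_const (y := p.toReal⁻¹)).tendsto 0).comp hlim
  rw [ENNReal.zero_rpow_of_pos (by positivity)] at h1
  refine h1.congr fun y => ?_
  rw [Function.comp_apply, ENNReal.rpow_rpow_inv hr0.ne']

lemma MemLpHarm.poissonIntegral (hn : 2 ≤ n) (hp : 1 ≤ p) (hp' : p ≠ ∞) (hf : MemLpHarm n k p f)
    {y : ℝ} (hy : 0 < y) :
    MemLpHarm n k p fun x' v => poissonIntegral n k f (join x' y) v := by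
  obtain ⟨N, w, P, h⟩ := exists_isNodes (n + 1) k
  have ha := fun i => hf.weightIntegrable hp hp' (cConst (n + 1) k) (w i)
  have hmem : ∀ x' : E n, join x' y ∈ upperHalf n := fun x' => by simpa [upperHalf] using hy
  refine ⟨fun x' => h.poissonIntegral_mem_Harm hf.mem_harm ha (hmem x'), ?_, ?_⟩
  · have h1 := (h.contDiffOn_poissonIntegral hf.mem_harm ha).continuousOn
    have h2 : Continuous fun z : E n × Metric.ball (0 : E (n + 1)) 1 =>
        (join z.1 y, (z.2 : E (n + 1))) :=
      ((continuous_join_left y).comp continuous_fst).prodMk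
        (continuous_subtype_val.comp continuous_snd)
    exact (h1.comp_continuous h2 fun z => ⟨hmem z.1, mem_univ _⟩).measurable
  · exact (hf.normLp_poissonIntegral_le hn hp hp' hy).trans_lt
      (ENNReal.mul_lt_top (measure_lt_top _ _) hf.normLp_lt_top)

end Slices

end

end Bosonic

/-! ### The Dirichlet problem -/

theorem mainTheorem2 (n k : ℕ) (hn : 2 ≤ n) (hk : 1 ≤ k) :
    ∃ C : ℝ≥0, 0 < C ∧
      ∀ (p : ℝ≥0∞), 1 ≤ p → p ≠ ∞ →
      ∀ f : Bosonic.E n → Bosonic.E (n + 1) → ℝ, Bosonic.MemLpHarm n k p f →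
        -- the Poisson integral converges absolutely
        (∀ x ∈ Bosonic.upperHalf n, ∀ v : Bosonic.E (n + 1),
          Integrable
            (fun z : Bosonic.E n × Metric.sphere (0 : Bosonic.E (n + 1)) 1 =>
              Bosonic.poissonKernel n k x z.1 z.2 v * f z.1 z.2)
            ((volume : Measure (Bosonic.E n)).prod (Bosonic.surf (n + 1)))) ∧
        -- it is a smooth function with values in the harmonic polynomials
        (∀ x ∈ Bosonic.upperHalf n,
          (fun v => Bosonic.poissonIntegral n k f x v) ∈ Bosonic.Harm (n + 1) k) ∧
        ContDiffOn ℝ (⊤ : ℕ∞)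
          (fun z : Bosonic.E (n + 1) × Bosonic.E (n + 1) => Bosonic.poissonIntegral n k f z.1 z.2)
          (Bosonic.upperHalf n ×ˢ univ) ∧
        -- and a null solution of the bosonic Laplacian
        (∀ x ∈ Bosonic.upperHalf n, ∀ v : Bosonic.E (n + 1),
          Bosonic.bosonicLaplacian (n + 1) k (Bosonic.poissonIntegral n k f) x v = 0) ∧
        -- uniform bound for the slices
        (∀ y : ℝ, 0 < y →
          Bosonic.MemLpHarm n k p (fun x' v => Bosonic.poissonIntegral n k f (Bosonic.join x' y) v) ∧
          Bosonic.normLp n p (fun x' v => Bosonic.poissonIntegral n k f (Bosonic.join x' y) v) ≤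
            C * Bosonic.normLp n p f) ∧
        -- convergence of the slices to the boundary data
        Tendsto
          (fun y : ℝ => Bosonic.normLp n p
            (fun x' v => Bosonic.poissonIntegral n k f (Bosonic.join x' y) v - f x' v))
          (𝓝[>] 0) (𝓝 0) := by
  obtain ⟨N, w, P, h⟩ := Bosonic.exists_isNodes (n + 1) k
  -- The mass of ν is the constant needed; adding 1 makes it positive without computing the mass.
  refine ⟨(Bosonic.poissonMeasure n k univ).toNNReal + 1, by positivity, fun p hp hp' f hf => ?_⟩
  have ha := fun i => hf.weightIntegrable hp hp' (Bosonic.cConst (n + 1) k) (w i)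
  refine ⟨fun x hx v => hf.integrable_poissonKernel_mul hp hp' hx v,
    fun x hx => h.poissonIntegral_mem_Harm hf.mem_harm ha hx,
    h.contDiffOn_poissonIntegral hf.mem_harm ha,
    fun x hx v => h.bosonicLaplacian_poissonIntegral hn hk hf.mem_harm ha hx v,
    fun y hy => ⟨hf.poissonIntegral hn hp hp' hy, ?_⟩,
    hf.tendsto_normLp_poissonIntegral_sub hn hp hp'⟩
  refine (hf.normLp_poissonIntegral_le hn hp hp' hy).trans ?_
  gcongr
  rw [ENNReal.coe_add, ENNReal.coe_toNNReal (measure_ne_top _ _)]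
  exact le_self_add
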